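/- Let $(M,g)$ be a semi-Riemannian manifold: $M$ is a smooth $n$-dimensional manifold and $g$ a smooth nondegenerate symmetric two-form on $M$ of constant index $\nu$. Let $D$ be the Levi-Civita connection of $g$, $\tfrac{D}{dx}$ the covariant derivative along curves, and $R$ the curvature with the sign convention $R(X,Y)Z=D_YD_XZ-D_XD_YZ+D_{[X,Y]}Z$. Let $V\colon[0,1]\times M\to\mathbb R$ be smooth, and write $\nabla V(x,\cdot)$ for the $g$-gradient of $V(x,\cdot)$. Let $\gamma\colon[0,1]\to M$ be a $p$-geodesic (perturbed geodesic), i.e. a smooth curve with $$\tfrac{D}{dx}\gamma'(x)+\nabla V(x,\gamma(x))=0 .$$ Let $H^1_0(\gamma)$ be the space of $H^1$ vector fields $\xi$ along $\gamma$ with $\xi(0)=\xi(1)=0$, with its usual Hilbert space topology (given by the $H^1$ norm of the expressions of $\xi$ in finitely many charts that cover $\gamma$), and for $\xi,\eta\in H^1_0(\gamma)$ put $$H_\gamma(\xi,\eta)=\int_0^1 g\big(\tfrac{D}{dx}\xi,\tfrac{D}{dx}\eta\big)\,dx-\int_0^1 g\big(R(\gamma',\xi)\gamma'+D_{\xi}\nabla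 V(x,\gamma),\eta\big)\,dx,\qquad h_\gamma(\xi)=H_\gamma(\xi,\xi).$$ Then: 1. The integrand of $H_\gamma(\xi,\eta)$ is integrable for all $\xi,\eta\in H^1_0(\gamma)$, and $h_\gamma$ is the Hessian at $\gamma$ of the energy functional $E(\alpha)=\int_0^1\frac12 g(\alpha',\alpha')\,dx-\int_0^1V(x,\alpha(x))\,dx$ on paths from $\gamma(0)$ to $\gamma(1)$: for every smooth variation $(\alpha_s)_{|s|<\varepsilon}$ of $\gamma=\alpha_0$ with fixed end points and variation field $\xi=\partial_s\alpha_s|_{s=0}$, the function $s\mapsto E(\alpha_s)$ is twice differentiable at $0$ and its second derivative there is $h_\gamma(\xi)$. 2. $h_\gamma$ is a Fredholm quadratic form on $H^1_0(\gamma)$: there is a bounded symmetric bilinear form $b$ on $H^1_0(\gamma)$ with $h_\gamma(\xi)=b(\xi,\xi)$ such that the operator $\xi\mapsto b(\xi,\cdot)$ from $H^1_0(\gamma)$ to its dual is Fredholm (finite-dimensional kernel, closed range, finite-dimensional cokernel). 3. $h_\gamma$ is nondegenerate (that is, $\xi\mapsto b(\xi,\cdot)$ is an isomorphism of $H^1_0(\gamma)$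 onto its dual) if and only if $1$ is not a conjugate instant, i.e. there is no nonzero smooth vector field $\xi$ along $\gamma$ with $\xi(0)=\xi(1)=0$ and $$\tfrac{D^2}{dx^2}\xi+R(\gamma',\xi)\gamma'+D_{\xi}\nabla V(x,\gamma)=0\quad\text{on }[0,1].$$ -/

import Mathlib

open Set Filter Topology MeasureTheory
open scoped Manifold ContDiff InnerProductSpace

noncomputable section

set_option linter.unusedSectionVars false

namespace SemiRiem

/-! ### Fredholm and nondegenerate quadratic forms -/

section QuadraticForms

variable {H : Type*} [NormedAddCommGroup H] [InnerProductSpace ℝ H]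

/-- `b` is a bounded symmetric bilinear form with `q u = b (u, u)`. -/
def IsPolarForm (q : H → ℝ) (b : H →L[ℝ] StrongDual ℝ H) : Prop :=
  (∀ u v, b u v = b v u) ∧ ∀ u, q u = b u u

/-- `q` is a bounded quadratic form whose associated operator `u ↦ b (u, ·)` from `H` to its dual
is Fredholm: finite dimensional kernel, closed range, finite dimensional cokernel. -/
def IsFredholmForm (q : H → ℝ) : Prop :=
  ∃ b : H →L[ℝ] StrongDual ℝ H, IsPolarForm q b ∧
    FiniteDimensional ℝ (LinearMap.ker (b : H →ₗ[ℝ] StrongDual ℝ H)) ∧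
    IsClosed (range b) ∧
    FiniteDimensional ℝ (StrongDual ℝ H ⧸ LinearMap.range (b : H →ₗ[ℝ] StrongDual ℝ H))

/-- `q` is a bounded quadratic form such that `u ↦ b (u, ·)` is a (topological) isomorphism of `H`
onto its dual. -/
def IsNondegenerateForm (q : H → ℝ) : Prop :=
  ∃ b : H ≃L[ℝ] StrongDual ℝ H, IsPolarForm q (b : H →L[ℝ] StrongDual ℝ H)

end QuadraticForms

/-! ### Semi-Riemannian metrics, Levi-Civita connection and curvature -/

/-- The Euclidean model space. -/
abbrev Eucl (n : ℕ) : Type := EuclideanSpace ℝ (Fin n)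

section Metric

variable {n ν : ℕ} {M : Type*} [TopologicalSpace M] [ChartedSpace (Eucl n) M]
  [IsManifold (𝓡 n) ∞ M]

variable (n ν M) in
/-- A semi-Riemannian metric: a smooth nondegenerate symmetric two-form of constant index `ν`
(the maximal dimension of a subspace on which the form is negative definite). -/
structure SemiRiemannianMetric where
  val (p : M) : TangentSpace (𝓡 n) p →L[ℝ] TangentSpace (𝓡 n) p →L[ℝ] ℝ
  symm (p : M) (u v : TangentSpace (𝓡 n) p) : val p u v = val p v u
  nondegenerate (p : M) (u : TangentSpace (𝓡 n) p) (hu : ∀ v, val p u v = 0) : u = 0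
  index (p : M) : IsGreatest {k : ℕ | ∃ W : Submodule ℝ (TangentSpace (𝓡 n) p),
    Module.finrank ℝ W = k ∧ ∀ w ∈ W, w ≠ 0 → val p w w < 0} ν
  contMDiff : ContMDiff (𝓡 n) ((𝓡 n).prod 𝓘(ℝ, Eucl n →L[ℝ] Eucl n →L[ℝ] ℝ)) ∞
    (fun p ↦ Bundle.TotalSpace.mk' (Eucl n →L[ℝ] Eucl n →L[ℝ] ℝ)
      (E := fun p : M ↦ TangentSpace (𝓡 n) p →L[ℝ] TangentSpace (𝓡 n) p →L[ℝ] ℝ) p (val p))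

variable (g : SemiRiemannianMetric n ν M)

/-- The metric in the chart at `c`: the bilinear form on the model space at the coordinate `y`. -/
def metricIn (c : M) (y : Eucl n) : Eucl n →L[ℝ] Eucl n →L[ℝ] ℝ :=
  let p := (extChartAt (𝓡 n) c).symm y
  let b : Eucl n →L[ℝ] Eucl n →L[ℝ] ℝ := g.val p
  b.bilinearComp (tangentCoordChange (𝓡 n) c p p) (tangentCoordChange (𝓡 n) c p p)

/-- The Christoffel symbols of the Levi-Civita connection in the chart at `c`, as a vector-valued
form: `Γ (u, v)` is the solution of
`2 g (Γ (u, v), w) = (∂_u g) (v, w) + (∂_v g) (u, w) - (∂_w g) (u, v)` for all `w`. -/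
def christoffel (c : M) (y u v : Eucl n) : Eucl n :=
  let dg : Eucl n →L[ℝ] Eucl n →L[ℝ] Eucl n →L[ℝ] ℝ := fderiv ℝ (metricIn g c) y
  (metricIn g c y).inverse ((1 / 2 : ℝ) • (dg u v + dg v u - (dg.flip u).flip v))

/-- The curvature `R (u, v) w` at `p`, computed in the chart at `p`, whose coordinate frame at `p`
is the identification of `T_p M` with the model space. The sign convention is
`R (X, Y) Z = D_Y D_X Z - D_X D_Y Z + D_[X, Y] Z`, for which the Jacobi equation of geodesics
is `D² ξ + R (γ', ξ) γ' = 0`. -/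
def curvature (p : M) (u v w : TangentSpace (𝓡 n) p) : TangentSpace (𝓡 n) p :=
  let y : Eucl n := extChartAt (𝓡 n) p p
  let Γ : Eucl n → Eucl n → Eucl n → Eucl n := christoffel g p
  fderiv ℝ (fun z ↦ Γ z u w) y v - fderiv ℝ (fun z ↦ Γ z v w) y u
    + Γ y v (Γ y u w) - Γ y u (Γ y v w)

/-- The gradient of a function with respect to `g`: `g (∇f, w) = df (w)` for all `w`. -/
def metricGradient (f : M → ℝ) (p : M) : TangentSpace (𝓡 n) p :=
  (g.val p).inverse (mfderiv (𝓡 n) 𝓘(ℝ, ℝ) f p : TangentSpace (𝓡 n) p →L[ℝ] ℝ)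

/-- The Levi-Civita covariant derivative `D_u X` at `p` of a vector field `X` on `M`, computed in
the chart at `p`. -/
def covDerivField (X : ∀ p : M, TangentSpace (𝓡 n) p) (p : M) (u : TangentSpace (𝓡 n) p) :
    TangentSpace (𝓡 n) p :=
  let y : Eucl n := extChartAt (𝓡 n) p p
  let X' : Eucl n → Eucl n := fun z ↦
    let q := (extChartAt (𝓡 n) p).symm z
    tangentCoordChange (𝓡 n) q p q (X q)
  fderiv ℝ X' y u + christoffel g p y u (X p)

end Metric

/-! ### Vector fields along a curve -/

section Curves

variable {n ν : ℕ} {M : Type*} [TopologicalSpace M] [ChartedSpace (Eucl n) M]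
  [IsManifold (𝓡 n) ∞ M]

/-- Vector fields along the curve `γ`. Only their values over `[0, 1]` matter. -/
abbrev FieldAlong (γ : ℝ → M) : Type := ∀ t : ℝ, TangentSpace (𝓡 n) (γ t)

/-- The coordinate expression of the field `ξ` along `γ` in the chart at `c`. -/
def fieldIn (γ : ℝ → M) (ξ : FieldAlong (n := n) γ) (c : M) (t : ℝ) : Eucl n :=
  tangentCoordChange (𝓡 n) (γ t) c (γ t) (ξ t)

/-- The velocity of a curve defined on `[0, 1]`. -/
def velocity (γ : ℝ → M) : FieldAlong (n := n) γ := fun t ↦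
  mfderivWithin 𝓘(ℝ, ℝ) (𝓡 n) γ (Icc 0 1) t (1 : ℝ)

/-- The covariant derivative `D ξ / dx` along a curve defined on `[0, 1]`; its value at `t` is
computed in the chart at `γ t`. -/
def covDeriv (g : SemiRiemannianMetric n ν M) (γ : ℝ → M) (ξ : FieldAlong (n := n) γ) :
    FieldAlong (n := n) γ := fun t ↦
  derivWithin (fieldIn γ ξ (γ t)) (Icc 0 1) t
    + christoffel g (γ t) (extChartAt (𝓡 n) (γ t) (γ t)) (velocity γ t) (ξ t)

/-- A smooth time dependent potential on `[0, 1] × M`. -/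
def IsSmoothPotential (n : ℕ) {M : Type*} [TopologicalSpace M] [ChartedSpace (Eucl n) M]
    (V : ℝ → M → ℝ) : Prop :=
  ContMDiffOn (𝓘(ℝ, ℝ).prod (𝓡 n)) 𝓘(ℝ, ℝ) ∞ (fun z : ℝ × M ↦ V z.1 z.2) (Icc 0 1 ×ˢ univ)

/-- Perturbed geodesics: smooth curves `γ` on `[0, 1]` with `D γ' / dx + ∇V (x, γ) = 0`. -/
structure IsPGeodesic (g : SemiRiemannianMetric n ν M) (V : ℝ → M → ℝ) (γ : ℝ → M) : Prop where
  smooth : ContMDiffOn 𝓘(ℝ, ℝ) (𝓡 n) ∞ γ (Icc 0 1)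
  equation : ∀ x ∈ Icc (0 : ℝ) 1, covDeriv g γ (velocity γ) x + metricGradient g (V x) (γ x) = 0

/-- The operator `ξ ↦ R (γ', ξ) γ' + D_ξ ∇V (x, γ)`. -/
def jacobiPotential (g : SemiRiemannianMetric n ν M) (V : ℝ → M → ℝ) (γ : ℝ → M)
    (ξ : FieldAlong (n := n) γ) : FieldAlong (n := n) γ := fun x ↦
  curvature g (γ x) (velocity γ x) (ξ x) (velocity γ x)
    + covDerivField g (metricGradient g (V x)) (γ x) (ξ x)

/-- Jacobi fields along `γ`. -/
structure IsJacobiField (g : SemiRiemannianMetric n ν M) (V : ℝ → M → ℝ) (γ : ℝ → M)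
    (ξ : FieldAlong (n := n) γ) : Prop where
  smooth : ContMDiffOn 𝓘(ℝ, ℝ) (𝓡 n).tangent ∞
    (fun x ↦ (⟨γ x, ξ x⟩ : TangentBundle (𝓡 n) M)) (Icc 0 1)
  equation : ∀ x ∈ Icc (0 : ℝ) 1,
    covDeriv g γ (covDeriv g γ ξ) x + jacobiPotential g V γ ξ x = 0

/-- `x` is a conjugate instant: there is a nonzero Jacobi field vanishing at `0` and at `x`. -/
def IsConjugateInstant (g : SemiRiemannianMetric n ν M) (V : ℝ → M → ℝ) (γ : ℝ → M) (x : ℝ) :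
    Prop :=
  x ∈ Ioc (0 : ℝ) 1 ∧ ∃ ξ : FieldAlong (n := n) γ, IsJacobiField g V γ ξ ∧
    (∃ t ∈ Icc (0 : ℝ) 1, ξ t ≠ 0) ∧ ξ 0 = 0 ∧ ξ x = 0

/-! ### The Hilbert space of `H¹` fields vanishing at the end points -/

/-- `u` is of class `H¹` on `[a, b]`: it is a primitive of a square integrable function. -/
def IsH1On {n : ℕ} (a b : ℝ) (u : ℝ → Eucl n) : Prop :=
  ∃ v : ℝ → Eucl n, MemLp v 2 (volume.restrict (Icc a b)) ∧
    ∀ s ∈ Icc a b, u s = u a + ∫ r in a..s, v r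

/-- A field along `γ` is of class `H¹` if its expression in any chart is of class `H¹` on every
compact subinterval of `[0, 1]` that `γ` maps into the domain of the chart. -/
def IsH1Field (γ : ℝ → M) (ξ : FieldAlong (n := n) γ) : Prop :=
  ∀ (c : M) (a b : ℝ), 0 ≤ a → a ≤ b → b ≤ 1 →
    (∀ t ∈ Icc a b, γ t ∈ (chartAt (Eucl n) c).source) → IsH1On a b (fieldIn γ ξ c)

lemma memLp_intervalIntegrable {n : ℕ} {a b s : ℝ} {v : ℝ → Eucl n}
    (hv : MemLp v 2 (volume.restrict (Icc a b))) (hs : s ∈ Icc a b) :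
    IntervalIntegrable v volume a s := by
  have h : IntegrableOn v (Icc a b) volume := hv.integrable (by norm_num)
  rw [intervalIntegrable_iff_integrableOn_Icc_of_le hs.1]
  exact h.mono_set (Icc_subset_Icc_right hs.2)

lemma IsH1On.add {n : ℕ} {a b : ℝ} {u w : ℝ → Eucl n} (hu : IsH1On a b u) (hw : IsH1On a b w) :
    IsH1On a b (fun s ↦ u s + w s) := by
  obtain ⟨v, hv, hv'⟩ := hu
  obtain ⟨z, hz, hz'⟩ := hw
  refine ⟨fun s ↦ v s + z s, hv.add hz, fun s hs ↦ ?_⟩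
  beta_reduce
  rw [hv' s hs, hz' s hs, intervalIntegral.integral_add (memLp_intervalIntegrable hv hs)
    (memLp_intervalIntegrable hz hs)]
  abel

lemma IsH1On.const_smul {n : ℕ} {a b : ℝ} {u : ℝ → Eucl n} (r : ℝ) (hu : IsH1On a b u) :
    IsH1On a b (fun s ↦ r • u s) := by
  obtain ⟨v, hv, hv'⟩ := hu
  refine ⟨fun s ↦ r • v s, hv.const_smul r, fun s hs ↦ ?_⟩
  beta_reduce
  rw [hv' s hs, intervalIntegral.integral_smul, smul_add]

lemma IsH1On.continuousOn {n : ℕ} {a b : ℝ} {u : ℝ → Eucl n} (hab : a ≤ b)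
    (hu : IsH1On a b u) : ContinuousOn u (Icc a b) := by
  obtain ⟨v, hv, hv'⟩ := hu
  have h : IntegrableOn v (uIcc a b) volume := by
    rw [uIcc_of_le hab]
    exact hv.integrable (by norm_num)
  have h2 := intervalIntegral.continuousOn_primitive_interval h
  rw [uIcc_of_le hab] at h2
  exact (h2.const_add (u a)).congr fun s hs ↦ hv' s hs

lemma IsH1On.deriv_spec {n : ℕ} {a b : ℝ} {u : ℝ → Eucl n} (hab : a ≤ b)
    (hu : IsH1On a b u) : ∃ v, MemLp v 2 (volume.restrict (Ioc a b)) ∧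
      ∀ᵐ x ∂volume.restrict (Ioc a b), HasDerivAt u (v x) x := by
  obtain ⟨v, hv, hv'⟩ := hu
  refine ⟨v, hv.mono_measure (Measure.restrict_mono Ioc_subset_Icc_self le_rfl), ?_⟩
  have hi := memLp_intervalIntegrable hv (right_mem_Icc.2 hab)
  rw [← restrict_Ioo_eq_restrict_Ioc, ae_restrict_iff' measurableSet_Ioo]
  filter_upwards [hi.ae_hasDerivAt_integral] with x hx hxm
  have hx' := hx (by rw [uIcc_of_le hab]; exact Ioo_subset_Icc_self hxm) a left_mem_uIcc
  refine (hx'.const_add (u a)).congr_of_eventuallyEq ?_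
  filter_upwards [Icc_mem_nhds hxm.1 hxm.2] with s hs using hv' s hs

lemma IsH1On.inner_integrable {n : ℕ} {a b : ℝ} {u w : ℝ → Eucl n} (hab : a ≤ b)
    (hu : IsH1On a b u) (hw : IsH1On a b w) :
    IntervalIntegrable (fun x ↦ ⟪u x, w x⟫_ℝ + ⟪deriv u x, deriv w x⟫_ℝ) volume a b := by
  have h1 : IntervalIntegrable (fun x ↦ ⟪u x, w x⟫_ℝ) volume a b := by
    apply ContinuousOn.intervalIntegrable
    rw [uIcc_of_le hab]
    exact (hu.continuousOn hab).inner (hw.continuousOn hab)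
  obtain ⟨v, hv, hv'⟩ := hu.deriv_spec hab
  obtain ⟨z, hz, hz'⟩ := hw.deriv_spec hab
  refine h1.add ?_
  rw [intervalIntegrable_iff_integrableOn_Ioc_of_le hab]
  have h2 : Integrable (fun x ↦ ⟪v x, z x⟫_ℝ) (volume.restrict (Ioc a b)) := by
    refine memLp_one_iff_integrable.1 ?_
    refine MemLp.of_bilin (p := 2) (q := 2) (fun x y ↦ ⟪x, y⟫_ℝ) 1 hv hz (hv.1.inner hz.1) ?_
    filter_upwards with x
    rw [one_mul]
    exact nnnorm_inner_le_nnnorm _ _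
  refine h2.congr ?_
  filter_upwards [hv', hz'] with x h3 h4
  rw [h3.deriv, h4.deriv]

lemma isH1On_zero {n : ℕ} (a b : ℝ) : IsH1On a b (fun _ ↦ (0 : Eucl n)) :=
  ⟨fun _ ↦ 0, MemLp.zero, by simp⟩

lemma fieldIn_add (γ : ℝ → M) (ξ η : FieldAlong (n := n) γ) (c : M) :
    fieldIn γ (ξ + η) c = fun s ↦ fieldIn γ ξ c s + fieldIn γ η c s := by
  funext s
  exact map_add (tangentCoordChange (𝓡 n) (γ s) c (γ s)) _ _

lemma fieldIn_smul (γ : ℝ → M) (r : ℝ) (ξ : FieldAlong (n := n) γ) (c : M) :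
    fieldIn γ (r • ξ) c = fun s ↦ r • fieldIn γ ξ c s := by
  funext s
  exact map_smul (tangentCoordChange (𝓡 n) (γ s) c (γ s)) _ _

lemma fieldIn_zero (γ : ℝ → M) (c : M) :
    fieldIn γ (0 : FieldAlong (n := n) γ) c = fun _ ↦ 0 := by
  funext s
  exact map_zero (tangentCoordChange (𝓡 n) (γ s) c (γ s))

variable (n) in
/-- The space `H¹₀(γ)` of `H¹` fields along `γ` vanishing at `0` and `1`; its elements, which are
fields over `[0, 1]`, are represented by their extensions by zero. -/
def h10Submodule (γ : ℝ → M) : Submodule ℝ (FieldAlong (n := n) γ) where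
  carrier := {ξ | IsH1Field γ ξ ∧ ∀ t ∉ Ioo (0 : ℝ) 1, ξ t = 0}
  add_mem' := by
    rintro ξ η ⟨hξ, hξ'⟩ ⟨hη, hη'⟩
    refine ⟨fun c a b ha hab hb h ↦ ?_, fun t ht ↦ ?_⟩
    · rw [fieldIn_add]
      exact (hξ c a b ha hab hb h).add (hη c a b ha hab hb h)
    · simp [hξ' t ht, hη' t ht]
  zero_mem' := by
    refine ⟨fun c a b _ _ _ _ ↦ ?_, fun t _ ↦ rfl⟩
    rw [fieldIn_zero]
    exact isH1On_zero a b
  smul_mem' := by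
    rintro r ξ ⟨hξ, hξ'⟩
    refine ⟨fun c a b ha hab hb h ↦ ?_, fun t ht ↦ ?_⟩
    · rw [fieldIn_smul]
      exact (hξ c a b ha hab hb h).const_smul r
    · simp [hξ' t ht]

variable (n) in
/-- A subdivision `0 = t 0 ≤ t 1 ≤ ... ≤ t N = 1` together with charts containing the
corresponding pieces of `γ`. -/
structure ChartSubdivision (γ : ℝ → M) where
  N : ℕ
  t : ℕ → ℝ
  c : ℕ → M
  mono : Monotone t
  first : t 0 = 0
  last : t N = 1
  mem_source : ∀ i < N, ∀ s ∈ Icc (t i) (t (i + 1)), γ s ∈ (chartAt (Eucl n) (c i)).source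

/-- Every curve admits such subdivisions. -/
lemma nonempty_chartSubdivision {γ : ℝ → M} (hγ : ContinuousOn γ (Icc 0 1)) :
    Nonempty (ChartSubdivision n γ) := by
  have hγ' : Continuous ((Icc (0 : ℝ) 1).domRestrict γ) := continuousOn_iff_continuous_domRestrict.1 hγ
  obtain ⟨t, h0, hm, ⟨N, hN⟩, hc⟩ := exists_monotone_Icc_subset_open_cover_Icc
    (zero_le_one (α := ℝ))
    (c := fun p : M ↦ (Icc (0 : ℝ) 1).domRestrict γ ⁻¹' (chartAt (Eucl n) p).source)
    (fun p ↦ (chartAt (Eucl n) p).open_source.preimage hγ')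
    (fun s _ ↦ mem_iUnion.2 ⟨γ s, mem_chart_source (Eucl n) (γ s)⟩)
  choose c hc using hc
  exact ⟨⟨N, fun i ↦ t i, c, fun i j h ↦ hm h, h0, hN N le_rfl, fun i _ s hs ↦
    hc i (show (⟨s, (t i).2.1.trans hs.1, hs.2.trans (t (i + 1)).2.2⟩ : Icc (0 : ℝ) 1) ∈
      Icc (t i) (t (i + 1)) from ⟨hs.1, hs.2⟩)⟩⟩

lemma ChartSubdivision.le_succ {γ : ℝ → M} (S : ChartSubdivision n γ) (i : ℕ) :
    S.t i ≤ S.t (i + 1) := S.mono (Nat.le_succ i)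

lemma ChartSubdivision.isH1On {γ : ℝ → M} (S : ChartSubdivision n γ)
    (ξ : h10Submodule n γ) {i : ℕ} (hi : i ∈ Finset.range S.N) :
    IsH1On (S.t i) (S.t (i + 1)) (fieldIn γ ξ.1 (S.c i)) := by
  have hi' := Finset.mem_range.1 hi
  refine ξ.2.1 (S.c i) _ _ ?_ (S.le_succ i) ?_ (S.mem_source i hi')
  · exact S.first ▸ S.mono (Nat.zero_le i)
  · exact S.last ▸ S.mono hi'

lemma ChartSubdivision.exists_mem {γ : ℝ → M} (S : ChartSubdivision n γ) {s : ℝ}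
    (hs : s ∈ Ioo (0 : ℝ) 1) : ∃ i ∈ Finset.range S.N, S.t i ≤ s ∧ s < S.t (i + 1) := by
  classical
  have hex : ∃ k, s < S.t k := ⟨S.N, by rw [S.last]; exact hs.2⟩
  have h1 := Nat.find_spec hex
  have h2 : ∀ m < Nat.find hex, ¬ s < S.t m := fun m hm ↦ Nat.find_min hex hm
  have h3 : Nat.find hex ≤ S.N := Nat.find_min' hex (by rw [S.last]; exact hs.2)
  generalize Nat.find hex = k at h1 h2 h3
  cases k with
  | zero => rw [S.first] at h1; exact absurd h1 (not_lt.2 hs.1.le)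
  | succ i => exact ⟨i, Finset.mem_range.2 h3, not_lt.1 (h2 i (Nat.lt_succ_self i)), h1⟩

/-- The space `H¹₀(γ)`, normed by means of the coordinate expressions with respect to a
subdivision `S`. Another subdivision gives an equivalent norm. -/
def H10 (γ : ℝ → M) (_S : ChartSubdivision n γ) : Type := h10Submodule n γ

instance (γ : ℝ → M) (S : ChartSubdivision n γ) : AddCommGroup (H10 γ S) :=
  inferInstanceAs (AddCommGroup (h10Submodule n γ))

instance (γ : ℝ → M) (S : ChartSubdivision n γ) : Module ℝ (H10 γ S) :=
  inferInstanceAs (Module ℝ (h10Submodule n γ))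

/-- The field underlying an element of `H¹₀(γ)`. -/
def H10.field {γ : ℝ → M} {S : ChartSubdivision n γ} (ξ : H10 γ S) : FieldAlong (n := n) γ :=
  ξ.1

/-- The `H¹` scalar product: the sum over the pieces of the subdivision of
`∫ ⟨ξ, η⟩ + ⟨ξ', η'⟩` in coordinates. -/
def h1Inner {γ : ℝ → M} (S : ChartSubdivision n γ) (ξ η : FieldAlong (n := n) γ) : ℝ :=
  ∑ i ∈ Finset.range S.N, ∫ x in (S.t i)..(S.t (i + 1)),
    (⟪fieldIn γ ξ (S.c i) x, fieldIn γ η (S.c i) x⟫_ℝ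
      + ⟪deriv (fieldIn γ ξ (S.c i)) x, deriv (fieldIn γ η (S.c i)) x⟫_ℝ)

lemma h1Inner_self_nonneg {γ : ℝ → M} (S : ChartSubdivision n γ) (ξ : FieldAlong (n := n) γ) :
    0 ≤ h1Inner S ξ ξ :=
  Finset.sum_nonneg fun i _ ↦ intervalIntegral.integral_nonneg (S.le_succ i) fun _ _ ↦
    add_nonneg real_inner_self_nonneg real_inner_self_nonneg

lemma h1Inner_definite {γ : ℝ → M} (S : ChartSubdivision n γ) (ξ : h10Submodule n γ)
    (h : h1Inner S ξ.1 ξ.1 = 0) : ξ = 0 := by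
  apply Subtype.ext
  funext s
  by_cases hs : s ∈ Ioo (0 : ℝ) 1
  swap
  · exact ξ.2.2 s hs
  obtain ⟨i, hi, h1, h2⟩ := S.exists_mem hs
  have hlt : S.t i < S.t (i + 1) := h1.trans_lt h2
  have hH := S.isH1On ξ hi
  have h3 := (Finset.sum_eq_zero_iff_of_nonneg fun i _ ↦
    intervalIntegral.integral_nonneg (S.le_succ i) fun _ _ ↦
    add_nonneg real_inner_self_nonneg real_inner_self_nonneg).1 h i hi
  have hc := hH.continuousOn hlt.le
  have hc2 : ContinuousOn (fun x ↦ ⟪fieldIn γ ξ.1 (S.c i) x, fieldIn γ ξ.1 (S.c i) x⟫_ℝ)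
    (Icc (S.t i) (S.t (i + 1))) := hc.inner hc
  have h4 : ∫ x in (S.t i)..(S.t (i + 1)),
      ⟪fieldIn γ ξ.1 (S.c i) x, fieldIn γ ξ.1 (S.c i) x⟫_ℝ ≤ 0 := by
    rw [← h3]
    refine intervalIntegral.integral_mono_on hlt.le ?_ (hH.inner_integrable hlt.le hH) fun x _ ↦
      le_add_of_nonneg_right real_inner_self_nonneg
    exact ContinuousOn.intervalIntegrable (by rwa [uIcc_of_le hlt.le])
  have h5 : fieldIn γ ξ.1 (S.c i) s = 0 := by
    by_contra hne
    refine absurd h4 (not_le.2 (intervalIntegral.integral_pos hlt hc2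
      (fun _ _ ↦ real_inner_self_nonneg) ⟨s, ⟨h1, h2.le⟩, real_inner_self_pos.2 hne⟩))
  have hsrc := S.mem_source i (Finset.mem_range.1 hi) s ⟨h1, h2.le⟩
  have hsrc' : γ s ∈ (extChartAt (𝓡 n) (S.c i)).source := by rwa [extChartAt_source]
  have h6 := tangentCoordChange_comp (I := 𝓡 n) (w := γ s) (x := S.c i) (y := γ s) (z := γ s)
    (v := (ξ.1 s : Eucl n)) ⟨⟨mem_extChartAt_source (γ s), hsrc'⟩, mem_extChartAt_source (γ s)⟩
  have h7 := tangentCoordChange_self (I := 𝓡 n) (v := (ξ.1 s : Eucl n))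
    (mem_extChartAt_source (I := 𝓡 n) (γ s))
  refine h7.symm.trans (h6.symm.trans ?_)
  exact (congrArg _ h5).trans (map_zero _)

lemma h1Inner_add_left {γ : ℝ → M} (S : ChartSubdivision n γ) (ξ η ζ : h10Submodule n γ) :
    h1Inner S (ξ.1 + η.1) ζ.1 = h1Inner S ξ.1 ζ.1 + h1Inner S η.1 ζ.1 := by
  unfold h1Inner
  rw [← Finset.sum_add_distrib]
  refine Finset.sum_congr rfl fun i hi ↦ ?_
  have hle := S.le_succ i
  have h1 := S.isH1On ξ hi
  have h2 := S.isH1On η hi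
  have h3 := S.isH1On ζ hi
  rw [← intervalIntegral.integral_add (h1.inner_integrable hle h3) (h2.inner_integrable hle h3)]
  obtain ⟨v, -, hv⟩ := h1.deriv_spec hle
  obtain ⟨w, -, hw⟩ := h2.deriv_spec hle
  refine intervalIntegral.integral_congr_ae_restrict ?_
  rw [uIoc_of_le hle]
  filter_upwards [hv, hw] with x hx hy
  rw [fieldIn_add, (hx.fun_add hy).deriv, hx.deriv, hy.deriv, inner_add_left, inner_add_left]
  ring

lemma h1Inner_smul_left {γ : ℝ → M} (S : ChartSubdivision n γ) (ξ ζ : FieldAlong (n := n) γ)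
    (r : ℝ) : h1Inner S (r • ξ) ζ = r * h1Inner S ξ ζ := by
  unfold h1Inner
  rw [Finset.mul_sum]
  refine Finset.sum_congr rfl fun i hi ↦ ?_
  rw [← intervalIntegral.integral_const_mul]
  refine intervalIntegral.integral_congr fun x _ ↦ ?_
  have h : deriv (fun s ↦ r • fieldIn γ ξ (S.c i) s) x = r • deriv (fieldIn γ ξ (S.c i)) x :=
    deriv_fun_const_smul_field r _
  simp only [fieldIn_smul, h, real_inner_smul_left]
  ring

lemma h1Inner_comm {γ : ℝ → M} (S : ChartSubdivision n γ) (ξ ζ : FieldAlong (n := n) γ) :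
    h1Inner S ξ ζ = h1Inner S ζ ξ := by
  unfold h1Inner
  simp only [real_inner_comm]

/-- `h1Inner` is a scalar product on `H¹₀(γ)`. -/
abbrev h10Core (γ : ℝ → M) (S : ChartSubdivision n γ) : InnerProductSpace.Core ℝ (H10 γ S) where
  inner ξ η := h1Inner S ξ.field η.field
  conj_inner_symm ξ η := h1Inner_comm S η.field ξ.field
  re_inner_nonneg ξ := h1Inner_self_nonneg S ξ.field
  add_left ξ η ζ := h1Inner_add_left S ξ η ζ
  smul_left ξ η r := h1Inner_smul_left S ξ.field η.field r
  definite ξ h := h1Inner_definite S ξ h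

instance (γ : ℝ → M) (S : ChartSubdivision n γ) : NormedAddCommGroup (H10 γ S) :=
  (h10Core γ S).toNormedAddCommGroup

instance (γ : ℝ → M) (S : ChartSubdivision n γ) : InnerProductSpace ℝ (H10 γ S) :=
  InnerProductSpace.ofCore (h10Core γ S).toCore

/-! ### The energy functional and its Hessian -/

/-- The energy functional `E (γ) = ∫ g (γ', γ') / 2 - ∫ V (x, γ)`. -/
def energy (g : SemiRiemannianMetric n ν M) (V : ℝ → M → ℝ) (γ : ℝ → M) : ℝ :=
  (∫ x in (0 : ℝ)..1, (1 / 2 : ℝ) * g.val (γ x) (velocity γ x) (velocity γ x))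
    - ∫ x in (0 : ℝ)..1, V x (γ x)

/-- The integrand of the bilinear form `H_γ`. -/
def hessianDensity (g : SemiRiemannianMetric n ν M) (V : ℝ → M → ℝ) (γ : ℝ → M)
    (ξ η : FieldAlong (n := n) γ) (x : ℝ) : ℝ :=
  g.val (γ x) (covDeriv g γ ξ x) (covDeriv g γ η x)
    - g.val (γ x) (jacobiPotential g V γ ξ x) (η x)

/-- The bilinear form
`H_γ (ξ, η) = ∫ g (Dξ/dx, Dη/dx) - g (R (γ', ξ) γ' + D_ξ ∇V (x, γ), η) dx`. -/
def hessianForm (g : SemiRiemannianMetric n ν M) (V : ℝ → M → ℝ) (γ : ℝ → M)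
    (ξ η : FieldAlong (n := n) γ) : ℝ :=
  ∫ x in (0 : ℝ)..1, hessianDensity g V γ ξ η x

/-- The quadratic form `h_γ` on `H¹₀(γ)`. -/
def hessian (g : SemiRiemannianMetric n ν M) (V : ℝ → M → ℝ) (γ : ℝ → M)
    (S : ChartSubdivision n γ) (ξ : H10 γ S) : ℝ :=
  hessianForm g V γ ξ.field ξ.field

/-- `α` is a smooth variation of `γ` with fixed end points, defined for parameters `s` in
`(-ε, ε)`, with variation field `ξ = ∂α/∂s` at `s = 0`. -/
structure IsVariation (γ : ℝ → M) (ξ : FieldAlong (n := n) γ) (ε : ℝ) (α : ℝ → ℝ → M) :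
    Prop where
  pos : 0 < ε
  smooth : ContMDiffOn (𝓘(ℝ, ℝ).prod 𝓘(ℝ, ℝ)) (𝓡 n) ∞ (fun z : ℝ × ℝ ↦ α z.1 z.2)
    (Ioo (-ε) ε ×ˢ Icc 0 1)
  left : ∀ s ∈ Ioo (-ε) ε, α s 0 = γ 0
  right : ∀ s ∈ Ioo (-ε) ε, α s 1 = γ 1
  field : ∀ x ∈ Icc (0 : ℝ) 1,
    (⟨α 0 x, mfderiv 𝓘(ℝ, ℝ) (𝓡 n) (fun s ↦ α s x) 0 (1 : ℝ)⟩ : TangentBundle (𝓡 n) M)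
      = ⟨γ x, ξ x⟩

/-- `h` gives the second derivative at `γ` of the energy functional on the space of paths with the
same end points as `γ`: for each smooth variation with fixed end points and variation field `ξ`,
the energy is twice differentiable at parameter `0` with second derivative `h ξ`. -/
def IsSecondVariation (g : SemiRiemannianMetric n ν M) (V : ℝ → M → ℝ) (γ : ℝ → M)
    (S : ChartSubdivision n γ) (h : H10 γ S → ℝ) : Prop :=
  ∀ (ξ : H10 γ S) (ε : ℝ) (α : ℝ → ℝ → M), IsVariation γ ξ.field ε α →
    ∃ e : ℝ → ℝ, (∀ᶠ s in 𝓝 0, HasDerivAt (fun r ↦ energy g V (α r)) (e s) s) ∧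
      HasDerivAt e (h ξ) 0

end Curves

end SemiRiem

end

open SemiRiem

open Set Filter Topology MeasureTheory
open scoped Manifold ContDiff InnerProductSpace

noncomputable section

set_option maxSynthPendingDepth 3
set_option linter.unusedSectionVars false

/-! In a chart the index form is `∫ G (u' + Γ u, w' + Γ w) - q (u, w)`, with coefficients that are
smooth along `γ`, with `G` symmetric and invertible, and with `q` symmetric. The transformation laws
of Christoffel symbols, curvature and Hessians show that this expression is the same in all charts
(`fieldIn_covDeriv`, `metricIn_jacobiPotential`, `hessianDensity_eq`), so the form on `H10 γ S` is
the sum of such integrals over the pieces of the subdivision (`hessianForm_eq_sum`).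

Fredholmness. As `G` is indefinite, `h_γ` need not be coercive, even up to a compact term. On a
short interval starting at `s`, however, `G` is almost constant, and pairing `u` with `J u`, where
`J = G(s)⁻¹` (after Riesz identification), turns the leading term into almost `∫ |u'|²`; the
remaining terms are absorbed by the Poincaré inequality (`exists_indexDensity_coercive`). For a
field `ξ` that vanishes at the points of a fine grid, the fields `J ξ` on the grid intervals extend
by zero, and their sum `ζ` satisfies `‖ξ‖² ≤ 4 b (ξ, ζ)` and `‖ζ‖ ≤ D ‖ξ‖`. Hence `b` is bounded
below on a closed subspace of finite codimension (`exists_subspace_bound`). This yields a finite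
dimensional kernel and a closed range; by symmetry and completeness the range is the annihilator of
the kernel, so the cokernel is finite dimensional and injectivity alone gives an isomorphism
(`isFredholmForm_of_bound`). No compact embedding is used.

Kernel. If `ξ` lies in the kernel, testing with fields supported in a chart and the lemma of du
Bois-Reymond show that the momentum `p = G (u' + Γ u, ·)` is a.e. a primitive, so `(u, p)` solves a
linear first order system with smooth coefficients and is smooth (`exists_momentum_of_weak`); this
system is the Jacobi equation. Conversely, integrating by parts against a Jacobi field leaves
boundary terms that telescope over the subdivision and vanish at the end points
(`exists_mem_ker_of_isJacobiField`).

Second variation. Differentiating twice under the integral sign, the integrand equals the density of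
`h_γ` plus the derivative of `g (D(∂α/∂s)/ds, γ')`, by a pointwise identity
(`IsMetricOn.second_variation_identity`) and the equation of `γ`. This boundary term does not depend
on the chart, telescopes, and vanishes at the fixed end points (`isSecondVariation_hessian`). -/

namespace SemiRiem

/-! ### Christoffel symbols and curvature of a metric on an open set of a normed space -/

section LocalGeometry

variable {E : Type*} [NormedAddCommGroup E] [NormedSpace ℝ E]

/-- The Christoffel symbols of the first kind, in terms of the derivative of the metric. -/
def koszul (dg : E →L[ℝ] E →L[ℝ] E →L[ℝ] ℝ) (u v : E) : E →L[ℝ] ℝ :=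
  (1 / 2 : ℝ) • (dg u v + dg v u - (dg.flip u).flip v)

lemma koszul_apply (dg : E →L[ℝ] E →L[ℝ] E →L[ℝ] ℝ) (u v w : E) :
    koszul dg u v w = (1 / 2 : ℝ) * (dg u v w + dg v u w - dg w u v) := rfl

/-- The Christoffel symbols of the metric `G` on a normed space. -/
def chr (G : E → E →L[ℝ] E →L[ℝ] ℝ) (y u v : E) : E :=
  (G y).inverse (koszul (fderiv ℝ G y) u v)

/-- `koszul` as a bundled map, linear in all its arguments. -/
def koszulL : (E →L[ℝ] E →L[ℝ] E →L[ℝ] ℝ) →L[ℝ] E →L[ℝ] E →L[ℝ] E →L[ℝ] ℝ :=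
  let F : (E →L[ℝ] E →L[ℝ] E →L[ℝ] ℝ) →L[ℝ] E →L[ℝ] E →L[ℝ] E →L[ℝ] ℝ :=
    (ContinuousLinearMap.flipₗᵢ ℝ E E (E →L[ℝ] ℝ)).toLinearIsometry.toContinuousLinearMap
  let K : (E →L[ℝ] E →L[ℝ] ℝ) →L[ℝ] E →L[ℝ] E →L[ℝ] ℝ :=
    (ContinuousLinearMap.flipₗᵢ ℝ E E ℝ).toLinearIsometry.toContinuousLinearMap
  (1 / 2 : ℝ) • (ContinuousLinearMap.id ℝ _ + F - (ContinuousLinearMap.compL ℝ E _ _ K).comp F)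

lemma koszulL_apply (dg : E →L[ℝ] E →L[ℝ] E →L[ℝ] ℝ) (u v : E) :
    koszulL dg u v = koszul dg u v := rfl

/-- The Christoffel symbols as a bundled bilinear map. -/
def chrL (G : E → E →L[ℝ] E →L[ℝ] ℝ) (y : E) : E →L[ℝ] E →L[ℝ] E :=
  (ContinuousLinearMap.compL ℝ E (E →L[ℝ] ℝ) E (G y).inverse).comp (koszulL (fderiv ℝ G y))

lemma chrL_apply (G : E → E →L[ℝ] E →L[ℝ] ℝ) (y u v : E) : chrL G y u v = chr G y u v := rfl

lemma chr_add_right (G : E → E →L[ℝ] E →L[ℝ] ℝ) (y u v w : E) :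
    chr G y u (v + w) = chr G y u v + chr G y u w :=
  (chrL G y u).map_add v w

/-- The curvature of a connection with Christoffel symbols `Γ`. -/
def curv (Γ : E → E → E → E) (y u v w : E) : E :=
  fderiv ℝ (fun z ↦ Γ z u w) y v - fderiv ℝ (fun z ↦ Γ z v w) y u
    + Γ y v (Γ y u w) - Γ y u (Γ y v w)

lemma koszul_symm {dg : E →L[ℝ] E →L[ℝ] E →L[ℝ] ℝ} (h : ∀ w u v, dg w u v = dg w v u) (u v : E) :
    koszul dg u v = koszul dg v u := by
  ext w
  rw [koszul_apply, koszul_apply, h w u v]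
  ring

/-- Transformation of the Christoffel symbols, pointwise algebraic form. -/
lemma inverse_koszul_transform {g g' : E →L[ℝ] E →L[ℝ] ℝ} {dg dg' : E →L[ℝ] E →L[ℝ] E →L[ℝ] ℝ}
    {J : E →L[ℝ] E} {H : E →L[ℝ] E →L[ℝ] E} (hg : g.IsInvertible) (hg' : g'.IsInvertible)
    (hJ : Function.Surjective J) (hH : ∀ u v, H u v = H v u) (hs : ∀ u v, g' u v = g' v u)
    (hgg : ∀ u v, g u v = g' (J u) (J v))
    (hdg : ∀ w u v, dg w u v = dg' (J w) (J u) (J v) + g' (H w u) (J v) + g' (J u) (H w v))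
    (u v : E) :
    J (g.inverse (koszul dg u v)) = g'.inverse (koszul dg' (J u) (J v)) + H u v := by
  have h1 : g' (J (g.inverse (koszul dg u v))) = g' (g'.inverse (koszul dg' (J u) (J v)) + H u v) := by
    ext w'
    obtain ⟨w, rfl⟩ := hJ w'
    rw [← hgg, hg.self_apply_inverse, map_add, hg'.self_apply_inverse, koszul_apply, hdg, hdg, hdg,
      add_apply, koszul_apply, hH v u, hH w u, hH w v, hs (H u w) (J v),
      hs (J u) (H v w)]
    ring
  simpa only [hg'.inverse_apply_self] using congrArg g'.inverse h1

/-- A smooth nondegenerate symmetric bilinear form on a set. -/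
structure IsMetricOn (G : E → E →L[ℝ] E →L[ℝ] ℝ) (U : Set E) : Prop where
  isOpen : IsOpen U
  smooth : ContDiffOn ℝ ∞ G U
  symm : ∀ y ∈ U, ∀ u v, G y u v = G y v u
  invertible : ∀ y ∈ U, (G y).IsInvertible

namespace IsMetricOn

variable {G : E → E →L[ℝ] E →L[ℝ] ℝ} {U : Set E} (hG : IsMetricOn G U) {y : E}

include hG

lemma contDiffAt (hy : y ∈ U) : ContDiffAt ℝ ∞ G y :=
  hG.smooth.contDiffAt (hG.isOpen.mem_nhds hy)

lemma contDiffAt_fderiv (hy : y ∈ U) : ContDiffAt ℝ ∞ (fderiv ℝ G) y :=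
  (hG.contDiffAt hy).fderiv_right (by simp)

lemma differentiableAt (hy : y ∈ U) : DifferentiableAt ℝ G y :=
  (hG.contDiffAt hy).differentiableAt (by simp)

lemma differentiableAt_fderiv (hy : y ∈ U) : DifferentiableAt ℝ (fderiv ℝ G) y :=
  (hG.contDiffAt_fderiv hy).differentiableAt (by simp)

lemma fderiv_symm (hy : y ∈ U) (w u v : E) : fderiv ℝ G y w u v = fderiv ℝ G y w v u := by
  have hd := (hG.differentiableAt hy).hasFDerivAt
  have h1 : HasFDerivAt (fun z ↦ G z u v) _ y :=
    (hd.clm_apply (hasFDerivAt_const u y)).clm_apply (hasFDerivAt_const v y)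
  have h2 : HasFDerivAt (fun z ↦ G z v u) _ y :=
    (hd.clm_apply (hasFDerivAt_const v y)).clm_apply (hasFDerivAt_const u y)
  have h3 := h1.unique (h2.congr_of_eventuallyEq (by
    filter_upwards [hG.isOpen.mem_nhds hy] with z hz using hG.symm z hz u v))
  simpa using congrArg (fun f : E →L[ℝ] ℝ ↦ f w) h3

lemma snd_fderiv_symm (hy : y ∈ U) (w x u v : E) :
    fderiv ℝ (fderiv ℝ G) y w x u v = fderiv ℝ (fderiv ℝ G) y w x v u := by
  have hd := (hG.differentiableAt_fderiv hy).hasFDerivAt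
  have h1 : HasFDerivAt (fun z ↦ fderiv ℝ G z x u v) _ y :=
    ((hd.clm_apply (hasFDerivAt_const x y)).clm_apply (hasFDerivAt_const u y)).clm_apply
      (hasFDerivAt_const v y)
  have h2 : HasFDerivAt (fun z ↦ fderiv ℝ G z x v u) _ y :=
    ((hd.clm_apply (hasFDerivAt_const x y)).clm_apply (hasFDerivAt_const v y)).clm_apply
      (hasFDerivAt_const u y)
  have h3 := h1.unique (h2.congr_of_eventuallyEq (by
    filter_upwards [hG.isOpen.mem_nhds hy] with z hz using hG.fderiv_symm hz x u v))
  simpa using congrArg (fun f : E →L[ℝ] ℝ ↦ f w) h3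

lemma snd_fderiv_comm (hy : y ∈ U) (w x : E) :
    fderiv ℝ (fderiv ℝ G) y w x = fderiv ℝ (fderiv ℝ G) y x w :=
  (hG.contDiffAt hy).isSymmSndFDerivAt (by simp; norm_cast) w x

lemma apply_chr (hy : y ∈ U) (u v w : E) : G y (chr G y u v) w = koszul (fderiv ℝ G y) u v w := by
  rw [chr, (hG.invertible y hy).self_apply_inverse]

lemma chr_symm (hy : y ∈ U) (u v : E) : chr G y u v = chr G y v u := by
  rw [chr, chr, koszul_symm (hG.fderiv_symm hy)]

/-- Compatibility of the connection with the metric: in the sum of the two Koszul expressions all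
derivatives cancel except the one in the direction `w`. -/
lemma fderiv_apply (hy : y ∈ U) (w u v : E) :
    fderiv ℝ G y w u v = G y (chr G y w u) v + G y (chr G y w v) u := by
  rw [hG.apply_chr hy, hG.apply_chr hy, koszul_apply, koszul_apply, hG.fderiv_symm hy w v u]
  ring

lemma contDiffOn_inverse [CompleteSpace E] :
    ContDiffOn ℝ ∞ (fun z ↦ (G z).inverse) U := by
  intro z hz
  obtain ⟨e, he⟩ := hG.invertible z hz
  have h := contDiffAt_map_inverse (𝕜 := ℝ) (n := ∞) e
  rw [he] at h
  exact (h.comp z (hG.contDiffAt hz)).contDiffWithinAt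

lemma contDiffOn_chrL [CompleteSpace E] : ContDiffOn ℝ ∞ (chrL G) U := by
  have h1 : ContDiffOn ℝ ∞ (fderiv ℝ G) U :=
    fun z hz ↦ (hG.contDiffAt_fderiv hz).contDiffWithinAt
  have h2 := (ContinuousLinearMap.compL ℝ E (E →L[ℝ] ℝ) E).contDiff.comp_contDiffOn
    hG.contDiffOn_inverse
  exact h2.clm_comp ((koszulL (E := E)).contDiff.comp_contDiffOn h1)

lemma differentiableAt_chrL [CompleteSpace E] (hy : y ∈ U) : DifferentiableAt ℝ (chrL G) y :=
  (hG.contDiffOn_chrL.contDiffAt (hG.isOpen.mem_nhds hy)).differentiableAt (by simp)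

lemma hasFDerivAt_chr [CompleteSpace E] (hy : y ∈ U) (u v : E) :
    HasFDerivAt (fun z ↦ chr G z u v) (((fderiv ℝ (chrL G) y).flip u).flip v) y := by
  have h := ((hG.differentiableAt_chrL hy).hasFDerivAt.clm_apply (hasFDerivAt_const u y)).clm_apply
    (hasFDerivAt_const v y)
  refine h.congr_fderiv ?_
  ext w
  simp

lemma curv_eq [CompleteSpace E] (hy : y ∈ U) (u v w : E) :
    curv (chr G) y u v w = fderiv ℝ (chrL G) y v u w - fderiv ℝ (chrL G) y u v w
      + chr G y v (chr G y u w) - chr G y u (chr G y v w) := by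
  rw [curv, (hG.hasFDerivAt_chr hy u w).fderiv, (hG.hasFDerivAt_chr hy v w).fderiv]
  rfl

/-- Obtained by differentiating `G (Γ (u, w), x) = koszul (DG) u w x`, so that the inverse of `G`
never has to be differentiated. -/
lemma apply_fderiv_chrL [CompleteSpace E] (hy : y ∈ U) (v u w x : E) :
    G y (fderiv ℝ (chrL G) y v u w) x = koszul (fderiv ℝ (fderiv ℝ G) y v) u w x
      - fderiv ℝ G y v (chr G y u w) x := by
  have h1 : HasFDerivAt (fun z ↦ G z (chr G z u w) x) _ y :=
    ((hG.differentiableAt hy).hasFDerivAt.clm_apply (hG.hasFDerivAt_chr hy u w)).clm_apply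
      (hasFDerivAt_const x y)
  have h2 : HasFDerivAt (fun z ↦ koszulL (fderiv ℝ G z) u w x) _ y :=
    (((koszulL.hasFDerivAt.comp y (hG.differentiableAt_fderiv hy).hasFDerivAt).clm_apply
      (hasFDerivAt_const u y)).clm_apply (hasFDerivAt_const w y)).clm_apply (hasFDerivAt_const x y)
  have h3 := h1.unique (h2.congr_of_eventuallyEq (by
    filter_upwards [hG.isOpen.mem_nhds hy] with z hz
    rw [hG.apply_chr hz, koszulL_apply]))
  have h4 := congrArg (fun f : E →L[ℝ] ℝ ↦ f v) h3
  simp [koszulL_apply] at h4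
  linarith

/-- The tidal form `g (R (p, u) p, x)` in terms of the second derivatives of the metric. -/
lemma apply_curv [CompleteSpace E] (hy : y ∈ U) (p u x : E) :
    G y (curv (chr G) y p u p) x =
      koszul (fderiv ℝ (fderiv ℝ G) y u) p p x - koszul (fderiv ℝ (fderiv ℝ G) y p) u p x
        - G y (chr G y u x) (chr G y p p) + G y (chr G y p x) (chr G y p u) := by
  rw [hG.curv_eq hy]
  simp only [map_add, map_sub, add_apply, sub_apply,
    hG.apply_fderiv_chrL hy, hG.fderiv_apply hy, hG.chr_symm hy u p]
  ring

/-- The pair symmetry of the curvature, restricted to the tidal operator. It is read off from the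
formula `apply_curv`, whose second order part is symmetric because `D²G` is, and it is what makes
the index form symmetric. -/
lemma apply_curv_comm [CompleteSpace E] (hy : y ∈ U) (p u x : E) :
    G y (curv (chr G) y p u p) x = G y (curv (chr G) y p x p) u := by
  rw [hG.apply_curv hy, hG.apply_curv hy, hG.chr_symm hy u x, hG.symm y hy (chr G y p x)]
  simp only [koszul_apply]
  have hc := hG.snd_fderiv_comm hy
  have hs := hG.snd_fderiv_symm hy
  rw [hc u p, hc u x, hc x p, hs p p x u, hs p u p x, hs p x p u]
  ring

end IsMetricOn

/-- Transformation of the Christoffel symbols under a change of coordinates. -/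
lemma chr_transform {G G' : E → E →L[ℝ] E →L[ℝ] ℝ} {U U' W : Set E} (hG : IsMetricOn G U)
    (hG' : IsMetricOn G' U') {φ : E → E} (hW : IsOpen W) (hWU : W ⊆ U) (hWU' : MapsTo φ W U')
    (hφ : ContDiffOn ℝ ∞ φ W) (hs : ∀ z ∈ W, Function.Surjective (fderiv ℝ φ z))
    (hgg : ∀ z ∈ W, ∀ u v, G z u v = G' (φ z) (fderiv ℝ φ z u) (fderiv ℝ φ z v))
    {y : E} (hy : y ∈ W) (u v : E) :
    fderiv ℝ φ y (chr G y u v) = chr G' (φ y) (fderiv ℝ φ y u) (fderiv ℝ φ y v)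
      + fderiv ℝ (fderiv ℝ φ) y u v := by
  have hφy := hφ.contDiffAt (hW.mem_nhds hy)
  have hφ' : ContDiffAt ℝ ∞ (fderiv ℝ φ) y := hφy.fderiv_right (by simp)
  have hJ := (hφ'.differentiableAt (by simp)).hasFDerivAt
  refine inverse_koszul_transform (hG.invertible y (hWU hy)) (hG'.invertible _ (hWU' hy)) (hs y hy)
    (fun u v ↦ hφy.isSymmSndFDerivAt (by simp; norm_cast) u v) (hG'.symm _ (hWU' hy)) (hgg y hy) ?_ u v
  intro w u v
  have h1 : HasFDerivAt (fun z ↦ G z u v) _ y :=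
    ((hG.differentiableAt (hWU hy)).hasFDerivAt.clm_apply (hasFDerivAt_const u y)).clm_apply
      (hasFDerivAt_const v y)
  have h2 : HasFDerivAt (fun z ↦ G' (φ z) (fderiv ℝ φ z u) (fderiv ℝ φ z v)) _ y :=
    (((hG'.differentiableAt (hWU' hy)).hasFDerivAt.comp y
      (hφy.differentiableAt (by simp)).hasFDerivAt).clm_apply
        (hJ.clm_apply (hasFDerivAt_const u y))).clm_apply (hJ.clm_apply (hasFDerivAt_const v y))
  have h3 := h1.unique (h2.congr_of_eventuallyEq (by
    filter_upwards [hW.mem_nhds hy] with z hz using hgg z hz u v))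
  have h4 := congrArg (fun f : E →L[ℝ] ℝ ↦ f w) h3
  simp at h4
  linarith

/-- Transformation of the curvature under a change of coordinates. -/
lemma curv_transform [CompleteSpace E] {G G' : E → E →L[ℝ] E →L[ℝ] ℝ} {U U' W : Set E}
    (hG : IsMetricOn G U)
    (hG' : IsMetricOn G' U') {φ : E → E} (hW : IsOpen W) (hWU : W ⊆ U) (hWU' : MapsTo φ W U')
    (hφ : ContDiffOn ℝ ∞ φ W) (hs : ∀ z ∈ W, Function.Surjective (fderiv ℝ φ z))
    (hgg : ∀ z ∈ W, ∀ u v, G z u v = G' (φ z) (fderiv ℝ φ z u) (fderiv ℝ φ z v))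
    {y : E} (hy : y ∈ W) (u v w : E) :
    fderiv ℝ φ y (curv (chr G) y u v w)
      = curv (chr G') (φ y) (fderiv ℝ φ y u) (fderiv ℝ φ y v) (fderiv ℝ φ y w) := by
  have hφy := hφ.contDiffAt (hW.mem_nhds hy)
  have hφ' : ContDiffAt ℝ ∞ (fderiv ℝ φ) y := hφy.fderiv_right (by simp)
  have hφ'' : ContDiffAt ℝ ∞ (fderiv ℝ (fderiv ℝ φ)) y := hφ'.fderiv_right (by simp)
  have hJ := (hφ'.differentiableAt (by simp)).hasFDerivAt
  have hH := (hφ''.differentiableAt (by simp)).hasFDerivAt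
  -- The transformation law of the Christoffel symbols, differentiated in the direction `v`.
  have key : ∀ v u w : E,
      fderiv ℝ φ y (fderiv ℝ (chrL G) y v u w) + fderiv ℝ (fderiv ℝ φ) y v (chr G y u w)
        = fderiv ℝ (chrL G') (φ y) (fderiv ℝ φ y v) (fderiv ℝ φ y u) (fderiv ℝ φ y w)
          + chr G' (φ y) (fderiv ℝ (fderiv ℝ φ) y v u) (fderiv ℝ φ y w)
          + chr G' (φ y) (fderiv ℝ φ y u) (fderiv ℝ (fderiv ℝ φ) y v w)
          + fderiv ℝ (fderiv ℝ (fderiv ℝ φ)) y v u w := by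
    intro v u w
    have h1 : HasFDerivAt (fun z ↦ fderiv ℝ φ z (chr G z u w)) _ y :=
      hJ.clm_apply (hG.hasFDerivAt_chr (hWU hy) u w)
    have h2 : HasFDerivAt (fun z ↦ chrL G' (φ z) (fderiv ℝ φ z u) (fderiv ℝ φ z w)
        + fderiv ℝ (fderiv ℝ φ) z u w) _ y :=
      ((((hG'.differentiableAt_chrL (hWU' hy)).hasFDerivAt.comp y
        (hφy.differentiableAt (by simp)).hasFDerivAt).clm_apply
          (hJ.clm_apply (hasFDerivAt_const u y))).clm_apply
            (hJ.clm_apply (hasFDerivAt_const w y))).add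
        ((hH.clm_apply (hasFDerivAt_const u y)).clm_apply (hasFDerivAt_const w y))
    have h3 := h1.unique (h2.congr_of_eventuallyEq (by
      filter_upwards [hW.mem_nhds hy] with z hz
      rw [chrL_apply]
      exact chr_transform hG hG' hW hWU hWU' hφ hs hgg hz u w))
    have h4 := congrArg (fun f : E →L[ℝ] E ↦ f v) h3
    simp [chrL_apply] at h4
    rw [h4]
    abel
  have hsymm : ∀ u v, fderiv ℝ (fderiv ℝ φ) y u v = fderiv ℝ (fderiv ℝ φ) y v u :=
    fun u v ↦ hφy.isSymmSndFDerivAt (by simp; norm_cast) u v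
  have hsymm3 : ∀ u v, fderiv ℝ (fderiv ℝ (fderiv ℝ φ)) y u v = fderiv ℝ (fderiv ℝ (fderiv ℝ φ)) y v u :=
    fun u v ↦ hφ'.isSymmSndFDerivAt (by simp; norm_cast) u v
  have hch := fun u v ↦ chr_transform hG hG' hW hWU hWU' hφ hs hgg hy u v
  rw [hG.curv_eq (hWU hy), hG'.curv_eq (hWU' hy)]
  -- Antisymmetrising `key` in `u` and `v` removes the third derivatives of `φ` and the symmetric
  -- second derivative in the directions `u`, `v`. The other second derivatives cancel against those
  -- produced by the quadratic terms, in `e1` and `e2`.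
  have k1 := key v u w
  have k2 := key u v w
  rw [hsymm3 u v, hsymm u v] at k2
  have e1 := hch v (chr G y u w)
  have e2 := hch u (chr G y v w)
  rw [hch u w] at e1
  rw [hch v w] at e2
  rw [chr_add_right] at e1 e2
  simp only [map_add, map_sub, e1, e2]
  rw [← eq_sub_iff_add_eq] at k1 k2
  rw [k1, k2]
  abel

/-- The gradient of a function with respect to `G`. -/
def grad (G : E → E →L[ℝ] E →L[ℝ] ℝ) (f : E → ℝ) (y : E) : E := (G y).inverse (fderiv ℝ f y)

/-- The Hessian of a function, in terms of its second derivative. -/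
lemma IsMetricOn.apply_covDeriv_grad [CompleteSpace E] {G : E → E →L[ℝ] E →L[ℝ] ℝ} {U : Set E}
    (hG : IsMetricOn G U) {f : E → ℝ} {y : E} (hy : y ∈ U) (hf : ContDiffAt ℝ ∞ f y) (u v : E) :
    DifferentiableAt ℝ (grad G f) y ∧
    G y (fderiv ℝ (grad G f) y u + chr G y u (grad G f y)) v
      = fderiv ℝ (fderiv ℝ f) y u v - fderiv ℝ f y (chr G y u v) := by
  have hf' : ContDiffAt ℝ ∞ (fderiv ℝ f) y := hf.fderiv_right (by simp)
  have hgr : DifferentiableAt ℝ (grad G f) y :=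
    ((hG.contDiffOn_inverse.contDiffAt (hG.isOpen.mem_nhds hy)).differentiableAt (by simp)).clm_apply
      (hf'.differentiableAt (by simp))
  refine ⟨hgr, ?_⟩
  -- The lowered gradient is `df` near `y`; differentiating this identity and using metric
  -- compatibility gives the covariant Hessian.
  have hap : ∀ z ∈ U, G z (grad G f z) = fderiv ℝ f z := fun z hz ↦
    (hG.invertible z hz).self_apply_inverse _
  have h1 : HasFDerivAt (fun z ↦ G z (grad G f z) v) _ y :=
    ((hG.differentiableAt hy).hasFDerivAt.clm_apply hgr.hasFDerivAt).clm_apply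
      (hasFDerivAt_const v y)
  have h2 : HasFDerivAt (fun z ↦ fderiv ℝ f z v) _ y :=
    (hf'.differentiableAt (by simp)).hasFDerivAt.clm_apply (hasFDerivAt_const v y)
  have h3 := h1.unique (h2.congr_of_eventuallyEq (by
    filter_upwards [hG.isOpen.mem_nhds hy] with z hz
    rw [hap z hz]))
  have h4 := congrArg (fun f : E →L[ℝ] ℝ ↦ f u) h3
  simp at h4
  rw [map_add, add_apply, ← h4, hG.fderiv_apply hy, ← hap y hy,
    hG.symm y hy (grad G f y)]
  ring

end LocalGeometry

/-! ### Metric, connection and curvature in the charts of the manifold -/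

section ChartCalculus

variable {n ν : ℕ} {M : Type*} [TopologicalSpace M] [ChartedSpace (Eucl n) M]
  [IsManifold (𝓡 n) ∞ M]

/-- The coordinate expression in the chart at `c` of tangent vectors at `p`. -/
abbrev toChart (c p : M) : Eucl n →L[ℝ] Eucl n := tangentCoordChange (𝓡 n) p c p

/-- The tangent vector at `p` with given coordinate expression in the chart at `c`. -/
abbrev ofChart (c p : M) : Eucl n →L[ℝ] Eucl n := tangentCoordChange (𝓡 n) c p p

/-- The change of coordinates between the charts at `c` and at `d`. -/
abbrev coordTrans (c d : M) : Eucl n → Eucl n := extChartAt (𝓡 n) d ∘ (extChartAt (𝓡 n) c).symm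

lemma mem_source_self (p : M) : p ∈ (chartAt (Eucl n) p).source := mem_chart_source (Eucl n) p

lemma tcc_comp {w x y z : M} (hw : z ∈ (chartAt (Eucl n) w).source)
    (hx : z ∈ (chartAt (Eucl n) x).source) (hy : z ∈ (chartAt (Eucl n) y).source) (v : Eucl n) :
    tangentCoordChange (𝓡 n) x y z (tangentCoordChange (𝓡 n) w x z v)
      = tangentCoordChange (𝓡 n) w y z v := by
  refine tangentCoordChange_comp ⟨⟨?_, ?_⟩, ?_⟩ <;> rwa [extChartAt_source]

lemma tcc_self {x z : M} (h : z ∈ (chartAt (Eucl n) x).source) (v : Eucl n) :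
    tangentCoordChange (𝓡 n) x x z v = v :=
  tangentCoordChange_self (by rwa [extChartAt_source])

lemma tcc_tcc {x y z : M} (hx : z ∈ (chartAt (Eucl n) x).source)
    (hy : z ∈ (chartAt (Eucl n) y).source) (v : Eucl n) :
    tangentCoordChange (𝓡 n) y x z (tangentCoordChange (𝓡 n) x y z v) = v := by
  rw [tcc_comp hx hy hx, tcc_self hx]

lemma toChart_ofChart {c p : M} (h : p ∈ (chartAt (Eucl n) c).source) (v : Eucl n) :
    toChart c p (ofChart c p v) = v := tcc_tcc h (mem_source_self p) v

lemma ofChart_toChart {c p : M} (h : p ∈ (chartAt (Eucl n) c).source) (v : Eucl n) :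
    ofChart c p (toChart c p v) = v := tcc_tcc (mem_source_self p) h v

lemma toChart_self (p : M) (v : Eucl n) : toChart p p v = v := tcc_self (mem_source_self p) v

lemma tcc_surjective {c d p : M} (hc : p ∈ (chartAt (Eucl n) c).source)
    (hd : p ∈ (chartAt (Eucl n) d).source) :
    Function.Surjective (tangentCoordChange (𝓡 n) c d p) :=
  fun v ↦ ⟨tangentCoordChange (𝓡 n) d c p v, tcc_tcc hd hc v⟩

lemma hasFDerivAt_coordTrans {c d p : M} (hc : p ∈ (chartAt (Eucl n) c).source)
    (hd : p ∈ (chartAt (Eucl n) d).source) :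
    HasFDerivAt (coordTrans c d) (tangentCoordChange (𝓡 n) c d p) (extChartAt (𝓡 n) c p) := by
  have h := hasFDerivWithinAt_tangentCoordChange (I := 𝓡 n) (x := c) (y := d) (z := p)
    ⟨by rwa [extChartAt_source], by rwa [extChartAt_source]⟩
  rw [ModelWithCorners.range_eq_univ, hasFDerivWithinAt_univ] at h
  exact h

/-- The part of the domain of coordinates at `c` that is covered by the chart at `d`. -/
def overlap (c d : M) : Set (Eucl n) :=
  (extChartAt (𝓡 n) c).target ∩ (extChartAt (𝓡 n) c).symm ⁻¹' (chartAt (Eucl n) d).source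

lemma isOpen_overlap (c d : M) : IsOpen (overlap (n := n) c d) :=
  (continuousOn_extChartAt_symm c).isOpen_inter_preimage (isOpen_extChartAt_target c)
    (chartAt (Eucl n) d).open_source

lemma mem_overlap {c d p : M} (hc : p ∈ (chartAt (Eucl n) c).source)
    (hd : p ∈ (chartAt (Eucl n) d).source) : extChartAt (𝓡 n) c p ∈ overlap (n := n) c d := by
  have hc' : p ∈ (extChartAt (𝓡 n) c).source := by rwa [extChartAt_source]
  refine ⟨(extChartAt (𝓡 n) c).map_source hc', ?_⟩
  rwa [mem_preimage, (extChartAt (𝓡 n) c).left_inv hc']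

lemma exists_of_mem_overlap {c d : M} {y : Eucl n} (hy : y ∈ overlap c d) :
    ∃ p, p ∈ (chartAt (Eucl n) c).source ∧ p ∈ (chartAt (Eucl n) d).source ∧
      extChartAt (𝓡 n) c p = y := by
  refine ⟨(extChartAt (𝓡 n) c).symm y, ?_, hy.2, (extChartAt (𝓡 n) c).right_inv hy.1⟩
  rw [← extChartAt_source (I := 𝓡 n)]
  exact (extChartAt (𝓡 n) c).map_target hy.1

lemma coordTrans_apply {c d p : M} (hc : p ∈ (chartAt (Eucl n) c).source) :
    coordTrans c d (extChartAt (𝓡 n) c p) = extChartAt (𝓡 n) d p := by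
  have hc' : p ∈ (extChartAt (𝓡 n) c).source := by rwa [extChartAt_source]
  simp only [coordTrans, Function.comp, (extChartAt (𝓡 n) c).left_inv hc']

lemma contDiffOn_coordTrans (c d : M) : ContDiffOn ℝ ∞ (coordTrans (n := n) c d) (overlap c d) := by
  refine (contDiffOn_ext_coord_change (I := 𝓡 n) (n := ∞) d c).mono fun y hy ↦ ?_
  obtain ⟨p, hc, hd, rfl⟩ := exists_of_mem_overlap hy
  have hc' : p ∈ (extChartAt (𝓡 n) c).source := by rwa [extChartAt_source]
  have hd' : p ∈ (extChartAt (𝓡 n) d).source := by rwa [extChartAt_source]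
  rw [PartialEquiv.trans_source]
  refine ⟨(extChartAt (𝓡 n) c).map_source hc', ?_⟩
  change (extChartAt (𝓡 n) c).symm _ ∈ (extChartAt (𝓡 n) d).source
  rwa [(extChartAt (𝓡 n) c).left_inv hc']

lemma mapsTo_coordTrans (c d : M) :
    MapsTo (coordTrans (n := n) c d) (overlap c d) (extChartAt (𝓡 n) d).target := by
  intro y hy
  obtain ⟨p, hc, hd, rfl⟩ := exists_of_mem_overlap hy
  rw [coordTrans_apply hc]
  exact (extChartAt (𝓡 n) d).map_source (by rwa [extChartAt_source])

variable (g : SemiRiemannianMetric n ν M)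

/-- The metric at a point, as a bilinear form on the model space. -/
def metricAt (p : M) : Eucl n →L[ℝ] Eucl n →L[ℝ] ℝ := g.val p

lemma metricAt_symm (p : M) (u v : Eucl n) : metricAt g p u v = metricAt g p v u := g.symm p u v

lemma metricAt_nondegenerate {p : M} {u : Eucl n} (h : ∀ v, metricAt g p u v = 0) : u = 0 :=
  g.nondegenerate p u h

lemma metricIn_apply {c p : M} (hc : p ∈ (chartAt (Eucl n) c).source) (u v : Eucl n) :
    metricIn g c (extChartAt (𝓡 n) c p) u v = metricAt g p (ofChart c p u) (ofChart c p v) := by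
  have hc' : p ∈ (extChartAt (𝓡 n) c).source := by rwa [extChartAt_source]
  -- The base point enters the form and both coordinate changes, so it is generalised to `q` and
  -- then substituted.
  have key : ∀ q, q = p → ((metricAt g q).bilinearComp (tangentCoordChange (𝓡 n) c q q)
      (tangentCoordChange (𝓡 n) c q q)) u v = metricAt g p (ofChart c p u) (ofChart c p v) := by
    rintro q rfl
    rfl
  exact key _ ((extChartAt (𝓡 n) c).left_inv hc')

lemma metricAt_eq_metricIn {c p : M} (hc : p ∈ (chartAt (Eucl n) c).source) (u v : Eucl n) :
    metricAt g p u v = metricIn g c (extChartAt (𝓡 n) c p) (toChart c p u) (toChart c p v) := by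
  rw [metricIn_apply g hc, ofChart_toChart hc, ofChart_toChart hc]

lemma metricIn_trans {c d p : M} (hc : p ∈ (chartAt (Eucl n) c).source)
    (hd : p ∈ (chartAt (Eucl n) d).source) (u v : Eucl n) :
    metricIn g c (extChartAt (𝓡 n) c p) u v = metricIn g d (extChartAt (𝓡 n) d p)
      (tangentCoordChange (𝓡 n) c d p u) (tangentCoordChange (𝓡 n) c d p v) := by
  rw [metricIn_apply g hc, metricIn_apply g hd, tcc_comp hc hd (mem_source_self p),
    tcc_comp hc hd (mem_source_self p)]

/-- A coordinate frame field has a constant expression in the trivialisation given by its own chart.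
-/
lemma contMDiffOn_ofChart (c : M) (u : Eucl n) :
    ContMDiffOn (𝓡 n) ((𝓡 n).prod 𝓘(ℝ, Eucl n)) ∞
      (fun p ↦ Bundle.TotalSpace.mk' (Eucl n) (E := (TangentSpace (𝓡 n) : M → Type _)) p
        (ofChart c p u)) (chartAt (Eucl n) c).source := by
  have h := (Bundle.Trivialization.contMDiffOn_section_baseSet_iff (IB := 𝓡 n) (n := ∞)
    (E := (TangentSpace (𝓡 n) : M → Type _)) (s := fun p : M ↦ ofChart c p u)
    (trivializationAt (Eucl n) (TangentSpace (𝓡 n) : M → Type _) c)).2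
  refine h ?_
  refine (contMDiffOn_const (c := u)).congr fun p hp ↦ ?_
  exact toChart_ofChart hp u

/-- The entries of the metric in coordinates are `g` applied to two smooth coordinate frame fields;
in finite dimension smooth entries suffice. -/
lemma contDiffOn_metricIn (c : M) :
    ContDiffOn ℝ ∞ (metricIn g c) (extChartAt (𝓡 n) c).target := by
  rw [contDiffOn_clm_apply]
  intro u
  rw [contDiffOn_clm_apply]
  intro v
  have h := ContMDiffOn.clm_bundle_apply₂ (F₃ := ℝ) (E₃ := Bundle.Trivial M ℝ) (b := id)
    g.contMDiff.contMDiffOn (contMDiffOn_ofChart c u) (contMDiffOn_ofChart c v)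
  have h2 : ContMDiffOn (𝓡 n) 𝓘(ℝ, ℝ) ∞ (fun p ↦ g.val p (ofChart c p u) (ofChart c p v))
      (chartAt (Eucl n) c).source := fun p hp ↦ by
    have := h p hp
    simp only [Bundle.contMDiffWithinAt_totalSpace] at this
    exact this.2
  have h3 := h2.comp (contMDiffOn_extChartAt_symm (I := 𝓡 n) (n := ∞) c) fun y hy ↦ by
    rw [← extChartAt_source (I := 𝓡 n)]
    exact (extChartAt (𝓡 n) c).map_target hy
  exact contMDiffOn_iff_contDiffOn.1 h3

lemma isInvertible_of_nondegenerate {b : Eucl n →L[ℝ] Eucl n →L[ℝ] ℝ}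
    (h : ∀ u, (∀ v, b u v = 0) → u = 0) : b.IsInvertible := by
  have hinj : Function.Injective (b : Eucl n →ₗ[ℝ] (Eucl n →L[ℝ] ℝ)) := by
    rw [← LinearMap.ker_eq_bot, LinearMap.ker_eq_bot']
    exact fun u hu ↦ h u fun v ↦ by
      have := congrArg (fun f : Eucl n →L[ℝ] ℝ ↦ f v) hu
      simpa using this
  have hd : Module.finrank ℝ (Eucl n) = Module.finrank ℝ (Eucl n →L[ℝ] ℝ) :=
    (InnerProductSpace.toDual ℝ (Eucl n)).toLinearEquiv.finrank_eq
  let e := LinearEquiv.ofInjectiveOfFinrankEq (b : Eucl n →ₗ[ℝ] (Eucl n →L[ℝ] ℝ)) hinj hd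
  exact ⟨e.toContinuousLinearEquiv, by ext; rfl⟩

lemma isInvertible_metricAt (p : M) :
    (metricAt g p).IsInvertible :=
  isInvertible_of_nondegenerate fun _ ↦ metricAt_nondegenerate g

lemma isMetricOn_metricIn (c : M) : IsMetricOn (metricIn g c) (extChartAt (𝓡 n) c).target := by
  have key : ∀ y ∈ (extChartAt (𝓡 n) c).target, ∃ p ∈ (chartAt (Eucl n) c).source,
      extChartAt (𝓡 n) c p = y := fun y hy ↦ ⟨(extChartAt (𝓡 n) c).symm y, by
    rw [← extChartAt_source (I := 𝓡 n)]
    exact (extChartAt (𝓡 n) c).map_target hy, (extChartAt (𝓡 n) c).right_inv hy⟩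
  refine ⟨isOpen_extChartAt_target c, contDiffOn_metricIn g c, fun y hy u v ↦ ?_, fun y hy ↦ ?_⟩
  · obtain ⟨p, hp, rfl⟩ := key y hy
    rw [metricIn_apply g hp, metricIn_apply g hp, metricAt_symm]
  · obtain ⟨p, hp, rfl⟩ := key y hy
    refine isInvertible_of_nondegenerate fun u hu ↦ ?_
    have h : ofChart c p u = 0 := metricAt_nondegenerate g fun v ↦ by
      rw [← ofChart_toChart hp v]
      exact (metricIn_apply g hp u _).symm.trans (hu _)
    rw [← toChart_ofChart hp u, h, map_zero]

lemma christoffel_eq (c : M) : christoffel g c = chr (metricIn g c) := rfl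

lemma fderiv_coordTrans {c d p : M} (hc : p ∈ (chartAt (Eucl n) c).source)
    (hd : p ∈ (chartAt (Eucl n) d).source) :
    fderiv ℝ (coordTrans c d) (extChartAt (𝓡 n) c p) = tangentCoordChange (𝓡 n) c d p :=
  (hasFDerivAt_coordTrans hc hd).fderiv

lemma overlap_subset (c d : M) : overlap (n := n) c d ⊆ (extChartAt (𝓡 n) c).target :=
  inter_subset_left

lemma fderiv_coordTrans_surjective (c d : M) : ∀ z ∈ overlap (n := n) c d,
    Function.Surjective (fderiv ℝ (coordTrans (n := n) c d) z) := by
  intro z hz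
  obtain ⟨p, hc, hd, rfl⟩ := exists_of_mem_overlap hz
  rw [fderiv_coordTrans hc hd]
  exact tcc_surjective hc hd

lemma metricIn_pullback (c d : M) : ∀ z ∈ overlap (n := n) c d, ∀ u v,
    metricIn g c z u v = metricIn g d (coordTrans c d z) (fderiv ℝ (coordTrans c d) z u)
      (fderiv ℝ (coordTrans c d) z v) := by
  intro z hz u v
  obtain ⟨p, hc, hd, rfl⟩ := exists_of_mem_overlap hz
  rw [fderiv_coordTrans hc hd, coordTrans_apply hc, metricIn_trans g hc hd]

lemma christoffel_trans {c d p : M} (hc : p ∈ (chartAt (Eucl n) c).source)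
    (hd : p ∈ (chartAt (Eucl n) d).source) (u v : Eucl n) :
    tangentCoordChange (𝓡 n) c d p (christoffel g c (extChartAt (𝓡 n) c p) u v)
      = christoffel g d (extChartAt (𝓡 n) d p) (tangentCoordChange (𝓡 n) c d p u)
          (tangentCoordChange (𝓡 n) c d p v)
        + fderiv ℝ (fderiv ℝ (coordTrans c d)) (extChartAt (𝓡 n) c p) u v := by
  have h := chr_transform (isMetricOn_metricIn g c) (isMetricOn_metricIn g d) (isOpen_overlap c d)
    (overlap_subset c d) (mapsTo_coordTrans c d) (contDiffOn_coordTrans c d)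
    (fderiv_coordTrans_surjective c d) (metricIn_pullback g c d) (mem_overlap hc hd) u v
  rwa [fderiv_coordTrans hc hd, coordTrans_apply hc] at h

lemma curv_trans {c d p : M} (hc : p ∈ (chartAt (Eucl n) c).source)
    (hd : p ∈ (chartAt (Eucl n) d).source) (u v w : Eucl n) :
    tangentCoordChange (𝓡 n) c d p
        (curv (chr (metricIn g c)) (extChartAt (𝓡 n) c p) u v w)
      = curv (chr (metricIn g d)) (extChartAt (𝓡 n) d p) (tangentCoordChange (𝓡 n) c d p u)
          (tangentCoordChange (𝓡 n) c d p v) (tangentCoordChange (𝓡 n) c d p w) := by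
  have h := curv_transform (isMetricOn_metricIn g c) (isMetricOn_metricIn g d) (isOpen_overlap c d)
    (overlap_subset c d) (mapsTo_coordTrans c d) (contDiffOn_coordTrans c d)
    (fderiv_coordTrans_surjective c d) (metricIn_pullback g c d) (mem_overlap hc hd) u v w
  rwa [fderiv_coordTrans hc hd, coordTrans_apply hc] at h

/-- `curvature` is defined in the chart at `p` itself; the tensoriality `curv_trans` allows it to be
computed in one fixed chart `c` along a whole piece of curve. -/
lemma metricAt_curvature {c p : M} (hc : p ∈ (chartAt (Eucl n) c).source) (u v w x : Eucl n) :
    metricAt g p (curvature g p u v w) x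
      = metricIn g c (extChartAt (𝓡 n) c p) (curv (chr (metricIn g c)) (extChartAt (𝓡 n) c p)
        (toChart c p u) (toChart c p v) (toChart c p w)) (toChart c p x) := by
  refine (metricAt_eq_metricIn g hc _ _).trans ?_
  rw [← curv_trans g (mem_source_self p) hc]
  rfl

end ChartCalculus

/-! ### The zeroth order coefficient of the index form -/

section TidalForm

variable {E : Type*} [NormedAddCommGroup E] [NormedSpace ℝ E]

/-- The operator `u ↦ R (p, u) p` for the metric `G`. -/
def tidalMap (G : E → E →L[ℝ] E →L[ℝ] ℝ) (y p : E) : E →L[ℝ] E :=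
  ((fderiv ℝ (chrL G) y).flip p).flip p - (fderiv ℝ (chrL G) y p).flip p
    + (chrL G y).flip (chrL G y p p) - (chrL G y p).comp ((chrL G y).flip p)

/-- The bilinear form `g (R (p, u) p + D_u ∇f, v)`. -/
def tidalForm (G : E → E →L[ℝ] E →L[ℝ] ℝ) (f : E → ℝ) (y p : E) : E →L[ℝ] E →L[ℝ] ℝ :=
  (G y).comp (tidalMap G y p) + fderiv ℝ (fderiv ℝ f) y
    - (ContinuousLinearMap.compL ℝ E E ℝ (fderiv ℝ f y)).comp (chrL G y)

variable [CompleteSpace E] {G : E → E →L[ℝ] E →L[ℝ] ℝ} {U : Set E}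

lemma IsMetricOn.tidalMap_apply (hG : IsMetricOn G U) {y : E} (hy : y ∈ U) (p u : E) :
    tidalMap G y p u = curv (chr G) y p u p := by
  rw [hG.curv_eq hy]
  rfl

lemma IsMetricOn.tidalForm_apply (hG : IsMetricOn G U) {y : E} (hy : y ∈ U) (f : E → ℝ)
    (p u v : E) : tidalForm G f y p u v = G y (curv (chr G) y p u p) v
      + (fderiv ℝ (fderiv ℝ f) y u v - fderiv ℝ f y (chr G y u v)) := by
  rw [← hG.tidalMap_apply hy, ← chrL_apply, ← add_sub_assoc]
  rfl

/-- The curvature part is symmetric by `apply_curv_comm`, the Hessian part because second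
derivatives commute and the connection is torsion free. -/
lemma IsMetricOn.tidalForm_symm (hG : IsMetricOn G U) {y : E} (hy : y ∈ U) {f : E → ℝ}
    (hf : ContDiffAt ℝ ∞ f y) (p u v : E) : tidalForm G f y p u v = tidalForm G f y p v u := by
  rw [hG.tidalForm_apply hy, hG.tidalForm_apply hy, hG.apply_curv_comm hy, hG.chr_symm hy u v,
    (hf.isSymmSndFDerivAt (by simp; norm_cast)) u v]

/-- The partial derivative is the derivative within `I ×ˢ U` composed with the inclusion of the
second factor. Working within the set gives smoothness up to the end points of `I`, which matters
for a potential given only over `[0, 1]`. -/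
lemma ContDiffOn.partial_fderiv {F : Type*} [NormedAddCommGroup F] [NormedSpace ℝ F]
    {f : ℝ → E → F} {I : Set ℝ} (hI : UniqueDiffOn ℝ I) (hU : IsOpen U)
    (hf : ContDiffOn ℝ ∞ (fun z : ℝ × E ↦ f z.1 z.2) (I ×ˢ U)) :
    ContDiffOn ℝ ∞ (fun z : ℝ × E ↦ fderiv ℝ (f z.1) z.2) (I ×ˢ U) := by
  have h1 : ContDiffOn ℝ ∞ (fderivWithin ℝ (fun z : ℝ × E ↦ f z.1 z.2) (I ×ˢ U)) (I ×ˢ U) :=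
    hf.fderivWithin (hI.prod hU.uniqueDiffOn) (by simp)
  refine (h1.clm_comp (contDiffOn_const (c := ContinuousLinearMap.inr ℝ ℝ E))).congr ?_
  rintro ⟨x, y⟩ ⟨hx, hy⟩
  have h2 := ((hf.differentiableOn (by simp)) (x, y) ⟨hx, hy⟩).hasFDerivWithinAt
  have h3 : HasFDerivWithinAt (fun y ↦ (x, y)) (ContinuousLinearMap.inr ℝ ℝ E) U y :=
    (hasFDerivAt_prodMk_right x y).hasFDerivWithinAt
  have h4 := (h2.comp y h3 fun z hz ↦ ⟨hx, hz⟩).hasFDerivAt (hU.mem_nhds hy)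
  exact h4.fderiv

lemma ContDiffOn.partial_right {F : Type*} [NormedAddCommGroup F] [NormedSpace ℝ F]
    {f : ℝ → E → F} {I : Set ℝ}
    (hf : ContDiffOn ℝ ∞ (fun z : ℝ × E ↦ f z.1 z.2) (I ×ˢ U)) {x : ℝ} (hx : x ∈ I) :
    ContDiffOn ℝ ∞ (f x) U :=
  hf.comp (f := fun y ↦ (x, y)) (contDiff_prodMk_right x).contDiffOn fun _ hy ↦ ⟨hx, hy⟩

lemma IsMetricOn.contDiffOn_tidalForm (hG : IsMetricOn G U) {f : ℝ → E → ℝ} {I J : Set ℝ}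
    (hI : UniqueDiffOn ℝ I) (hf : ContDiffOn ℝ ∞ (fun z : ℝ × E ↦ f z.1 z.2) (I ×ˢ U))
    {y p : ℝ → E} (hJ : J ⊆ I) (hy : ContDiffOn ℝ ∞ y J) (hp : ContDiffOn ℝ ∞ p J)
    (hyU : MapsTo y J U) : ContDiffOn ℝ ∞ (fun t ↦ tidalForm G (f t) (y t) (p t)) J := by
  have h1 := ContDiffOn.partial_fderiv hI hG.isOpen hf
  have h2 := ContDiffOn.partial_fderiv (f := fun t ↦ fderiv ℝ (f t)) hI hG.isOpen h1
  have hty : ContDiffOn ℝ ∞ (fun t ↦ (t, y t)) J := contDiffOn_id.prodMk hy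
  have hm : MapsTo (fun t ↦ (t, y t)) J (I ×ˢ U) := fun t ht ↦ ⟨hJ ht, hyU ht⟩
  have k1 : ContDiffOn ℝ ∞ (fun t ↦ fderiv ℝ (f t) (y t)) J := h1.comp hty hm
  have k2 : ContDiffOn ℝ ∞ (fun t ↦ fderiv ℝ (fderiv ℝ (f t)) (y t)) J := h2.comp hty hm
  have k3 : ContDiffOn ℝ ∞ (fun t ↦ G (y t)) J := hG.smooth.comp hy hyU
  have k4 : ContDiffOn ℝ ∞ (fun t ↦ chrL G (y t)) J := hG.contDiffOn_chrL.comp hy hyU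
  have k5 : ContDiffOn ℝ ∞ (fun t ↦ fderiv ℝ (chrL G) (y t)) J :=
    (hG.contDiffOn_chrL.fderiv_of_isOpen hG.isOpen (by simp)).comp hy hyU
  have flip2 : ∀ {a : ℝ → E →L[ℝ] E →L[ℝ] E}, ContDiffOn ℝ ∞ a J →
      ContDiffOn ℝ ∞ (fun t ↦ (a t).flip) J := fun ha ↦
    (ContinuousLinearMap.flipₗᵢ ℝ E E E).contDiff.comp_contDiffOn ha
  have flip3 : ContDiffOn ℝ ∞ (fun t ↦ (fderiv ℝ (chrL G) (y t)).flip) J :=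
    (ContinuousLinearMap.flipₗᵢ ℝ E E (E →L[ℝ] E)).contDiff.comp_contDiffOn k5
  have kc : ContDiffOn ℝ ∞ (fun t ↦ ContinuousLinearMap.compL ℝ E E ℝ (fderiv ℝ (f t) (y t))) J :=
    (ContinuousLinearMap.compL ℝ E E ℝ).contDiff.comp_contDiffOn k1
  unfold tidalForm tidalMap
  exact ((k3.clm_comp ((((flip2 (flip3.clm_apply hp)).clm_apply hp).sub
    ((flip2 (k5.clm_apply hp)).clm_apply hp)).add
    ((flip2 k4).clm_apply ((k4.clm_apply hp).clm_apply hp)) |>.sub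
    ((k4.clm_apply hp).clm_comp ((flip2 k4).clm_apply hp)))).add k2).sub (kc.clm_comp k4)

omit [CompleteSpace E] in
lemma fderiv_of_eventuallyEq_comp {f f₀ : E → ℝ} {φ : E → E} {y : E} (hφ : ContDiffAt ℝ ∞ φ y)
    (hf : ContDiffAt ℝ ∞ f (φ y)) (h : f₀ =ᶠ[𝓝 y] f ∘ φ) (u : E) :
    fderiv ℝ f₀ y u = fderiv ℝ f (φ y) (fderiv ℝ φ y u) := by
  rw [h.fderiv_eq, fderiv_comp y (hf.differentiableAt (by simp)) (hφ.differentiableAt (by simp))]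
  rfl

lemma snd_fderiv_of_eventuallyEq_comp {f f₀ : E → ℝ} {φ : E → E} {y : E}
    (hφ : ContDiffAt ℝ ∞ φ y) (hf : ContDiffAt ℝ ∞ f (φ y)) (h : f₀ =ᶠ[𝓝 y] f ∘ φ) (u v : E) :
    fderiv ℝ (fderiv ℝ f₀) y u v = fderiv ℝ (fderiv ℝ f) (φ y) (fderiv ℝ φ y u) (fderiv ℝ φ y v)
      + fderiv ℝ f (φ y) (fderiv ℝ (fderiv ℝ φ) y u v) := by
  have hφ' : ContDiffAt ℝ ∞ (fderiv ℝ φ) y := hφ.fderiv_right (by simp)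
  have hf' : ContDiffAt ℝ ∞ (fderiv ℝ f) (φ y) := hf.fderiv_right (by simp)
  have hev : ∀ᶠ z in 𝓝 y, fderiv ℝ f₀ z = (fderiv ℝ f (φ z)).comp (fderiv ℝ φ z) := by
    filter_upwards [h.eventuallyEq_nhds, (hφ.of_le (m := 1) (by simp)).eventually (by simp),
      hφ.continuousAt.eventually ((hf.of_le (m := 1) (by simp)).eventually (by simp))] with z hz h1 h2
    rw [hz.fderiv_eq]
    exact fderiv_comp z (h2.differentiableAt (by simp)) (h1.differentiableAt (by simp))
  have hd1 : HasFDerivAt (fun z ↦ fderiv ℝ f (φ z)) _ y :=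
    (hf'.differentiableAt (by simp)).hasFDerivAt.comp y (hφ.differentiableAt (by simp)).hasFDerivAt
  have hd2 := hd1.clm_comp (hφ'.differentiableAt (by simp)).hasFDerivAt
  rw [(hd2.congr_of_eventuallyEq hev).fderiv]
  simp
  ring

end TidalForm

/-! ### Velocities, differentials and gradients in coordinates -/

section CurveCalculus

variable {n ν : ℕ} {M : Type*} [TopologicalSpace M] [ChartedSpace (Eucl n) M]
  [IsManifold (𝓡 n) ∞ M]

/-- The coordinate expression of a curve. -/
abbrev curveIn (c : M) (γ : ℝ → M) (t : ℝ) : Eucl n := extChartAt (𝓡 n) c (γ t)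

/-- The coordinate expression of a function. -/
abbrev funIn (c : M) (f : M → ℝ) : Eucl n → ℝ := f ∘ (extChartAt (𝓡 n) c).symm

lemma mem_target_of_mem_source {c p : M} (h : p ∈ (chartAt (Eucl n) c).source) :
    extChartAt (𝓡 n) c p ∈ (extChartAt (𝓡 n) c).target :=
  (extChartAt (𝓡 n) c).map_source (by rwa [extChartAt_source])

lemma symm_mem_source {c : M} {y : Eucl n} (h : y ∈ (extChartAt (𝓡 n) c).target) :
    (extChartAt (𝓡 n) c).symm y ∈ (chartAt (Eucl n) c).source := by
  rw [← extChartAt_source (I := 𝓡 n)]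
  exact (extChartAt (𝓡 n) c).map_target h

lemma symm_extChartAt {c p : M} (h : p ∈ (chartAt (Eucl n) c).source) :
    (extChartAt (𝓡 n) c).symm (extChartAt (𝓡 n) c p) = p :=
  (extChartAt (𝓡 n) c).left_inv (by rwa [extChartAt_source])

/-- Velocity of a curve in coordinates. -/
lemma hasDerivWithinAt_curveIn {β : ℝ → M} {s : Set ℝ} {t : ℝ}
    (hβ : MDifferentiableWithinAt 𝓘(ℝ, ℝ) (𝓡 n) β s t) {c : M}
    (hc : β t ∈ (chartAt (Eucl n) c).source) :
    HasDerivWithinAt (curveIn c β)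
      (toChart c (β t) (mfderivWithin 𝓘(ℝ, ℝ) (𝓡 n) β s t (1 : ℝ))) s t := by
  have h1 := hβ.hasMFDerivWithinAt.2
  simp only [writtenInExtChartAt, mfld_simps] at h1
  have h1' : HasFDerivWithinAt (curveIn (β t) β)
      (mfderivWithin 𝓘(ℝ, ℝ) (𝓡 n) β s t : ℝ →L[ℝ] Eucl n) s t := h1
  have h2 := (hasFDerivAt_coordTrans (mem_source_self (β t)) hc).comp_hasFDerivWithinAt t h1'
  have h3 := h2.congr_of_eventuallyEq (f₁ := curveIn c β) (by
    filter_upwards [hβ.continuousWithinAt.preimage_mem_nhdsWithin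
      ((chartAt (Eucl n) (β t)).open_source.mem_nhds (mem_source_self (β t)))] with r hr
    exact (coordTrans_apply hr).symm) (coordTrans_apply (mem_source_self _)).symm
  exact h3.hasDerivWithinAt

/-- The differential of a function, as a linear form on the model space. -/
def diffAt (f : M → ℝ) (p : M) : Eucl n →L[ℝ] ℝ := mfderiv (𝓡 n) 𝓘(ℝ, ℝ) f p

/-- The differential of a function in coordinates. -/
lemma fderiv_funIn {f : M → ℝ} {p c : M} (hf : MDifferentiableAt (𝓡 n) 𝓘(ℝ, ℝ) f p)
    (hc : p ∈ (chartAt (Eucl n) c).source) (u : Eucl n) :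
    DifferentiableAt ℝ (funIn c f) (extChartAt (𝓡 n) c p) ∧
    diffAt f p (ofChart c p u)
      = fderiv ℝ (funIn c f) (extChartAt (𝓡 n) c p) u := by
  have h1 := hf.hasMFDerivAt.2
  simp only [writtenInExtChartAt, mfld_simps] at h1
  have h1' : HasFDerivAt (funIn p f) (diffAt f p)
      (extChartAt (𝓡 n) p p) :=
    hasFDerivWithinAt_univ.1 h1
  have h2 := hasFDerivAt_coordTrans hc (mem_source_self p)
  rw [← coordTrans_apply hc] at h1'
  have h3 := h1'.comp _ h2
  have h4 : HasFDerivAt (funIn c f) ((diffAt f p).comp (ofChart c p)) (extChartAt (𝓡 n) c p) := by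
    refine h3.congr_of_eventuallyEq ?_
    filter_upwards [(isOpen_overlap c p).mem_nhds (mem_overlap hc (mem_source_self p))] with y hy
    obtain ⟨q, hq, hq', rfl⟩ := exists_of_mem_overlap hy
    simp only [Function.comp_apply, symm_extChartAt hq, symm_extChartAt hq']
  refine ⟨h4.differentiableAt, ?_⟩
  rw [h4.fderiv]
  rfl

/-- A potential in coordinates. -/
lemma contDiffOn_funIn {V : ℝ → M → ℝ} (hV : IsSmoothPotential n V) (c : M) :
    ContDiffOn ℝ ∞ (fun z : ℝ × Eucl n ↦ funIn c (V z.1) z.2)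
      (Icc 0 1 ×ˢ (extChartAt (𝓡 n) c).target) := by
  have h1 : ContMDiffOn (𝓘(ℝ, ℝ).prod 𝓘(ℝ, Eucl n)) (𝓘(ℝ, ℝ).prod (𝓡 n)) ∞
      (fun z : ℝ × Eucl n ↦ (z.1, (extChartAt (𝓡 n) c).symm z.2))
      (Icc 0 1 ×ˢ (extChartAt (𝓡 n) c).target) :=
    contMDiffOn_fst.prodMk ((contMDiffOn_extChartAt_symm (I := 𝓡 n) (n := ∞) c).comp
      contMDiffOn_snd fun z hz ↦ hz.2)
  have h2 := ContMDiffOn.comp hV h1 fun z hz ↦ ⟨hz.1, mem_univ _⟩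
  rw [← modelWithCornersSelf_prod, chartedSpaceSelf_prod] at h2
  exact contMDiffOn_iff_contDiffOn.1 h2

lemma mdifferentiableAt_potential {V : ℝ → M → ℝ} (hV : IsSmoothPotential n V) {x : ℝ}
    (hx : x ∈ Icc (0 : ℝ) 1) (p : M) : MDifferentiableAt (𝓡 n) 𝓘(ℝ, ℝ) (V x) p := by
  have h : ContMDiffOn (𝓡 n) 𝓘(ℝ, ℝ) ∞ (V x) univ :=
    ContMDiffOn.comp (f := fun q : M ↦ (x, q)) hV
      (contMDiffOn_const.prodMk contMDiffOn_id) fun q _ ↦ ⟨hx, mem_univ q⟩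
  exact (contMDiffOn_univ.1 h p).mdifferentiableAt (by simp)

variable (g : SemiRiemannianMetric n ν M)

lemma metricAt_metricGradient {V : ℝ → M → ℝ} (hV : IsSmoothPotential n V) {x : ℝ}
    (hx : x ∈ Icc (0 : ℝ) 1) {c p : M} (hc : p ∈ (chartAt (Eucl n) c).source) (u : Eucl n) :
    metricAt g p (metricGradient g (V x) p) u
      = fderiv ℝ (funIn c (V x)) (extChartAt (𝓡 n) c p) (toChart c p u) := by
  rw [← (fderiv_funIn (mdifferentiableAt_potential hV hx p) hc _).2, ofChart_toChart hc]
  exact congrArg (fun l : Eucl n →L[ℝ] ℝ ↦ l u)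
    ((isInvertible_metricAt g p).self_apply_inverse (mfderiv (𝓡 n) 𝓘(ℝ, ℝ) (V x) p))

lemma toChart_metricGradient {V : ℝ → M → ℝ} (hV : IsSmoothPotential n V) {x : ℝ}
    (hx : x ∈ Icc (0 : ℝ) 1) {c p : M} (hc : p ∈ (chartAt (Eucl n) c).source) :
    toChart c p (metricGradient g (V x) p)
      = grad (metricIn g c) (funIn c (V x)) (extChartAt (𝓡 n) c p) := by
  have hi := (isMetricOn_metricIn g c).invertible _ (mem_target_of_mem_source hc)
  have h : metricIn g c (extChartAt (𝓡 n) c p) (toChart c p (metricGradient g (V x) p))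
      = fderiv ℝ (funIn c (V x)) (extChartAt (𝓡 n) c p) := by
    ext u
    rw [← toChart_ofChart hc u]
    refine (metricAt_eq_metricIn g hc _ _).symm.trans ?_
    exact metricAt_metricGradient g hV hx hc _
  rw [grad, ← h, hi.inverse_apply_self]

lemma contDiffAt_funIn {V : ℝ → M → ℝ} (hV : IsSmoothPotential n V) {x : ℝ}
    (hx : x ∈ Icc (0 : ℝ) 1) {c : M} {y : Eucl n} (hy : y ∈ (extChartAt (𝓡 n) c).target) :
    ContDiffAt ℝ ∞ (funIn c (V x)) y :=
  (ContDiffOn.partial_right (f := fun x ↦ funIn c (V x)) (contDiffOn_funIn hV c) hx).contDiffAt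
    ((isOpen_extChartAt_target c).mem_nhds hy)

/-- The derivative `D_u ∇V` is computed in the chart at `p`, where its pairing with `v` is the
covariant Hessian. In passing to the chart at `c`, the second derivative of the change of charts
occurs both in the second derivative of `V` and in the Christoffel symbols, and cancels. -/
lemma metricAt_covDerivField {V : ℝ → M → ℝ} (hV : IsSmoothPotential n V) {x : ℝ}
    (hx : x ∈ Icc (0 : ℝ) 1) {c p : M} (hc : p ∈ (chartAt (Eucl n) c).source) (u v : Eucl n) :
    metricAt g p (covDerivField g (metricGradient g (V x)) p u) v
      = fderiv ℝ (fderiv ℝ (funIn c (V x))) (extChartAt (𝓡 n) c p) (toChart c p u) (toChart c p v)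
        - fderiv ℝ (funIn c (V x)) (extChartAt (𝓡 n) c p)
          (christoffel g c (extChartAt (𝓡 n) c p) (toChart c p u) (toChart c p v)) := by
  have hp := mem_source_self (n := n) p
  have hpt := mem_target_of_mem_source hp
  have e1 : covDerivField g (metricGradient g (V x)) p u
      = fderiv ℝ (grad (metricIn g p) (funIn p (V x))) (extChartAt (𝓡 n) p p) u
        + chr (metricIn g p) (extChartAt (𝓡 n) p p) u
          (grad (metricIn g p) (funIn p (V x)) (extChartAt (𝓡 n) p p)) := by
    have e2 : (fun z ↦ toChart p ((extChartAt (𝓡 n) p).symm z)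
          (metricGradient g (V x) ((extChartAt (𝓡 n) p).symm z)))
        =ᶠ[𝓝 (extChartAt (𝓡 n) p p)] grad (metricIn g p) (funIn p (V x)) := by
      filter_upwards [(isOpen_extChartAt_target p).mem_nhds hpt] with z hz
      refine (toChart_metricGradient g hV hx (symm_mem_source hz)).trans ?_
      rw [(extChartAt (𝓡 n) p).right_inv hz]
    have e3 : metricGradient g (V x) p
        = grad (metricIn g p) (funIn p (V x)) (extChartAt (𝓡 n) p p) := by
      rw [← toChart_metricGradient g hV hx hp]
      exact (toChart_self p _).symm
    change fderiv ℝ _ _ u + christoffel g p _ u (metricGradient g (V x) p) = _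
    rw [e3, ← e2.fderiv_eq]
    rfl
  have e4 := ((isMetricOn_metricIn g p).apply_covDeriv_grad hpt
    (contDiffAt_funIn hV hx hpt) u v).2
  have e5 : metricAt g p (covDerivField g (metricGradient g (V x)) p u) v
      = fderiv ℝ (fderiv ℝ (funIn p (V x))) (extChartAt (𝓡 n) p p) u v
        - fderiv ℝ (funIn p (V x)) (extChartAt (𝓡 n) p p)
          (chr (metricIn g p) (extChartAt (𝓡 n) p p) u v) := by
    rw [← e4, ← e1]
    refine (metricAt_eq_metricIn g hp _ _).trans ?_
    exact congrArg₂ (fun a b ↦ metricIn g p (extChartAt (𝓡 n) p p) a b) (toChart_self p _)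
      (toChart_self p _)
  refine e5.trans ?_
  have hov := mem_overlap (n := n) hp hc
  have hφ := contDiffOn_coordTrans (n := n) p c
  have hφy := hφ.contDiffAt ((isOpen_overlap p c).mem_nhds hov)
  have hcd : coordTrans p c (extChartAt (𝓡 n) p p) = extChartAt (𝓡 n) c p := coordTrans_apply hp
  have hf := contDiffAt_funIn hV hx (mem_target_of_mem_source (n := n) hc)
  have h1 : funIn p (V x) =ᶠ[𝓝 (extChartAt (𝓡 n) p p)] funIn c (V x) ∘ coordTrans p c := by
    filter_upwards [(isOpen_overlap p c).mem_nhds hov] with y hy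
    obtain ⟨q, hq, hq', rfl⟩ := exists_of_mem_overlap hy
    simp only [Function.comp_apply, symm_extChartAt hq, symm_extChartAt hq']
  rw [← hcd] at hf
  have h2 := snd_fderiv_of_eventuallyEq_comp hφy hf h1 u v
  have h3 := fderiv_of_eventuallyEq_comp hφy hf h1 (christoffel g p (extChartAt (𝓡 n) p p) u v)
  rw [hcd, fderiv_coordTrans hp hc] at h2 h3
  rw [christoffel_trans g hp hc u v, map_add] at h3
  rw [h2, ← christoffel_eq, h3]
  ring

end CurveCalculus

/-! ### Vector fields along a curve and the local form of the Hessian density -/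

section FieldCalculus

variable {n ν : ℕ} {M : Type*} [TopologicalSpace M] [ChartedSpace (Eucl n) M]
  [IsManifold (𝓡 n) ∞ M]

/-- The coordinate expression of the velocity of a curve on `[0, 1]`. -/
abbrev velIn (c : M) (γ : ℝ → M) (t : ℝ) : Eucl n := fieldIn γ (velocity γ) c t

/-- The parameters in `[0, 1]` at which the curve is in the domain of the chart at `c`. -/
def chartDom (n : ℕ) {M : Type*} [TopologicalSpace M] [ChartedSpace (Eucl n) M]
    (c : M) (γ : ℝ → M) : Set ℝ :=
  Icc 0 1 ∩ γ ⁻¹' (chartAt (Eucl n) c).source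

variable {γ : ℝ → M}

lemma uniqueDiffWithinAt_unitInterval {t : ℝ} (ht : t ∈ Icc (0 : ℝ) 1) :
    UniqueDiffWithinAt ℝ (Icc (0 : ℝ) 1) t := uniqueDiffOn_Icc zero_lt_one t ht

lemma chartDom_mem_nhdsWithin (hγ : ContinuousOn γ (Icc 0 1)) {c : M} {t : ℝ}
    (ht : t ∈ chartDom n c γ) : chartDom n c γ ∈ 𝓝[Icc 0 1] t :=
  inter_mem self_mem_nhdsWithin ((hγ t ht.1).preimage_mem_nhdsWithin
    ((chartAt (Eucl n) c).open_source.mem_nhds ht.2))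

lemma uniqueDiffOn_chartDom (hγ : ContinuousOn γ (Icc 0 1)) (c : M) :
    UniqueDiffOn ℝ (chartDom n c γ) := fun _ ht ↦
  (uniqueDiffWithinAt_unitInterval ht.1).mono_nhds
    (nhdsWithin_le_iff.2 (chartDom_mem_nhdsWithin hγ ht))

lemma contDiffOn_curveIn (hγ : ContMDiffOn 𝓘(ℝ, ℝ) (𝓡 n) ∞ γ (Icc 0 1)) (c : M) :
    ContDiffOn ℝ ∞ (curveIn (n := n) c γ) (chartDom n c γ) :=
  contMDiffOn_iff_contDiffOn.1 ((contMDiffOn_extChartAt (I := 𝓡 n) (n := ∞) (x := c)).comp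
    (hγ.mono inter_subset_left) fun _ ht ↦ ht.2)

lemma hasDerivWithinAt_curveIn_velIn (hγ : ContMDiffOn 𝓘(ℝ, ℝ) (𝓡 n) ∞ γ (Icc 0 1)) {c : M} {t : ℝ}
    (ht : t ∈ chartDom n c γ) :
    HasDerivWithinAt (curveIn c γ) (velIn (n := n) c γ t) (Icc 0 1) t :=
  hasDerivWithinAt_curveIn ((hγ t ht.1).mdifferentiableWithinAt (by simp)) ht.2

lemma contDiffOn_velIn (hγ : ContMDiffOn 𝓘(ℝ, ℝ) (𝓡 n) ∞ γ (Icc 0 1)) (c : M) :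
    ContDiffOn ℝ ∞ (velIn (n := n) c γ) (chartDom n c γ) := by
  have hu := uniqueDiffOn_chartDom (n := n) hγ.continuousOn c
  refine ((contDiffOn_curveIn hγ c).derivWithin (m := ∞) hu (by simp)).congr fun t ht ↦ ?_
  exact (((hasDerivWithinAt_curveIn_velIn hγ ht).mono inter_subset_left).derivWithin (hu t ht)).symm

lemma fieldIn_trans (ξ : FieldAlong (n := n) γ) {c d : M} {t : ℝ}
    (hc : γ t ∈ (chartAt (Eucl n) c).source) (hd : γ t ∈ (chartAt (Eucl n) d).source) :
    tangentCoordChange (𝓡 n) c d (γ t) (fieldIn γ ξ c t) = fieldIn γ ξ d t :=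
  tcc_comp (mem_source_self _) hc hd _

/-- The matrix of the change of charts, along a curve. -/
lemma contDiffOn_tcc (hγ : ContMDiffOn 𝓘(ℝ, ℝ) (𝓡 n) ∞ γ (Icc 0 1)) (c d : M) :
    ContDiffOn ℝ ∞ (fun t ↦ tangentCoordChange (𝓡 n) c d (γ t))
      (chartDom n c γ ∩ chartDom n d γ) := by
  have h1 : ContDiffOn ℝ ∞ (fderiv ℝ (coordTrans (n := n) c d)) (overlap c d) :=
    (contDiffOn_coordTrans c d).fderiv_of_isOpen (isOpen_overlap c d) (by simp)
  refine (h1.comp ((contDiffOn_curveIn hγ c).mono inter_subset_left)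
    fun t ht ↦ mem_overlap ht.1.2 ht.2.2).congr fun t ht ↦ ?_
  exact (fderiv_coordTrans ht.1.2 ht.2.2).symm

/-- Product rule for the Jacobian of the change of charts along `γ` applied to the field. The second
order term is the one by which the Christoffel symbols fail to be a tensor. -/
lemma hasDerivWithinAt_fieldIn_trans (hγ : ContMDiffOn 𝓘(ℝ, ℝ) (𝓡 n) ∞ γ (Icc 0 1))
    {ξ : FieldAlong (n := n) γ} {c d : M} {t : ℝ} (hc : t ∈ chartDom n c γ)
    (hd : t ∈ chartDom n d γ) {v : Eucl n}
    (hv : HasDerivWithinAt (fieldIn γ ξ c) v (Icc 0 1) t) :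
    HasDerivWithinAt (fieldIn γ ξ d)
      (fderiv ℝ (fderiv ℝ (coordTrans c d)) (curveIn c γ t) (velIn c γ t) (fieldIn γ ξ c t)
        + tangentCoordChange (𝓡 n) c d (γ t) v) (Icc 0 1) t := by
  have h1 : ContDiffAt ℝ ∞ (fderiv ℝ (coordTrans (n := n) c d)) (curveIn c γ t) :=
    ((contDiffOn_coordTrans c d).contDiffAt ((isOpen_overlap c d).mem_nhds
      (mem_overlap hc.2 hd.2))).fderiv_right (by simp)
  have h2 := (h1.differentiableAt (by simp)).hasFDerivAt.comp_hasDerivWithinAt t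
    (hasDerivWithinAt_curveIn_velIn hγ hc)
  have h3 := h2.clm_apply hv
  have key : ∀ s ∈ chartDom n c γ ∩ chartDom n d γ, fieldIn γ ξ d s
      = (fderiv ℝ (coordTrans c d) ∘ curveIn c γ) s (fieldIn γ ξ c s) := fun s hs ↦ by
    rw [← fieldIn_trans ξ hs.1.2 hs.2.2, Function.comp_apply, fderiv_coordTrans hs.1.2 hs.2.2]
  refine (h3.congr_of_eventuallyEq ?_ (key t ⟨hc, hd⟩)).congr_deriv ?_
  · filter_upwards [chartDom_mem_nhdsWithin hγ.continuousOn hc,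
      chartDom_mem_nhdsWithin hγ.continuousOn hd] with s h4 h5 using key s ⟨h4, h5⟩
  · rw [Function.comp_apply, fderiv_coordTrans hc.2 hd.2]

variable (g : SemiRiemannianMetric n ν M)

/-- The covariant derivative along a curve in an arbitrary chart. -/
lemma fieldIn_covDeriv (hγ : ContMDiffOn 𝓘(ℝ, ℝ) (𝓡 n) ∞ γ (Icc 0 1))
    {ξ : FieldAlong (n := n) γ} {c : M} {t : ℝ} (hc : t ∈ chartDom n c γ) {v : Eucl n}
    (hv : HasDerivWithinAt (fieldIn γ ξ c) v (Icc 0 1) t) :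
    fieldIn γ (covDeriv g γ ξ) c t
      = v + chr (metricIn g c) (curveIn c γ t) (velIn c γ t) (fieldIn γ ξ c t) := by
  have hd : t ∈ chartDom n (γ t) γ := ⟨hc.1, mem_source_self _⟩
  have h1 := (hasDerivWithinAt_fieldIn_trans hγ hc hd hv).derivWithin
    (uniqueDiffWithinAt_unitInterval hc.1)
  -- The value at `t` is defined in the chart at `γ t`. The second derivative of the change of
  -- charts in `h1` is exactly the inhomogeneous term of `christoffel_trans`, so the covariant
  -- derivative transforms as a vector.
  have h2 : (covDeriv g γ ξ t : Eucl n) = tangentCoordChange (𝓡 n) c (γ t) (γ t)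
      (v + chr (metricIn g c) (curveIn c γ t) (velIn c γ t) (fieldIn γ ξ c t)) := by
    have h3 := christoffel_trans g hc.2 hd.2 (velIn c γ t) (fieldIn γ ξ c t)
    have h4 : ∀ ζ : FieldAlong (n := n) γ, tangentCoordChange (𝓡 n) c (γ t) (γ t) (fieldIn γ ζ c t)
        = ζ t := fun ζ ↦ ofChart_toChart hc.2 _
    rw [map_add, ← christoffel_eq, h3]
    have h5 : (covDeriv g γ ξ t : Eucl n) = derivWithin (fieldIn γ ξ (γ t)) (Icc 0 1) t + christoffel g (γ t) (curveIn (γ t) γ t)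
          (tangentCoordChange (𝓡 n) c (γ t) (γ t) (velIn c γ t))
          (tangentCoordChange (𝓡 n) c (γ t) (γ t) (fieldIn γ ξ c t)) :=
          congrArg₂ (fun a b : Eucl n ↦ derivWithin (fieldIn γ ξ (γ t)) (Icc 0 1) t
            + christoffel g (γ t) (curveIn (γ t) γ t) a b) (h4 _).symm (h4 _).symm
    refine Eq.trans h5 ?_
    rw [h1]
    abel
  exact (congrArg (toChart c (γ t)) h2).trans (toChart_ofChart hc.2 _)

lemma fieldIn_inj {ξ η : FieldAlong (n := n) γ} {c : M} {t : ℝ}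
    (hc : γ t ∈ (chartAt (Eucl n) c).source) (h : fieldIn γ ξ c t = fieldIn γ η c t) :
    ξ t = η t := by
  have h1 := congrArg (ofChart c (γ t)) h
  exact (ofChart_toChart hc _).symm.trans (h1.trans (ofChart_toChart hc _))

variable {g} {V : ℝ → M → ℝ}

/-- The second order part of the integrand of the index form, in coordinates. -/
abbrev tidalIn (g : SemiRiemannianMetric n ν M) (V : ℝ → M → ℝ) (γ : ℝ → M) (c : M) (t : ℝ) :
    Eucl n →L[ℝ] Eucl n →L[ℝ] ℝ :=
  tidalForm (metricIn g c) (funIn c (V t)) (curveIn c γ t) (velIn c γ t)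

lemma curveIn_mem_target {c : M} {t : ℝ} (hc : t ∈ chartDom n c γ) :
    curveIn (n := n) c γ t ∈ (extChartAt (𝓡 n) c).target := mem_target_of_mem_source hc.2

lemma metricIn_jacobiPotential (hV : IsSmoothPotential n V) (ξ : FieldAlong (n := n) γ) {c : M}
    {t : ℝ} (hc : t ∈ chartDom n c γ) (w : Eucl n) :
    metricIn g c (curveIn c γ t) (fieldIn γ (jacobiPotential g V γ ξ) c t) w
      = tidalIn g V γ c t (fieldIn γ ξ c t) w := by
  have h1 := metricAt_curvature g hc.2 (velocity γ t) (ξ t) (velocity γ t) (ofChart c (γ t) w)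
  have h2 := metricAt_covDerivField g hV hc.1 hc.2 (ξ t) (ofChart c (γ t) w)
  rw [toChart_ofChart hc.2] at h1 h2
  rw [(isMetricOn_metricIn g c).tidalForm_apply (curveIn_mem_target hc)]
  have h3 : ∀ a b : Eucl n, metricIn g c (curveIn c γ t) (toChart c (γ t) (a + b)) w
      = metricAt g (γ t) a (ofChart c (γ t) w) + metricAt g (γ t) b (ofChart c (γ t) w) := by
    intro a b
    rw [← add_apply, ← map_add, metricAt_eq_metricIn g hc.2, toChart_ofChart hc.2]
  exact (h3 _ _).trans (congrArg₂ (· + ·) h1 h2)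

/-- The bridge from the intrinsic density to the form studied analytically. Only differentiability
at the single point `t` is required, so it applies almost everywhere to `H¹` fields. -/
lemma hessianDensity_eq (hγ : ContMDiffOn 𝓘(ℝ, ℝ) (𝓡 n) ∞ γ (Icc 0 1))
    (hV : IsSmoothPotential n V) {ξ η : FieldAlong (n := n) γ} {c : M}
    {t : ℝ} (hc : t ∈ chartDom n c γ) {v w : Eucl n}
    (hv : HasDerivWithinAt (fieldIn γ ξ c) v (Icc 0 1) t)
    (hw : HasDerivWithinAt (fieldIn γ η c) w (Icc 0 1) t) :
    hessianDensity g V γ ξ η t = metricIn g c (curveIn c γ t)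
        (v + chr (metricIn g c) (curveIn c γ t) (velIn c γ t) (fieldIn γ ξ c t))
        (w + chr (metricIn g c) (curveIn c γ t) (velIn c γ t) (fieldIn γ η c t))
      - tidalIn g V γ c t (fieldIn γ ξ c t) (fieldIn γ η c t) := by
  rw [← fieldIn_covDeriv g hγ hc hv, ← fieldIn_covDeriv g hγ hc hw,
    ← metricIn_jacobiPotential hV ξ hc]
  exact congrArg₂ (· - ·) (metricAt_eq_metricIn g hc.2 _ _) (metricAt_eq_metricIn g hc.2 _ _)

lemma tidalIn_symm (hV : IsSmoothPotential n V) {c : M} {t : ℝ} (hc : t ∈ chartDom n c γ)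
    (u v : Eucl n) : tidalIn g V γ c t u v = tidalIn g V γ c t v u :=
  (isMetricOn_metricIn g c).tidalForm_symm (curveIn_mem_target hc)
    (contDiffAt_funIn hV hc.1 (curveIn_mem_target hc)) _ u v

lemma contDiffOn_tidalIn (hγ : ContMDiffOn 𝓘(ℝ, ℝ) (𝓡 n) ∞ γ (Icc 0 1))
    (hV : IsSmoothPotential n V) (c : M) :
    ContDiffOn ℝ ∞ (tidalIn g V γ c) (chartDom n c γ) :=
  (isMetricOn_metricIn g c).contDiffOn_tidalForm (f := fun t ↦ funIn c (V t))
    (uniqueDiffOn_Icc zero_lt_one)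
    (contDiffOn_funIn hV c) inter_subset_left (contDiffOn_curveIn hγ c) (contDiffOn_velIn hγ c)
    fun _ ht ↦ curveIn_mem_target ht

/-- The connection form along a curve: `u ↦ Γ (γ', u)`. -/
abbrev connIn (g : SemiRiemannianMetric n ν M) (γ : ℝ → M) (c : M) (t : ℝ) :
    Eucl n →L[ℝ] Eucl n := chrL (metricIn g c) (curveIn c γ t) (velIn c γ t)

lemma contDiffOn_connIn (hγ : ContMDiffOn 𝓘(ℝ, ℝ) (𝓡 n) ∞ γ (Icc 0 1)) (c : M) :
    ContDiffOn ℝ ∞ (connIn g γ c) (chartDom n c γ) :=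
  ((isMetricOn_metricIn g c).contDiffOn_chrL.comp (contDiffOn_curveIn hγ c)
    fun _ ht ↦ curveIn_mem_target ht).clm_apply (contDiffOn_velIn hγ c)

lemma contDiffOn_metricIn_curveIn (hγ : ContMDiffOn 𝓘(ℝ, ℝ) (𝓡 n) ∞ γ (Icc 0 1)) (c : M) :
    ContDiffOn ℝ ∞ (fun t ↦ metricIn g c (curveIn c γ t)) (chartDom n c γ) :=
  (contDiffOn_metricIn g c).comp (contDiffOn_curveIn hγ c) fun _ ht ↦ curveIn_mem_target ht

/-- Smooth fields, in coordinates. -/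
lemma contMDiffOn_field_iff (hγ : ContMDiffOn 𝓘(ℝ, ℝ) (𝓡 n) ∞ γ (Icc 0 1))
    {ξ : FieldAlong (n := n) γ} :
    ContMDiffOn 𝓘(ℝ, ℝ) (𝓡 n).tangent ∞
      (fun x ↦ (⟨γ x, ξ x⟩ : TangentBundle (𝓡 n) M)) (Icc 0 1) ↔
    ∀ c : M, ∀ t ∈ chartDom n c γ, ContDiffWithinAt ℝ ∞ (fieldIn γ ξ c) (Icc 0 1) t := by
  have key : ∀ c : M, ∀ t ∈ chartDom n c γ,
      (ContMDiffWithinAt 𝓘(ℝ, ℝ) (𝓡 n).tangent ∞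
        (fun x ↦ (⟨γ x, ξ x⟩ : TangentBundle (𝓡 n) M)) (Icc 0 1) t ↔
      ContDiffWithinAt ℝ ∞ (fieldIn γ ξ c) (Icc 0 1) t) := fun c t ht ↦ by
    rw [← contMDiffWithinAt_iff_contDiffWithinAt]
    refine ((trivializationAt (Eucl n) (TangentSpace (𝓡 n) : M → Type _) c).contMDiffWithinAt_iff
      (IB := 𝓡 n) (n := ∞) (f := fun x ↦ (⟨γ x, ξ x⟩ : TangentBundle (𝓡 n) M)) ?_).trans ?_
    · exact ht.2
    · exact and_iff_right (hγ t ht.1)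
  exact ⟨fun h c t ht ↦ (key c t ht).1 (h t ht.1),
    fun h t ht ↦ (key (γ t) t ⟨ht, mem_source_self _⟩).2 (h _ t ⟨ht, mem_source_self _⟩)⟩

end FieldCalculus

/-! ### `H¹` functions on an interval and integration by parts -/

section SobolevFunctions

variable {n : ℕ} {a b c : ℝ}

lemma IsH1On.congr {u w : ℝ → Eucl n} (hu : IsH1On a b u) (hab : a ≤ b) (h : EqOn w u (Icc a b)) :
    IsH1On a b w := by
  obtain ⟨v, hv, hv'⟩ := hu
  exact ⟨v, hv, fun s hs ↦ by rw [h hs, h (left_mem_Icc.2 hab), hv' s hs]⟩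

lemma IsH1On.mono {u : ℝ → Eucl n} (hu : IsH1On a b u) {a' b' : ℝ} (ha : a ≤ a') (hab : a' ≤ b')
    (hb : b' ≤ b) : IsH1On a' b' u := by
  obtain ⟨v, hv, hv'⟩ := hu
  refine ⟨v, hv.mono_measure (Measure.restrict_mono (Icc_subset_Icc ha hb) le_rfl), fun s hs ↦ ?_⟩
  have hs' : s ∈ Icc a b := ⟨ha.trans hs.1, hs.2.trans hb⟩
  have ha' : a' ∈ Icc a b := ⟨ha, hab.trans hb⟩
  rw [hv' s hs', hv' a' ha', add_assoc]
  congr 1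
  refine (intervalIntegral.integral_add_adjacent_intervals (memLp_intervalIntegrable hv ha') ?_).symm
  exact (memLp_intervalIntegrable hv ha').symm.trans (memLp_intervalIntegrable hv hs')

lemma IsH1On.trans {u : ℝ → Eucl n} (hu : IsH1On a b u) (hw : IsH1On b c u) (hab : a ≤ b)
    (hbc : b ≤ c) : IsH1On a c u := by
  classical
  obtain ⟨v, hv, hv'⟩ := hu
  obtain ⟨w, hw, hw'⟩ := hw
  have h1 : MemLp ((Icc a b).indicator v) 2 (volume.restrict (Icc a c)) := by
    rw [memLp_indicator_iff_restrict measurableSet_Icc]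
    exact hv.mono_measure (by
      rw [Measure.restrict_restrict measurableSet_Icc]
      exact Measure.restrict_mono inter_subset_left le_rfl)
  have h2 : MemLp ((Ioc b c).indicator w) 2 (volume.restrict (Icc a c)) := by
    rw [memLp_indicator_iff_restrict measurableSet_Ioc]
    exact hw.mono_measure (by
      rw [Measure.restrict_restrict measurableSet_Ioc]
      exact Measure.restrict_mono (inter_subset_left.trans Ioc_subset_Icc_self) le_rfl)
  -- The two sets are disjoint and cover `[a, c]`, so `z` is `v` up to `b` and `w` after it.
  set z := fun s ↦ (Icc a b).indicator v s + (Ioc b c).indicator w s with hz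
  have hzm : MemLp z 2 (volume.restrict (Icc a c)) := h1.add h2
  have e1 : ∀ s ∈ Icc a b, ∫ r in a..s, z r = ∫ r in a..s, v r := by
    intro s hs
    refine intervalIntegral.integral_congr fun r hr ↦ ?_
    rw [uIcc_of_le hs.1] at hr
    have hr' : r ∈ Icc a b := ⟨hr.1, hr.2.trans hs.2⟩
    simp only [hz]
    rw [indicator_of_mem hr', indicator_of_notMem (fun h : r ∈ Ioc b c ↦ absurd h.1 (not_lt.2 hr'.2)),
      add_zero]
  refine ⟨z, hzm, fun s hs ↦ ?_⟩
  rcases le_total s b with hsb | hsb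
  · rw [e1 s ⟨hs.1, hsb⟩, hv' s ⟨hs.1, hsb⟩]
  · rw [hw' s ⟨hsb, hs.2⟩, hv' b ⟨hab, le_rfl⟩, ← e1 b ⟨hab, le_rfl⟩, add_assoc]
    congr 1
    have e2 : ∫ r in b..s, w r = ∫ r in b..s, z r := by
      refine intervalIntegral.integral_congr_ae (Eventually.of_forall fun r hr ↦ ?_)
      rw [uIoc_of_le hsb] at hr
      have hr' : r ∈ Ioc b c := ⟨hr.1, hr.2.trans hs.2⟩
      simp only [hz]
      rw [indicator_of_mem hr',
        indicator_of_notMem (fun h : r ∈ Icc a b ↦ absurd hr.1 (not_lt.2 h.2)), zero_add]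
    rw [e2]
    have hb : b ∈ Icc a c := ⟨hab, hbc⟩
    exact intervalIntegral.integral_add_adjacent_intervals (memLp_intervalIntegrable hzm hb)
      ((memLp_intervalIntegrable hzm hb).symm.trans (memLp_intervalIntegrable hzm hs))

lemma eucl_integral_apply {f : ℝ → Eucl n} (hf : IntervalIntegrable f volume a b) (i : Fin n) :
    (∫ x in a..b, f x) i = ∫ x in a..b, f x i :=
  ((EuclideanSpace.proj (𝕜 := ℝ) i).intervalIntegral_comp_comm hf).symm

/-- By Lebesgue differentiation the classical derivative exists almost everywhere and represents the
weak one; the default value `0` of `deriv` is taken at most on a null set. From here on `deriv u`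
replaces a chosen integrand. -/
lemma IsH1On.memLp_deriv {u : ℝ → Eucl n} (hab : a ≤ b) (hu : IsH1On a b u) :
    MemLp (deriv u) 2 (volume.restrict (Icc a b)) := by
  obtain ⟨v, hv, hv'⟩ := hu.deriv_spec hab
  rw [← restrict_Ioc_eq_restrict_Icc]
  exact hv.ae_eq (hv'.mono fun x hx ↦ hx.deriv.symm)

lemma IsH1On.ae_hasDerivAt {u : ℝ → Eucl n} (hab : a ≤ b) (hu : IsH1On a b u) :
    ∀ᵐ x ∂volume.restrict (Icc a b), HasDerivAt u (deriv u x) x := by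
  obtain ⟨v, hv, hv'⟩ := hu.deriv_spec hab
  rw [← restrict_Ioc_eq_restrict_Icc]
  exact hv'.mono fun x hx ↦ hx.differentiableAt.hasDerivAt

lemma IsH1On.eq_add_integral_deriv {u : ℝ → Eucl n} (hab : a ≤ b) (hu : IsH1On a b u) {s : ℝ}
    (hs : s ∈ Icc a b) : u s = u a + ∫ r in a..s, deriv u r := by
  obtain ⟨v, hv, hv'⟩ := hu
  rw [hv' s hs]
  congr 1
  have hi := memLp_intervalIntegrable hv (right_mem_Icc.2 hab)
  refine intervalIntegral.integral_congr_ae ?_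
  -- The point `b` is discarded because `Icc a b` is not a neighbourhood of it.
  have hne : ∀ᵐ x : ℝ, x ≠ b := by simp [ae_iff, measure_singleton]
  filter_upwards [hi.ae_hasDerivAt_integral, hne] with x hx hxb hxm
  rw [uIoc_of_le hs.1] at hxm
  have hxI : x ∈ Icc a b := ⟨hxm.1.le, hxm.2.trans hs.2⟩
  have hx' := hx (by rwa [uIcc_of_le hab]) a left_mem_uIcc
  refine ((hx'.const_add (u a)).congr_of_eventuallyEq ?_).deriv.symm
  filter_upwards [Icc_mem_nhds hxm.1 (lt_of_le_of_ne hxI.2 hxb)] with s hs using hv' s hs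

lemma IsH1On.deriv_ae_eq {u v : ℝ → Eucl n} (hv : MemLp v 2 (volume.restrict (Icc a b)))
    (hab : a ≤ b) (hu : ∀ s ∈ Icc a b, u s = u a + ∫ r in a..s, v r) :
    ∀ᵐ x ∂volume.restrict (Icc a b), HasDerivAt u (v x) x := by
  have hi := memLp_intervalIntegrable hv (right_mem_Icc.2 hab)
  rw [← restrict_Ioo_eq_restrict_Icc, ae_restrict_iff' measurableSet_Ioo]
  filter_upwards [hi.ae_hasDerivAt_integral] with x hx hxm
  have hx' := hx (by rw [uIcc_of_le hab]; exact Ioo_subset_Icc_self hxm) a left_mem_uIcc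
  refine (hx'.const_add (u a)).congr_of_eventuallyEq ?_
  filter_upwards [Icc_mem_nhds hxm.1 hxm.2] with s hs using hu s hs

lemma memLp_clm_apply {E F : Type*} [NormedAddCommGroup E] [NormedSpace ℝ E]
    [NormedAddCommGroup F] [NormedSpace ℝ F] {T : ℝ → E →L[ℝ] F} {f : ℝ → E}
    [SecondCountableTopologyEither ℝ (E →L[ℝ] F)]
    (hT : ContinuousOn T (Icc a b)) (hf : MemLp f 2 (volume.restrict (Icc a b))) :
    MemLp (fun x ↦ T x (f x)) 2 (volume.restrict (Icc a b)) := by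
  obtain ⟨C, hC⟩ := isCompact_Icc.exists_bound_of_continuousOn hT
  refine MemLp.of_le_mul (c := C) hf ?_ ?_
  · exact (isBoundedBilinearMap_apply (𝕜 := ℝ) (E := E) (F := F)).continuous.comp_aestronglyMeasurable
      ((hT.aestronglyMeasurable measurableSet_Icc).prodMk hf.1)
  · filter_upwards [ae_restrict_mem measurableSet_Icc] with x hx
    exact (T x).le_of_opNorm_le (hC x hx) _

lemma ContinuousOn.memLp_Icc {E : Type*} [NormedAddCommGroup E] {f : ℝ → E}
    (hf : ContinuousOn f (Icc a b)) : MemLp f 2 (volume.restrict (Icc a b)) := by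
  obtain ⟨C, hC⟩ := isCompact_Icc.exists_bound_of_continuousOn hf
  refine MemLp.of_bound (hf.aestronglyMeasurable measurableSet_Icc) C ?_
  filter_upwards [ae_restrict_mem measurableSet_Icc] with x hx using hC x hx

lemma isH1On_of_hasDerivWithinAt {u v : ℝ → Eucl n}
    (hu : ∀ x ∈ Icc a b, HasDerivWithinAt u (v x) (Icc a b) x) (hv : ContinuousOn v (Icc a b)) :
    IsH1On a b u := by
  refine ⟨v, ContinuousOn.memLp_Icc hv, fun s hs ↦ ?_⟩
  have hsub : Icc a s ⊆ Icc a b := Icc_subset_Icc_right hs.2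
  rw [intervalIntegral.integral_eq_sub_of_hasDerivAt_of_le hs.1
    (fun x hx ↦ ((hu x (hsub hx)).continuousWithinAt.mono hsub)) (fun x hx ↦
      (hu x (hsub (Ioo_subset_Icc_self hx))).hasDerivAt
        (Icc_mem_nhds hx.1 (hx.2.trans_le hs.2)))
    ((hv.mono hsub).intervalIntegrable_of_Icc hs.1)]
  abel

lemma absolutelyContinuousOnInterval_congr {f g : ℝ → ℝ}
    (hf : AbsolutelyContinuousOnInterval f a b) (h : EqOn f g (uIcc a b)) :
    AbsolutelyContinuousOnInterval g a b := by
  refine Tendsto.congr' ?_ hf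
  refine Eventually.filter_mono inf_le_right (eventually_principal.2 fun E hE ↦ ?_)
  refine Finset.sum_congr rfl fun i hi ↦ ?_
  rw [h (hE.1 i hi).1, h (hE.1 i hi).2]

/-- Integration by parts is reduced, component by component, to that for absolutely continuous real
functions. -/
lemma IsH1On.absolutelyContinuous {u : ℝ → Eucl n} (hab : a ≤ b) (hu : IsH1On a b u) (i : Fin n) :
    AbsolutelyContinuousOnInterval (fun s ↦ u s i) a b := by
  have hm := hu.memLp_deriv hab
  have hi := memLp_intervalIntegrable hm (right_mem_Icc.2 hab)
  have hii : IntervalIntegrable (fun x ↦ deriv u x i) volume a b :=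
    ⟨(EuclideanSpace.proj (𝕜 := ℝ) i).integrable_comp hi.1,
      (EuclideanSpace.proj (𝕜 := ℝ) i).integrable_comp hi.2⟩
  have h1 := hii.absolutelyContinuousOnInterval_intervalIntegral (c := a) left_mem_uIcc
  have h2 : AbsolutelyContinuousOnInterval (fun _ : ℝ ↦ u a i) a b :=
    (contDiffOn_const (c := u a i)).absolutelyContinuousOnInterval
  refine absolutelyContinuousOnInterval_congr (h2.add h1) fun s hs ↦ ?_
  rw [uIcc_of_le hab] at hs
  have h := congrArg (fun z : Eucl n ↦ z i) (hu.eq_add_integral_deriv hab hs)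
  refine Eq.trans ?_ h.symm
  simp only [Pi.add_apply, PiLp.add_apply]
  rw [eucl_integral_apply (memLp_intervalIntegrable hm hs)]

lemma MemLp.integrable_inner_Icc {f g : ℝ → Eucl n} (hf : MemLp f 2 (volume.restrict (Icc a b)))
    (hg : MemLp g 2 (volume.restrict (Icc a b))) (hab : a ≤ b) :
    IntervalIntegrable (fun x ↦ ⟪f x, g x⟫_ℝ) volume a b := by
  rw [intervalIntegrable_iff_integrableOn_Icc_of_le hab]
  refine memLp_one_iff_integrable.1 ?_
  refine MemLp.of_bilin (p := 2) (q := 2) (fun x y ↦ ⟪x, y⟫_ℝ) 1 hf hg (hf.1.inner hg.1) ?_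
  filter_upwards with x
  rw [one_mul]
  exact nnnorm_inner_le_nnnorm _ _

lemma IsH1On.memLp {u : ℝ → Eucl n} (hab : a ≤ b) (hu : IsH1On a b u) :
    MemLp u 2 (volume.restrict (Icc a b)) :=
  ContinuousOn.memLp_Icc (hu.continuousOn hab)

/-- Integration by parts for `H¹` functions. -/
lemma IsH1On.integral_inner_deriv {u w : ℝ → Eucl n} (hab : a ≤ b) (hu : IsH1On a b u)
    (hw : IsH1On a b w) :
    ∫ x in a..b, (⟪deriv u x, w x⟫_ℝ + ⟪u x, deriv w x⟫_ℝ) = ⟪u b, w b⟫_ℝ - ⟪u a, w a⟫_ℝ := by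
  have key : ∀ i, ∫ x in a..b, (deriv (fun s ↦ u s i) x * w x i + u x i * deriv (fun s ↦ w s i) x)
      = u b i * w b i - u a i * w a i := fun i ↦
    (hu.absolutelyContinuous hab i).integral_deriv_mul_eq_sub (hw.absolutelyContinuous hab i)
  have hint : ∀ i, IntervalIntegrable
      (fun x ↦ deriv (fun s ↦ u s i) x * w x i + u x i * deriv (fun s ↦ w s i) x) volume a b :=
    fun i ↦ ((hu.absolutelyContinuous hab i).intervalIntegrable_deriv.mul_continuousOn
      (hw.absolutelyContinuous hab i).continuousOn).add
      ((hw.absolutelyContinuous hab i).intervalIntegrable_deriv.continuousOn_mul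
        (hu.absolutelyContinuous hab i).continuousOn)
  have e : ∀ x y : Eucl n, ⟪x, y⟫_ℝ = ∑ i, x i * y i := fun x y ↦ by
    simp [PiLp.inner_apply, mul_comm]
  rw [e, e, ← Finset.sum_sub_distrib, ← Finset.sum_congr rfl fun i _ ↦ key i,
    ← intervalIntegral.integral_finsetSum fun i _ ↦ hint i]
  refine intervalIntegral.integral_congr_ae_restrict ?_
  rw [uIoc_of_le hab, restrict_Ioc_eq_restrict_Icc]
  filter_upwards [hu.ae_hasDerivAt hab, hw.ae_hasDerivAt hab] with x h1 h2
  have h3 : ∀ {u : ℝ → Eucl n} {v} (i : Fin n), HasDerivAt u v x → deriv (fun s ↦ u s i) x = v i :=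
    fun i h ↦ ((EuclideanSpace.proj (𝕜 := ℝ) i).hasFDerivAt.comp_hasDerivAt x h).deriv
  rw [e, e, ← Finset.sum_add_distrib]
  exact Finset.sum_congr rfl fun i _ ↦ by rw [h3 i h1, h3 i h2]

lemma IsH1On.integral_inner_deriv_left {u w : ℝ → Eucl n} (hab : a ≤ b) (hu : IsH1On a b u)
    (hw : IsH1On a b w) :
    ∫ x in a..b, ⟪u x, deriv w x⟫_ℝ
      = ⟪u b, w b⟫_ℝ - ⟪u a, w a⟫_ℝ - ∫ x in a..b, ⟪deriv u x, w x⟫_ℝ := by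
  rw [← hu.integral_inner_deriv hab hw, intervalIntegral.integral_add
    (MemLp.integrable_inner_Icc (hu.memLp_deriv hab) (hw.memLp hab) hab)
    (MemLp.integrable_inner_Icc (hu.memLp hab) (hw.memLp_deriv hab) hab)]
  ring

/-- The product of a continuously differentiable matrix function and an `H¹` function. -/
lemma IsH1On.clm_apply {T T' : ℝ → Eucl n →L[ℝ] Eucl n} {u : ℝ → Eucl n} (hab : a ≤ b)
    (hT : ∀ x ∈ Icc a b, HasDerivWithinAt T (T' x) (Icc a b) x) (hT' : ContinuousOn T' (Icc a b))
    (hu : IsH1On a b u) : IsH1On a b (fun s ↦ T s (u s)) := by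
  have hTc : ContinuousOn T (Icc a b) := fun x hx ↦ (hT x hx).continuousWithinAt
  have hv : MemLp (fun x ↦ T' x (u x) + T x (deriv u x)) 2 (volume.restrict (Icc a b)) :=
    (memLp_clm_apply hT' (hu.memLp hab)).add (memLp_clm_apply hTc (hu.memLp_deriv hab))
  refine ⟨_, hv, fun s hs ↦ ?_⟩
  have hint := memLp_intervalIntegrable hv hs
  refine ext_inner_left ℝ fun e ↦ ?_
  have hsub : Icc a s ⊆ Icc a b := Icc_subset_Icc_right hs.2
  -- `A B` is the adjoint of `B` applied to `e`. Since `⟪e, T u⟫ = ⟪A T, u⟫`, the product rule for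
  -- `T u` follows from integration by parts for the pair `A T`, `u`.
  let A : (Eucl n →L[ℝ] Eucl n) →L[ℝ] Eucl n :=
    (ContinuousLinearMap.apply ℝ (Eucl n) e).comp
      (ContinuousLinearMap.adjoint (𝕜 := ℝ) (E := Eucl n) (F := Eucl n)).toContinuousLinearEquiv.toContinuousLinearMap
  have hA : ∀ (B : Eucl n →L[ℝ] Eucl n) y, ⟪A B, y⟫_ℝ = ⟪e, B y⟫_ℝ := fun B y ↦
    ContinuousLinearMap.adjoint_inner_left B y e
  have hd : ∀ x ∈ Icc a s, HasDerivWithinAt (fun x ↦ A (T x)) (A (T' x)) (Icc a s) x := fun x hx ↦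
    (A.hasFDerivAt.comp_hasDerivWithinAt x ((hT x (hsub hx)).mono hsub))
  have hAT : IsH1On a s (fun x ↦ A (T x)) :=
    isH1On_of_hasDerivWithinAt hd (A.continuous.comp_continuousOn (hT'.mono hsub))
  have hp := hAT.integral_inner_deriv hs.1 (hu.mono le_rfl hs.1 hs.2)
  rw [inner_add_right, ← hA, ← hA, ← sub_eq_iff_eq_add', ← hp]
  rw [← innerSL_apply_apply ℝ e, ← ContinuousLinearMap.intervalIntegral_comp_comm _ hint]
  refine intervalIntegral.integral_congr_ae_restrict ?_
  rw [uIoc_of_le hs.1, restrict_Ioc_eq_restrict_Icc, ← restrict_Ioo_eq_restrict_Icc]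
  filter_upwards [ae_restrict_mem measurableSet_Ioo] with x hx
  have := ((hd x (Ioo_subset_Icc_self hx)).hasDerivAt (Icc_mem_nhds hx.1 hx.2)).deriv
  rw [this, hA, hA, innerSL_apply_apply, inner_add_right]

end SobolevFunctions

/-! ### Symmetric forms bounded below on a subspace of finite codimension -/

section Fredholm

variable {H : Type*} [NormedAddCommGroup H] [InnerProductSpace ℝ H]

/-- A bounded bilinear form on a Hilbert space that is bounded below on a closed subspace of finite
codimension has closed range. -/
lemma isClosed_range_of_bound {F : Type*} [NormedAddCommGroup F] [NormedSpace ℝ F] [CompleteSpace H]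
    (b : H →L[ℝ] F) (Z : Submodule ℝ H) (hZ : IsClosed (Z : Set H)) [FiniteDimensional ℝ (H ⧸ Z)]
    {c : ℝ} (hc : 0 < c) (h : ∀ z ∈ Z, c * ‖z‖ ≤ ‖b z‖) : IsClosed (range b) := by
  have : CompleteSpace Z := hZ.completeSpace_coe
  have h1 : AntilipschitzWith (Real.toNNReal c⁻¹) (b.comp Z.subtypeL) := by
    refine AddMonoidHomClass.antilipschitz_of_bound _ fun z ↦ ?_
    rw [Real.coe_toNNReal _ (inv_nonneg.2 hc.le), ← div_eq_inv_mul, le_div_iff₀' hc]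
    exact h z z.2
  have h2 := h1.isClosed_range (b.comp Z.subtypeL).uniformContinuous
  -- The range is `b Z + b W`: the first summand is closed by the lower bound, the second is finite
  -- dimensional.
  obtain ⟨W, hW⟩ := Z.exists_isCompl
  have : FiniteDimensional ℝ W := (Submodule.quotientEquivOfIsCompl Z W hW).finiteDimensional
  have h3 := Submodule.isClosed_sup_finiteDimensional (Z.map (b : H →ₗ[ℝ] F))
    (W.map (b : H →ₗ[ℝ] F)) (by
      convert h2 using 1
      ext y
      simp)
  rw [← Submodule.map_sup, hW.sup_eq_top, Submodule.map_top] at h3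
  exact h3

/-- The lower bound forces the kernel to meet `Z` only in `0`, so it embeds into `H ⧸ Z`. -/
lemma finiteDimensional_ker_of_bound {F : Type*} [NormedAddCommGroup F] [NormedSpace ℝ F]
    (b : H →L[ℝ] F) (Z : Submodule ℝ H) [FiniteDimensional ℝ (H ⧸ Z)]
    {c : ℝ} (hc : 0 < c) (h : ∀ z ∈ Z, c * ‖z‖ ≤ ‖b z‖) :
    FiniteDimensional ℝ (LinearMap.ker (b : H →ₗ[ℝ] F)) := by
  refine FiniteDimensional.of_injective (Z.mkQ.comp (LinearMap.ker (b : H →ₗ[ℝ] F)).subtype) ?_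
  rw [injective_iff_map_eq_zero]
  rintro ⟨x, hx⟩ hxz
  have hxZ : x ∈ Z := by simpa using hxz
  have hb : b x = 0 := hx
  have := h x hxZ
  rw [hb, norm_zero] at this
  have hx0 : ‖x‖ = 0 := le_antisymm (by nlinarith [norm_nonneg x]) (norm_nonneg x)
  exact Subtype.ext (norm_eq_zero.1 hx0)

variable [CompleteSpace H]

/-- The range of a symmetric form with closed range is the annihilator of its kernel. -/
lemma mem_range_iff_of_symm (b : H →L[ℝ] StrongDual ℝ H) (hs : ∀ u v, b u v = b v u)
    (hcl : IsClosed (range b)) (f : StrongDual ℝ H) :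
    f ∈ range b ↔ ∀ z, b z = 0 → f z = 0 := by
  constructor
  · rintro ⟨u, rfl⟩ z hz
    rw [hs, hz, zero_apply]
  · intro hf
    -- The range, transported to `H` by the Riesz isomorphism. By symmetry of `b` its orthogonal
    -- complement is contained in the kernel, and being closed it equals its double orthogonal
    -- complement.
    let R : Submodule ℝ H := (LinearMap.range (b : H →ₗ[ℝ] StrongDual ℝ H)).comap
      (InnerProductSpace.toDual ℝ H).toLinearEquiv.toLinearMap
    have hR : IsClosed (R : Set H) := 
      hcl.preimage (InnerProductSpace.toDual ℝ H).continuous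
    have : CompleteSpace R := hR.completeSpace_coe
    have hmem : (InnerProductSpace.toDual ℝ H).symm f ∈ Rᗮᗮ := by
      rw [Submodule.mem_orthogonal]
      intro z hz
      rw [real_inner_comm, InnerProductSpace.toDual_symm_apply]
      refine hf z (ContinuousLinearMap.ext fun u ↦ ?_)
      rw [hs, zero_apply]
      have := (Submodule.mem_orthogonal R z).1 hz ((InnerProductSpace.toDual ℝ H).symm (b u))
        ⟨u, by simp⟩
      rwa [InnerProductSpace.toDual_symm_apply] at this
    rw [Submodule.orthogonal_orthogonal] at hmem
    obtain ⟨u, hu⟩ := hmem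
    refine ⟨u, ?_⟩
    simpa using hu

/-- A criterion for a quadratic form on a Hilbert space to be Fredholm, and to be nondegenerate. -/
lemma isFredholmForm_of_bound {q : H → ℝ} (b : H →L[ℝ] StrongDual ℝ H) (hb : IsPolarForm q b)
    (Z : Submodule ℝ H) (hZ : IsClosed (Z : Set H)) [FiniteDimensional ℝ (H ⧸ Z)]
    {c : ℝ} (hc : 0 < c) (h : ∀ z ∈ Z, c * ‖z‖ ≤ ‖b z‖) :
    IsFredholmForm q ∧ (IsNondegenerateForm q ↔ ∀ u, b u = 0 → u = 0) := by
  have hcl := isClosed_range_of_bound b Z hZ hc h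
  have hker := finiteDimensional_ker_of_bound b Z hc h
  have hmem := mem_range_iff_of_symm b hb.1 hcl
  refine ⟨⟨b, hb, hker, hcl, ?_⟩, ?_, ?_⟩
  · let K := LinearMap.ker (b : H →ₗ[ℝ] StrongDual ℝ H)
    -- Restriction of functionals to the kernel `K` of `b`. Its kernel is the range of `b`, so the
    -- cokernel embeds into the algebraic dual of the finite dimensional space `K`.
    let ρ : StrongDual ℝ H →ₗ[ℝ] (K →ₗ[ℝ] ℝ) :=
      (LinearMap.lcomp ℝ ℝ K.subtype).comp (ContinuousLinearMap.coeLM ℝ)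
    have hρ : LinearMap.ker ρ = LinearMap.range (b : H →ₗ[ℝ] StrongDual ℝ H) := by
      ext f
      have h1 : f ∈ LinearMap.range (b : H →ₗ[ℝ] StrongDual ℝ H) ↔ f ∈ range b := Iff.rfl
      rw [h1, hmem f, LinearMap.mem_ker]
      constructor
      · intro hf z hz
        exact LinearMap.congr_fun hf ⟨z, hz⟩
      · intro hf
        ext z
        exact hf z z.2
    rw [← hρ]
    exact FiniteDimensional.of_injective ((LinearMap.ker ρ).liftQ ρ le_rfl)
      (LinearMap.ker_eq_bot.1 (Submodule.ker_liftQ_eq_bot _ _ _ le_rfl))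
  · rintro ⟨b', hb'⟩ u hu
    -- Polarisation: two symmetric forms with the same diagonal `q` coincide.
    have hpol : ∀ x y, b x y = b' x y := fun x y ↦ by
      have e1 := hb.2 (x + y)
      have e2 := hb'.2 (x + y)
      rw [e1] at e2
      have ex := (hb.2 x).symm.trans (hb'.2 x)
      have ey := (hb.2 y).symm.trans (hb'.2 y)
      simp only [map_add, add_apply] at e2
      have s1 := hb.1 x y
      have s2 := hb'.1 x y
      simp only [ContinuousLinearEquiv.coe_coe] at *
      linarith
    have : b' u = 0 := ContinuousLinearMap.ext fun y ↦ by rw [← hpol, hu]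
    exact b'.map_eq_zero_iff.1 this
  · intro hinj
    have h1 : LinearMap.ker (b : H →ₗ[ℝ] StrongDual ℝ H) = ⊥ :=
      (Submodule.eq_bot_iff _).2 fun u hu ↦ hinj u hu
    have h2 : LinearMap.range (b : H →ₗ[ℝ] StrongDual ℝ H) = ⊤ :=
      eq_top_iff.2 fun f _ ↦ (hmem f).2 fun z hz ↦ by rw [hinj z hz, map_zero]
    refine ⟨ContinuousLinearEquiv.ofBijective b h1 h2, ?_⟩
    rwa [ContinuousLinearEquiv.coe_ofBijective]

end Fredholm

/-! ### The index form on an interval: boundedness and coercivity on short intervals -/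

section IndexForm

variable {n : ℕ} {a b : ℝ}

lemma integral_mul_le_sqrt_mul_sqrt {α : Type*} [MeasurableSpace α] {μ : Measure α} {f g : α → ℝ}
    (hf : MemLp f 2 μ) (hg : MemLp g 2 μ) :
    ∫ x, |f x| * |g x| ∂μ ≤ √(∫ x, f x ^ 2 ∂μ) * √(∫ x, g x ^ 2 ∂μ) := by
  have h := integral_mul_norm_le_Lp_mul_Lq (μ := μ) (f := f) (g := g) (p := 2) (q := 2)
    Real.HolderConjugate.two_two (by simpa using hf) (by simpa using hg)
  simpa [Real.sqrt_eq_rpow] using h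

/-- The square of the `H¹` norm. -/
def sobolevSq (a b : ℝ) (u : ℝ → Eucl n) : ℝ :=
  ∫ x in a..b, (⟪u x, u x⟫_ℝ + ⟪deriv u x, deriv u x⟫_ℝ)

lemma MemLp.intervalIntegrable_norm_sq {E : Type*} [NormedAddCommGroup E] {f : ℝ → E}
    (hf : MemLp f 2 (volume.restrict (Icc a b))) (hab : a ≤ b) :
    IntervalIntegrable (fun x ↦ ‖f x‖ ^ 2) volume a b := by
  rw [intervalIntegrable_iff_integrableOn_Icc_of_le hab]
  exact hf.integrable_norm_pow (by norm_num)

lemma IsH1On.sobolevSq_eq {u : ℝ → Eucl n} (hab : a ≤ b) (hu : IsH1On a b u) :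
    sobolevSq a b u = (∫ x in a..b, ‖u x‖ ^ 2) + ∫ x in a..b, ‖deriv u x‖ ^ 2 := by
  rw [← intervalIntegral.integral_add (MemLp.intervalIntegrable_norm_sq (hu.memLp hab) hab)
    (MemLp.intervalIntegrable_norm_sq (hu.memLp_deriv hab) hab)]
  simp only [sobolevSq, real_inner_self_eq_norm_sq]

lemma sobolevSq_nonneg (hab : a ≤ b) (u : ℝ → Eucl n) : 0 ≤ sobolevSq a b u :=
  intervalIntegral.integral_nonneg hab fun _ _ ↦
    add_nonneg real_inner_self_nonneg real_inner_self_nonneg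

lemma integral_norm_sq_nonneg (hab : a ≤ b) (u : ℝ → Eucl n) : 0 ≤ ∫ x in a..b, ‖u x‖ ^ 2 :=
  intervalIntegral.integral_nonneg hab fun _ _ ↦ by positivity

lemma norm_integral_le_sqrt_mul_sqrt {f : ℝ → Eucl n} (hab : a ≤ b)
    (hm : MemLp f 2 (volume.restrict (Icc a b))) {s : ℝ} (hs : s ∈ Icc a b) :
    ‖∫ r in a..s, f r‖ ≤ √(b - a) * √(∫ x in a..b, ‖f x‖ ^ 2) := by
  refine (intervalIntegral.norm_integral_le_integral_norm hs.1).trans ?_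
  refine (intervalIntegral.integral_mono_interval le_rfl hs.1 hs.2
    (Eventually.of_forall fun x ↦ norm_nonneg _)
    (memLp_intervalIntegrable hm (right_mem_Icc.2 hab)).norm).trans ?_
  have h := integral_mul_le_sqrt_mul_sqrt (μ := volume.restrict (Icc a b)) (f := fun _ ↦ (1 : ℝ))
    (g := fun x ↦ ‖f x‖) (memLp_const 1) hm.norm
  simp only [abs_one, one_mul, abs_norm, one_pow, integral_const, smul_eq_mul, mul_one] at h
  rw [intervalIntegral.integral_of_le hab, intervalIntegral.integral_of_le hab,
    restrict_Ioc_eq_restrict_Icc]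
  have hv : (volume.restrict (Icc a b)).real univ = b - a := by simp [measureReal_def, hab]
  rwa [hv] at h

lemma IsH1On.norm_sub_le {u : ℝ → Eucl n} (hab : a ≤ b) (hu : IsH1On a b u) {s : ℝ}
    (hs : s ∈ Icc a b) : ‖u s - u a‖ ≤ √(b - a) * √(∫ x in a..b, ‖deriv u x‖ ^ 2) := by
  rw [hu.eq_add_integral_deriv hab hs, add_sub_cancel_left]
  exact norm_integral_le_sqrt_mul_sqrt hab (hu.memLp_deriv hab) hs

/-- The Poincaré inequality on an interval. -/
lemma IsH1On.integral_norm_sq_le {u : ℝ → Eucl n} (hab : a ≤ b) (hu : IsH1On a b u) (ha : u a = 0) :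
    ∫ x in a..b, ‖u x‖ ^ 2 ≤ (b - a) ^ 2 * ∫ x in a..b, ‖deriv u x‖ ^ 2 := by
  have hD := integral_norm_sq_nonneg hab (deriv u)
  have h : ∀ x ∈ Icc a b, ‖u x‖ ^ 2 ≤ (b - a) * ∫ x in a..b, ‖deriv u x‖ ^ 2 := fun x hx ↦ by
    have h1 := hu.norm_sub_le hab hx
    rw [ha, sub_zero] at h1
    calc ‖u x‖ ^ 2 ≤ (√(b - a) * √(∫ x in a..b, ‖deriv u x‖ ^ 2)) ^ 2 := by gcongr
      _ = _ := by rw [mul_pow, Real.sq_sqrt (sub_nonneg.2 hab), Real.sq_sqrt hD]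
  have h2 := intervalIntegral.integral_mono_on hab
    (MemLp.intervalIntegrable_norm_sq (hu.memLp hab) hab) intervalIntegrable_const h
  rw [intervalIntegral.integral_const, smul_eq_mul] at h2
  linarith [h2]

/-- The integrand of the index form, in coordinates. -/
def indexDensity (G : ℝ → Eucl n →L[ℝ] Eucl n →L[ℝ] ℝ) (Γ : ℝ → Eucl n →L[ℝ] Eucl n)
    (q : ℝ → Eucl n →L[ℝ] Eucl n →L[ℝ] ℝ) (u w : ℝ → Eucl n) (t : ℝ) : ℝ :=
  G t (deriv u t + Γ t (u t)) (deriv w t + Γ t (w t)) - q t (u t) (w t)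

variable {G q : ℝ → Eucl n →L[ℝ] Eucl n →L[ℝ] ℝ} {Γ : ℝ → Eucl n →L[ℝ] Eucl n}

lemma memLp_covDeriv {u : ℝ → Eucl n} (hab : a ≤ b) (hΓ : ContinuousOn Γ (Icc a b))
    (hu : IsH1On a b u) :
    MemLp (fun t ↦ deriv u t + Γ t (u t)) 2 (volume.restrict (Icc a b)) :=
  (hu.memLp_deriv hab).add (memLp_clm_apply hΓ (hu.memLp hab))

lemma intervalIntegrable_bilin {B : ℝ → Eucl n →L[ℝ] Eucl n →L[ℝ] ℝ} {f g : ℝ → Eucl n}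
    (hab : a ≤ b) (hB : ContinuousOn B (Icc a b)) (hf : MemLp f 2 (volume.restrict (Icc a b)))
    (hg : MemLp g 2 (volume.restrict (Icc a b))) :
    IntervalIntegrable (fun t ↦ B t (f t) (g t)) volume a b := by
  rw [intervalIntegrable_iff_integrableOn_Icc_of_le hab]
  refine memLp_one_iff_integrable.1 ?_
  have h1 := memLp_clm_apply hB hf
  refine MemLp.of_bilin (p := 2) (q := 2) (fun (x : Eucl n →L[ℝ] ℝ) y ↦ x y) 1 h1 hg ?_ ?_
  · exact (isBoundedBilinearMap_apply (𝕜 := ℝ)).continuous.comp_aestronglyMeasurable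
      (h1.1.prodMk hg.1)
  · filter_upwards with x
    rw [one_mul]
    exact ContinuousLinearMap.le_opNNNorm _ _

lemma intervalIntegrable_indexDensity (hab : a ≤ b) (hG : ContinuousOn G (Icc a b))
    (hΓ : ContinuousOn Γ (Icc a b)) (hq : ContinuousOn q (Icc a b)) {u w : ℝ → Eucl n}
    (hu : IsH1On a b u) (hw : IsH1On a b w) :
    IntervalIntegrable (indexDensity G Γ q u w) volume a b :=
  (intervalIntegrable_bilin hab hG (memLp_covDeriv hab hΓ hu) (memLp_covDeriv hab hΓ hw)).sub
    (intervalIntegrable_bilin hab hq (hu.memLp hab) (hw.memLp hab))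

lemma exists_pos_bound {E : Type*} [NormedAddCommGroup E] {f : ℝ → E}
    (hf : ContinuousOn f (Icc a b)) : ∃ C, 0 < C ∧ ∀ x ∈ Icc a b, ‖f x‖ ≤ C := by
  obtain ⟨C, hC⟩ := isCompact_Icc.exists_bound_of_continuousOn hf
  exact ⟨max C 1, by positivity, fun x hx ↦ (hC x hx).trans (le_max_left _ _)⟩

/-- The density is at most `K (|u| + |u'|) (|w| + |w'|)`, to which Cauchy–Schwarz applies; the
factor `2` comes from `(x + y)² ≤ 2 (x² + y²)`. -/
lemma exists_indexDensity_bound (hab : a ≤ b) (hG : ContinuousOn G (Icc a b))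
    (hΓ : ContinuousOn Γ (Icc a b)) (hq : ContinuousOn q (Icc a b)) :
    ∃ C, 0 < C ∧ ∀ u w : ℝ → Eucl n, IsH1On a b u → IsH1On a b w →
      |∫ x in a..b, indexDensity G Γ q u w x| ≤ C * (√(sobolevSq a b u) * √(sobolevSq a b w)) := by
  obtain ⟨A, hA, hA'⟩ := exists_pos_bound hG
  obtain ⟨B, hB, hB'⟩ := exists_pos_bound hΓ
  obtain ⟨Q, hQ, hQ'⟩ := exists_pos_bound hq
  set K := A * (1 + B) ^ 2 + Q with hK
  have hKpos : 0 < K := by positivity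
  refine ⟨2 * K, by positivity, fun u w hu hw ↦ ?_⟩
  have hpt : ∀ x ∈ Icc a b, |indexDensity G Γ q u w x|
      ≤ K * (|‖u x‖ + ‖deriv u x‖| * |‖w x‖ + ‖deriv w x‖|) := by
    intro x hx
    have hcov : ∀ z : ℝ → Eucl n, ‖deriv z x + Γ x (z x)‖ ≤ (1 + B) * (‖z x‖ + ‖deriv z x‖) := by
      intro z
      have h1 := norm_add_le (deriv z x) (Γ x (z x))
      have h2 := (Γ x).le_of_opNorm_le (hB' x hx) (z x)
      nlinarith [norm_nonneg (z x), norm_nonneg (deriv z x)]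
    have h1 : ‖G x (deriv u x + Γ x (u x)) (deriv w x + Γ x (w x))‖
        ≤ A * ((1 + B) * (‖u x‖ + ‖deriv u x‖)) * ((1 + B) * (‖w x‖ + ‖deriv w x‖)) := by
      refine ((G x).le_opNorm₂ _ _).trans ?_
      have := hA' x hx
      have := hcov u
      have := hcov w
      gcongr
    have h2 : ‖q x (u x) (w x)‖ ≤ Q * (‖u x‖ + ‖deriv u x‖) * (‖w x‖ + ‖deriv w x‖) := by
      refine ((q x).le_opNorm₂ _ _).trans ?_
      have := hQ' x hx
      have := le_add_of_nonneg_right (a := ‖u x‖) (norm_nonneg (deriv u x))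
      have := le_add_of_nonneg_right (a := ‖w x‖) (norm_nonneg (deriv w x))
      gcongr
    have e : ∀ z : ℝ → Eucl n, |‖z x‖ + ‖deriv z x‖| = ‖z x‖ + ‖deriv z x‖ := fun z ↦
      abs_of_nonneg (by positivity)
    rw [e, e]
    refine (norm_sub_le _ _).trans ((add_le_add h1 h2).trans (le_of_eq ?_))
    rw [hK]
    ring
  have hm : ∀ z : ℝ → Eucl n, IsH1On a b z →
      MemLp (fun x ↦ ‖z x‖ + ‖deriv z x‖) 2 (volume.restrict (Icc a b)) := fun z hz ↦
    (hz.memLp hab).norm.add (hz.memLp_deriv hab).norm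
  have hsq : ∀ z : ℝ → Eucl n, IsH1On a b z →
      √(∫ x in Icc a b, (‖z x‖ + ‖deriv z x‖) ^ 2) ≤ √2 * √(sobolevSq a b z) := by
    intro z hz
    rw [← Real.sqrt_mul (by norm_num)]
    refine Real.sqrt_le_sqrt ?_
    rw [sobolevSq, ← intervalIntegral.integral_const_mul, intervalIntegral.integral_of_le hab,
      restrict_Ioc_eq_restrict_Icc]
    refine integral_mono_of_nonneg (Eventually.of_forall fun x ↦ sq_nonneg _) ?_
      (Eventually.of_forall fun x ↦ ?_)
    · have := (hz.inner_integrable hab hz).const_mul 2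
      rwa [intervalIntegrable_iff_integrableOn_Icc_of_le hab] at this
    · simp only [real_inner_self_eq_norm_sq]
      nlinarith [sq_nonneg (‖z x‖ - ‖deriv z x‖)]
  have hint : Integrable (fun x ↦ |‖u x‖ + ‖deriv u x‖| * |‖w x‖ + ‖deriv w x‖|)
      (volume.restrict (Icc a b)) :=
    (hm u hu).abs.integrable_mul (hm w hw).abs
  rw [intervalIntegral.integral_of_le hab, restrict_Ioc_eq_restrict_Icc]
  calc |∫ x in Icc a b, indexDensity G Γ q u w x|
      ≤ ∫ x in Icc a b, |indexDensity G Γ q u w x| := abs_integral_le_integral_abs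
    _ ≤ ∫ x in Icc a b, K * (|‖u x‖ + ‖deriv u x‖| * |‖w x‖ + ‖deriv w x‖|) := by
        refine integral_mono_of_nonneg (Eventually.of_forall fun x ↦ abs_nonneg _)
          (hint.const_mul K) ?_
        filter_upwards [ae_restrict_mem measurableSet_Icc] with x hx using hpt x hx
    _ = K * ∫ x in Icc a b, |‖u x‖ + ‖deriv u x‖| * |‖w x‖ + ‖deriv w x‖| :=
        integral_const_mul _ _
    _ ≤ K * ((√2 * √(sobolevSq a b u)) * (√2 * √(sobolevSq a b w))) := by
        gcongr
        refine (integral_mul_le_sqrt_mul_sqrt (hm u hu) (hm w hw)).trans ?_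
        exact mul_le_mul (hsq u hu) (hsq w hw) (by positivity) (by positivity)
    _ = 2 * K * (√(sobolevSq a b u) * √(sobolevSq a b w)) := by
        have : √2 * √2 = (2 : ℝ) := Real.mul_self_sqrt (by norm_num)
        linear_combination K * √(sobolevSq a b u) * √(sobolevSq a b w) * this

/-- On short intervals the index form is coercive in the direction of a suitable constant
rotation. -/
lemma exists_indexDensity_coercive (hG : ContinuousOn G (Icc a b))
    (hΓ : ContinuousOn Γ (Icc a b)) (hq : ContinuousOn q (Icc a b))
    (hsymm : ∀ t ∈ Icc a b, ∀ u v, G t u v = G t v u) (hinv : ∀ t ∈ Icc a b, (G t).IsInvertible) :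
    ∃ δ > 0, ∃ C > 0, ∀ s t, a ≤ s → s ≤ t → t ≤ b → t - s ≤ δ →
      ∃ J : Eucl n →L[ℝ] Eucl n, ‖J‖ ≤ C ∧ ∀ u : ℝ → Eucl n, IsH1On s t u → u s = 0 →
        sobolevSq s t u ≤ 4 * ∫ x in s..t, indexDensity G Γ q u (fun x ↦ J (u x)) x := by
  obtain ⟨A, hA, hA'⟩ := exists_pos_bound hG
  obtain ⟨B, hB, hB'⟩ := exists_pos_bound hΓ
  obtain ⟨Q, hQ, hQ'⟩ := exists_pos_bound hq
  have hinvc : ContinuousOn (fun t ↦ (G t).inverse) (Icc a b) := fun t ht ↦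
    ((hinv t ht).contDiffAt_map_inverse (n := 1)).continuousAt.comp_continuousWithinAt (hG t ht)
  -- `C` bounds the inverses of `G t` uniformly in `t`, hence bounds every `J` chosen below,
  -- independently of the subinterval.
  have hJc : ContinuousOn (fun t ↦ (G t).inverse.comp (innerSL ℝ (E := Eucl n))) (Icc a b) :=
    hinvc.clm_comp continuousOn_const
  obtain ⟨C, hC, hC'⟩ := exists_pos_bound hJc
  have huc := isCompact_Icc.uniformContinuousOn_of_continuous hG
  -- With `‖J‖ ≤ C`, an oscillation of `G` of at most `1 / (4 C)` costs at most a quarter of `‖v‖²`.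
  obtain ⟨δ₁, hδ₁, hδ₁'⟩ := Metric.uniformContinuousOn_iff.1 huc (1 / (4 * C)) (by positivity)
  -- The cross terms are at most `2 A B C ‖v‖ ‖y‖ ≤ ‖v‖² / 4 + (2 A B C)² ‖y‖²`; the other two
  -- summands bound the terms quadratic in `y`. Of the leading `‖v‖²` one half survives.
  set K := (2 * A * B * C) ^ 2 + A * B ^ 2 * C + Q * C with hK
  have hKpos : 0 < K := by positivity
  -- Halving `δ₁` turns `t - s ≤ δ` into the strict inequality needed for uniform continuity. The
  -- second bound gives `(t - s)² (4 K + 1) ≤ 1`, so that the Poincaré inequality absorbs both the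
  -- term with `K` and the `L²` part of the norm.
  refine ⟨min (δ₁ / 2) (1 / (4 * K + 1)), by positivity, C, hC, fun s t has hst htb hδ ↦ ?_⟩
  have hsab : s ∈ Icc a b := ⟨has, hst.trans htb⟩
  -- `J` is frozen at the left end point and satisfies `G s (v, J v) = ‖v‖²`; being constant, it
  -- commutes with differentiation.
  set J : Eucl n →L[ℝ] Eucl n := (G s).inverse.comp (innerSL ℝ (E := Eucl n)) with hJ
  have hJn : ‖J‖ ≤ C := hC' s hsab
  have hGJ : ∀ v, G s v (J v) = ‖v‖ ^ 2 := by
    intro v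
    rw [hsymm s hsab]
    have h1 : G s (J v) = innerSL ℝ v := by
      obtain ⟨e, he⟩ := hinv s hsab
      simp [hJ, ← he]
    rw [h1, innerSL_apply_apply, real_inner_self_eq_norm_sq]
  refine ⟨J, hJn, fun u hu hus ↦ ?_⟩
  have hsub : Icc s t ⊆ Icc a b := Icc_subset_Icc has htb
  have hJu : IsH1On s t (fun x ↦ J (u x)) :=
    hu.clm_apply hst (T := fun _ ↦ J) (T' := fun _ ↦ 0) (fun x _ ↦ hasDerivWithinAt_const _ _ _)
      continuousOn_const
  have hpt : ∀ x ∈ Icc s t, ∀ v y : Eucl n, 1 / 2 * ‖v‖ ^ 2 - K * ‖y‖ ^ 2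
      ≤ G x (v + Γ x y) (J v + Γ x (J y)) - q x y (J y) := by
    intro x hx v y
    have hxab := hsub hx
    have hJv : ∀ z, ‖J z‖ ≤ C * ‖z‖ := fun z ↦ J.le_of_opNorm_le hJn z
    have hΓz : ∀ z, ‖Γ x z‖ ≤ B * ‖z‖ := fun z ↦ (Γ x).le_of_opNorm_le (hB' x hxab) z
    have hGz : ∀ y z, |G x y z| ≤ A * ‖y‖ * ‖z‖ := fun y z ↦ ((G x).le_opNorm₂ y z).trans (by
      have := hA' x hxab
      gcongr)
    have hqz : |q x y (J y)| ≤ Q * ‖y‖ * (C * ‖y‖) := ((q x).le_opNorm₂ y _).trans (by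
      have := hQ' x hxab
      have := hJv y
      gcongr)
    have h1 : |G x v (J v) - G s v (J v)| ≤ 1 / 4 * ‖v‖ ^ 2 := by
      have hd : ‖G x - G s‖ ≤ 1 / (4 * C) := by
        rw [← dist_eq_norm]
        refine (hδ₁' x hxab s hsab ?_).le
        rw [Real.dist_eq, abs_of_nonneg (sub_nonneg.2 hx.1)]
        have := hδ.trans (min_le_left _ _)
        linarith [hx.2]
      have := ((G x - G s).le_opNorm₂ v (J v)).trans (by
        have := hJv v
        gcongr : _ ≤ 1 / (4 * C) * ‖v‖ * (C * ‖v‖))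
      refine (Eq.trans_le ?_ this).trans (le_of_eq ?_)
      · rfl
      · field_simp
    have h2 : |G x v (Γ x (J y))| ≤ A * ‖v‖ * (B * (C * ‖y‖)) := (hGz _ _).trans (by
      have := (hΓz (J y)).trans (by have := hJv y; gcongr : _ ≤ B * (C * ‖y‖))
      gcongr)
    have h3 : |G x (Γ x y) (J v)| ≤ A * (B * ‖y‖) * (C * ‖v‖) := (hGz _ _).trans (by
      have := hΓz y
      have := hJv v
      gcongr)
    have h4 : |G x (Γ x y) (Γ x (J y))| ≤ A * (B * ‖y‖) * (B * (C * ‖y‖)) := (hGz _ _).trans (by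
      have := hΓz y
      have := (hΓz (J y)).trans (by have := hJv y; gcongr : _ ≤ B * (C * ‖y‖))
      gcongr)
    simp only [map_add, add_apply]
    rw [hGJ] at h1
    have e1 := (abs_le.1 h1).1
    have e2 := (abs_le.1 h2).1
    have e3 := (abs_le.1 h3).1
    have e4 := (abs_le.1 h4).1
    have e5 := (abs_le.1 hqz).2
    have e6 := sq_nonneg (1 / 2 * ‖v‖ - 2 * A * B * C * ‖y‖)
    rw [hK]
    linarith
  have hae : (indexDensity G Γ q u fun x ↦ J (u x)) =ᵐ[volume.restrict (Icc s t)] fun x ↦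
      G x (deriv u x + Γ x (u x)) (J (deriv u x) + Γ x (J (u x))) - q x (u x) (J (u x)) := by
    filter_upwards [hu.ae_hasDerivAt hst] with x hx
    simp only [indexDensity]
    have hd : HasDerivAt (fun x ↦ J (u x)) (J (deriv u x)) x := J.hasFDerivAt.comp_hasDerivAt x hx
    rw [hd.deriv]
  have hi1 := MemLp.intervalIntegrable_norm_sq (hu.memLp hst) hst
  have hi2 := MemLp.intervalIntegrable_norm_sq (hu.memLp_deriv hst) hst
  have hlow : 1 / 2 * (∫ x in s..t, ‖deriv u x‖ ^ 2) - K * ∫ x in s..t, ‖u x‖ ^ 2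
      ≤ ∫ x in s..t, indexDensity G Γ q u (fun x ↦ J (u x)) x := by
    rw [← intervalIntegral.integral_const_mul, ← intervalIntegral.integral_const_mul,
      ← intervalIntegral.integral_sub (hi2.const_mul _) (hi1.const_mul _)]
    refine intervalIntegral.integral_mono_ae_restrict hst ((hi2.const_mul _).sub (hi1.const_mul _))
      (intervalIntegrable_indexDensity hst (hG.mono hsub) (hΓ.mono hsub) (hq.mono hsub) hu hJu) ?_
    filter_upwards [hae, ae_restrict_mem measurableSet_Icc] with x hx hxm
    rw [hx]
    exact hpt x hxm _ _
  have hP := hu.integral_norm_sq_le hst hus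
  have hD := integral_norm_sq_nonneg hst (deriv u)
  have hPn := integral_norm_sq_nonneg hst u
  rw [hu.sobolevSq_eq hst]
  have hδ2 : (t - s) ^ 2 * (4 * K + 1) ≤ 1 := by
    have h1 := hδ.trans (min_le_right _ _)
    rw [le_div_iff₀ (by positivity)] at h1
    have h0 : 0 ≤ t - s := sub_nonneg.2 hst
    nlinarith [mul_nonneg h0 hKpos.le]
  have h5 : (4 * K + 1) * (∫ x in s..t, ‖u x‖ ^ 2) ≤ ∫ x in s..t, ‖deriv u x‖ ^ 2 := by
    calc (4 * K + 1) * (∫ x in s..t, ‖u x‖ ^ 2)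
        ≤ (4 * K + 1) * ((t - s) ^ 2 * ∫ x in s..t, ‖deriv u x‖ ^ 2) := by gcongr
      _ = ((t - s) ^ 2 * (4 * K + 1)) * ∫ x in s..t, ‖deriv u x‖ ^ 2 := by ring
      _ ≤ 1 * ∫ x in s..t, ‖deriv u x‖ ^ 2 := by gcongr
      _ = _ := one_mul _
  linarith

end IndexForm

/-! ### Fields on the pieces of a subdivision, extension by zero, and the norm of `H¹₀(γ)` -/

section FieldsOnPieces

variable {n ν : ℕ} {M : Type*} [TopologicalSpace M] [ChartedSpace (Eucl n) M]
  [IsManifold (𝓡 n) ∞ M] {γ : ℝ → M}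

/-- Subdivisions are only weakly monotone, so intervals reduced to a point do occur. -/
lemma isH1On_self {a : ℝ} (u : ℝ → Eucl n) : IsH1On a a u :=
  ⟨0, MemLp.zero, fun s hs ↦ by
    have : s = a := le_antisymm hs.2 hs.1
    simp [this]⟩

lemma isH1On_of_contDiffOn {a b : ℝ} {u : ℝ → Eucl n} (hab : a ≤ b)
    (hu : ContDiffOn ℝ ∞ u (Icc a b)) : IsH1On a b u := by
  rcases hab.eq_or_lt with rfl | hlt
  · exact isH1On_self u
  · exact isH1On_of_hasDerivWithinAt
      (fun x hx ↦ (hu.differentiableOn (by simp) x hx).hasDerivWithinAt)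
      (hu.continuousOn_derivWithin (uniqueDiffOn_Icc hlt) (by simp))

lemma Icc_subset_chartDom {a b : ℝ} {c : M} (ha : 0 ≤ a) (hb : b ≤ 1)
    (hc : ∀ t ∈ Icc a b, γ t ∈ (chartAt (Eucl n) c).source) : Icc a b ⊆ chartDom n c γ :=
  fun t ht ↦ ⟨⟨ha.trans ht.1, ht.2.trans hb⟩, hc t ht⟩

lemma isH1On_fieldIn_trans (hγ : ContMDiffOn 𝓘(ℝ, ℝ) (𝓡 n) ∞ γ (Icc 0 1))
    {ξ : FieldAlong (n := n) γ} {a b : ℝ} {c d : M} (hab : a ≤ b) (hc : Icc a b ⊆ chartDom n c γ)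
    (hd : Icc a b ⊆ chartDom n d γ) (h : IsH1On a b (fieldIn γ ξ c)) :
    IsH1On a b (fieldIn γ ξ d) := by
  rcases hab.eq_or_lt with rfl | hlt
  · exact isH1On_self _
  have hT := (contDiffOn_tcc hγ c d).mono (subset_inter hc hd)
  refine (h.clm_apply hab (fun x hx ↦ (hT.differentiableOn (by simp) x hx).hasDerivWithinAt)
    (hT.continuousOn_derivWithin (uniqueDiffOn_Icc hlt) (by simp))).congr hab fun t ht ↦ ?_
  exact (fieldIn_trans ξ (hc ht).2 (hd ht).2).symm

namespace ChartSubdivision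

variable (S : ChartSubdivision n γ)

lemma nonneg (i : ℕ) : 0 ≤ S.t i := S.first ▸ S.mono (Nat.zero_le i)

lemma le_one {i : ℕ} (hi : i ≤ S.N) : S.t i ≤ 1 := S.last ▸ S.mono hi

lemma subset_chartDom {i : ℕ} (hi : i < S.N) :
    Icc (S.t i) (S.t (i + 1)) ⊆ chartDom n (S.c i) γ :=
  Icc_subset_chartDom (S.nonneg i) (S.le_one hi) (S.mem_source i hi)

/-- Being of class `H¹` can be checked on the pieces of a subdivision. -/
lemma isH1Field_of_pieces (hγ : ContMDiffOn 𝓘(ℝ, ℝ) (𝓡 n) ∞ γ (Icc 0 1))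
    {ξ : FieldAlong (n := n) γ}
    (h : ∀ i < S.N, IsH1On (S.t i) (S.t (i + 1)) (fieldIn γ ξ (S.c i))) : IsH1Field γ ξ := by
  intro c a b ha hab hb hc
  have hcd := Icc_subset_chartDom ha hb hc
  -- Induction on the number of pieces needed to reach `b'`; each new piece is transported to the
  -- chart at `c` and glued on.
  have key : ∀ k ≤ S.N, ∀ b', a ≤ b' → b' ≤ b → b' ≤ S.t k → IsH1On a b' (fieldIn γ ξ c) := by
    intro k
    induction k with
    | zero =>
      intro _ b' hab' hb' hk
      rw [S.first] at hk
      obtain rfl : b' = a := le_antisymm (hk.trans ha) hab'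
      exact isH1On_self _
    | succ k ih =>
      intro hkN b' hab' hb' hk
      have hkN' : k < S.N := hkN
      rcases le_total b' (S.t k) with h1 | h1
      · exact ih hkN'.le b' hab' hb' h1
      have piece : ∀ a', a ≤ a' → S.t k ≤ a' → a' ≤ b' → IsH1On a' b' (fieldIn γ ξ c) := by
        intro a' haa' hka' hab''
        refine isH1On_fieldIn_trans hγ hab'' ((Icc_subset_Icc hka' hk).trans (S.subset_chartDom hkN'))
          ((Icc_subset_Icc haa' hb').trans hcd) ((h k hkN').mono hka' hab'' hk)
      rcases le_total (S.t k) a with h2 | h2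
      · exact piece a le_rfl h2 hab'
      · exact (ih hkN'.le _ h2 (h1.trans hb') le_rfl).trans (piece _ h2 le_rfl h1) h2 h1
  exact key S.N le_rfl b hab le_rfl (by rwa [S.last])

end ChartSubdivision

/-- The field along `γ` with coordinate expression `w` in the chart at `c` over `[a, b]`, extended
by zero. -/
def localField (γ : ℝ → M) (c : M) (a b : ℝ) (w : ℝ → Eucl n) : FieldAlong (n := n) γ :=
  fun t ↦ (Icc a b).indicator (fun t ↦ ofChart c (γ t) (w t)) t

section LocalField

variable {a b : ℝ} {c : M} {w : ℝ → Eucl n}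

lemma fieldIn_localField (hc : ∀ t ∈ Icc a b, γ t ∈ (chartAt (Eucl n) c).source) {t : ℝ}
    (ht : t ∈ Icc a b) : fieldIn γ (localField γ c a b w) c t = w t := by
  refine (congrArg (toChart c (γ t)) (indicator_of_mem ht _)).trans ?_
  exact toChart_ofChart (hc t ht) _

lemma localField_eq_zero (hwa : w a = 0) (hwb : w b = 0) {t : ℝ} (ht : t ∉ Ioo a b) :
    localField γ c a b w t = 0 := by
  by_cases h : t ∈ Icc a b
  · refine (indicator_of_mem h _).trans ?_
    have hw : w t = 0 := by
      rcases h.1.eq_or_lt with rfl | h1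
      · exact hwa
      · rcases h.2.eq_or_lt with rfl | h2
        · exact hwb
        · exact absurd ⟨h1, h2⟩ ht
    exact (congrArg _ hw).trans (map_zero _)
  · exact indicator_of_notMem h _

lemma fieldIn_eq_zero {ξ : FieldAlong (n := n) γ} {t : ℝ} (h : ξ t = 0) (d : M) :
    fieldIn γ ξ d t = 0 :=
  (congrArg (toChart d (γ t)) h).trans (map_zero _)

/-- Since `w` vanishes at both ends, the extension by zero remains of class `H¹`. These fields are
the test fields for coercivity and for the weak equation. -/
lemma localField_mem (hγ : ContMDiffOn 𝓘(ℝ, ℝ) (𝓡 n) ∞ γ (Icc 0 1)) (ha : 0 ≤ a) (hab : a ≤ b)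
    (hb : b ≤ 1) (hc : ∀ t ∈ Icc a b, γ t ∈ (chartAt (Eucl n) c).source) (hw : IsH1On a b w)
    (hwa : w a = 0) (hwb : w b = 0) : localField γ c a b w ∈ h10Submodule n γ := by
  refine ⟨fun d a' b' ha' hab' hb' hd ↦ ?_, fun t ht ↦ localField_eq_zero hwa hwb fun h ↦
    ht ⟨ha.trans_lt h.1, h.2.trans_le hb⟩⟩
  have hz : ∀ p q, p ≤ q → (∀ t ∈ Icc p q, t ∉ Ioo a b) →
      IsH1On p q (fieldIn γ (localField γ c a b w) d) := fun p q hpq h ↦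
    (isH1On_zero p q).congr hpq fun t ht ↦ fieldIn_eq_zero (localField_eq_zero hwa hwb (h t ht)) d
  -- `p` and `q` are `a` and `b` clamped to `[a', b']`. The field vanishes on `[a', p]` and `[q,
  -- b']` unless these are points, and `[p, q]`, unless a point, lies in `[a, b]`.
  set p := max a' (min a b') with hp
  set q := max a' (min b b') with hq
  have hpq : p ≤ q := max_le_max le_rfl (min_le_min hab le_rfl)
  have hap : a' ≤ p := le_max_left _ _
  have hqb : q ≤ b' := max_le hab' (min_le_right _ _)
  refine (IsH1On.trans ?_ ?_ hap hpq).trans ?_ (hap.trans hpq) hqb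
  · rcases hap.eq_or_lt with h | h
    · rw [← h]; exact isH1On_self _
    · refine hz _ _ hap fun t ht hI ↦ ?_
      have : p ≤ a := by
        rw [hp] at h ⊢
        rcases le_total a' (min a b') with h' | h'
        · rw [max_eq_right h']; exact min_le_left _ _
        · rw [max_eq_left h'] at h; exact absurd h (lt_irrefl _)
      exact absurd hI.1 (not_lt.2 (ht.2.trans this))
  · rcases hpq.eq_or_lt with h | h
    · rw [← h]; exact isH1On_self _
    · have h1 : a ≤ p := by
        rcases le_total a b' with h' | h'
        · rw [hp, min_eq_left h']; exact le_max_right _ _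
        · rw [hp, hq, min_eq_right h', min_eq_right (h'.trans hab)] at h
          exact absurd h (lt_irrefl _)
      have h2 : q ≤ b := by
        rcases le_total a' b with h' | h'
        · exact max_le h' (min_le_left _ _)
        · rw [hp, hq, max_eq_left ((min_le_left _ _).trans h')] at h
          exact absurd h (not_lt.2 (le_max_left _ _))
      have hsub : Icc p q ⊆ Icc a b := Icc_subset_Icc h1 h2
      refine isH1On_fieldIn_trans (c := c) hγ hpq (hsub.trans (Icc_subset_chartDom ha hb hc))
        ((Icc_subset_Icc hap hqb).trans (Icc_subset_chartDom ha' hb' hd)) ?_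
      exact (hw.mono h1 hpq h2).congr hpq fun t ht ↦ fieldIn_localField hc (hsub ht)
  · rcases hqb.eq_or_lt with h | h
    · rw [h]; exact isH1On_self _
    · refine hz _ _ hqb fun t ht hI ↦ ?_
      have : b ≤ q := by
        rcases le_total b b' with h' | h'
        · rw [hq, min_eq_left h']; exact le_max_right _ _
        · exact absurd h (not_lt.2 (by rw [hq, min_eq_right h']; exact le_max_right _ _))
      exact absurd hI.2 (not_lt.2 (this.trans ht.1))

end LocalField

section Norm

variable {a b c : ℝ} {u w : ℝ → Eucl n}

lemma sobolevSq_congr (hab : a ≤ b) (h : EqOn u w (Icc a b)) :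
    sobolevSq a b u = sobolevSq a b w := by
  refine intervalIntegral.integral_congr_ae_restrict ?_
  rw [uIoc_of_le hab, ← restrict_Ioo_eq_restrict_Ioc]
  filter_upwards [ae_restrict_mem measurableSet_Ioo] with x hx
  have h1 : u =ᶠ[𝓝 x] w := by
    filter_upwards [Icc_mem_nhds hx.1 hx.2] with y hy using h hy
  rw [h1.deriv_eq, h1.eq_of_nhds]

lemma sobolevSq_eq_zero (hab : a ≤ b) (h : ∀ x ∈ Icc a b, u x = 0) : sobolevSq a b u = 0 := by
  rw [sobolevSq_congr hab (w := fun _ ↦ 0) h]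
  simp [sobolevSq]

lemma sobolevSq_add_adjacent (hab : a ≤ b) (hbc : b ≤ c) (hu : IsH1On a c u) :
    sobolevSq a b u + sobolevSq b c u = sobolevSq a c u :=
  intervalIntegral.integral_add_adjacent_intervals
    ((hu.mono le_rfl hab hbc).inner_integrable hab (hu.mono le_rfl hab hbc))
    ((hu.mono hab hbc le_rfl).inner_integrable hbc (hu.mono hab hbc le_rfl))

lemma sobolevSq_mono {s t : ℝ} (has : a ≤ s) (hst : s ≤ t) (htb : t ≤ b) (hu : IsH1On a b u) :
    sobolevSq s t u ≤ sobolevSq a b u := by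
  have hsb := hst.trans htb
  rw [← sobolevSq_add_adjacent has hsb hu,
    ← sobolevSq_add_adjacent hst htb (hu.mono has hsb le_rfl)]
  linarith [sobolevSq_nonneg has u, sobolevSq_nonneg htb u]

lemma sobolevSq_clm_le (hab : a ≤ b) (hu : IsH1On a b u) (J : Eucl n →L[ℝ] Eucl n) {C : ℝ}
    (hJ : ‖J‖ ≤ C) : sobolevSq a b (fun x ↦ J (u x)) ≤ C ^ 2 * sobolevSq a b u := by
  have hJu : IsH1On a b (fun x ↦ J (u x)) :=
    hu.clm_apply hab (T := fun _ ↦ J) (T' := fun _ ↦ 0) (fun x _ ↦ hasDerivWithinAt_const _ _ _)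
      continuousOn_const
  rw [sobolevSq, sobolevSq, ← intervalIntegral.integral_const_mul]
  refine intervalIntegral.integral_mono_ae_restrict hab (hJu.inner_integrable hab hJu)
    ((hu.inner_integrable hab hu).const_mul _) ?_
  filter_upwards [hu.ae_hasDerivAt hab] with x hx
  have hd : HasDerivAt (fun x ↦ J (u x)) (J (deriv u x)) x := J.hasFDerivAt.comp_hasDerivAt x hx
  rw [hd.deriv]
  simp only [real_inner_self_eq_norm_sq]
  have h1 : ∀ z, ‖J z‖ ^ 2 ≤ C ^ 2 * ‖z‖ ^ 2 := fun z ↦ by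
    rw [← mul_pow]
    exact pow_le_pow_left₀ (norm_nonneg _) (J.le_of_opNorm_le hJ z) 2
  linarith [h1 (u x), h1 (deriv u x)]

lemma H10.norm_sq_eq {S : ChartSubdivision n γ} (ξ : H10 γ S) :
    ‖ξ‖ ^ 2 = ∑ i ∈ Finset.range S.N,
      sobolevSq (S.t i) (S.t (i + 1)) (fieldIn γ ξ.field (S.c i)) :=
  (real_inner_self_eq_norm_sq ξ).symm

lemma H10.isH1On {S : ChartSubdivision n γ} (ξ : H10 γ S) {i : ℕ} (hi : i < S.N) :
    IsH1On (S.t i) (S.t (i + 1)) (fieldIn γ ξ.field (S.c i)) :=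
  S.isH1On ξ (Finset.mem_range.2 hi)

lemma H10.sobolevSq_le {S : ChartSubdivision n γ} (ξ : H10 γ S) {i : ℕ} (hi : i < S.N) :
    sobolevSq (S.t i) (S.t (i + 1)) (fieldIn γ ξ.field (S.c i)) ≤ ‖ξ‖ ^ 2 := by
  rw [ξ.norm_sq_eq]
  exact Finset.single_le_sum (f := fun i ↦ sobolevSq (S.t i) (S.t (i + 1))
    (fieldIn γ ξ.field (S.c i))) (fun j _ ↦ sobolevSq_nonneg (S.le_succ j) _)
    (Finset.mem_range.2 hi)

lemma H10.integral_norm_deriv_sq_le {S : ChartSubdivision n γ} (ξ : H10 γ S) {i : ℕ} (hi : i < S.N) :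
    ∫ x in (S.t i)..(S.t (i + 1)), ‖deriv (fieldIn γ ξ.field (S.c i)) x‖ ^ 2 ≤ ‖ξ‖ ^ 2 := by
  have h := ξ.sobolevSq_le hi
  rw [(ξ.isH1On hi).sobolevSq_eq (S.le_succ i)] at h
  linarith [integral_norm_sq_nonneg (S.le_succ i) (fieldIn γ ξ.field (S.c i))]

/-- The sup norm is controlled by the derivatives. -/
lemma H10.exists_sup_bound (S : ChartSubdivision n γ) :
    ∃ C : ℕ → ℝ, (∀ i, 0 ≤ C i) ∧ ∀ (ξ : H10 γ S) (R : ℝ), 0 ≤ R → (∀ j < S.N,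
      ∫ x in (S.t j)..(S.t (j + 1)), ‖deriv (fieldIn γ ξ.field (S.c j)) x‖ ^ 2 ≤ R ^ 2) →
      ∀ i < S.N, ∀ x ∈ Icc (S.t i) (S.t (i + 1)), ‖fieldIn γ ξ.field (S.c i) x‖ ≤ C i * R := by
  -- At the node between two pieces the coordinate expressions differ by a fixed linear map, whose
  -- norm is `A i`.
  have step : ∀ i, ∃ A : ℝ, 0 ≤ A ∧ (i + 1 < S.N → ∀ ξ : H10 γ S,
      ‖fieldIn γ ξ.field (S.c (i + 1)) (S.t (i + 1))‖
        ≤ A * ‖fieldIn γ ξ.field (S.c i) (S.t (i + 1))‖) := fun i ↦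
    ⟨‖tangentCoordChange (𝓡 n) (S.c i) (S.c (i + 1)) (γ (S.t (i + 1)))‖, norm_nonneg _,
      fun hi ξ ↦ by
        rw [← fieldIn_trans ξ.field (S.mem_source i (Nat.lt_of_succ_lt hi) _ ⟨S.le_succ i, le_rfl⟩)
          (S.mem_source (i + 1) hi _ ⟨le_rfl, S.le_succ _⟩)]
        exact ContinuousLinearMap.le_opNorm _ _⟩
  choose A hA hA' using step
  -- The field vanishes at the start. Passing a node multiplies the bound by `A i`, and running
  -- through a piece, of length at most `1`, adds at most `R`.
  let C : ℕ → ℝ := fun i ↦ Nat.rec 1 (fun i r ↦ A i * r + 1) i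
  have hC : ∀ i, 0 ≤ C i := fun i ↦ by
    induction i with
    | zero => exact zero_le_one
    | succ i ih => exact add_nonneg (mul_nonneg (hA i) ih) zero_le_one
  refine ⟨C, hC, fun ξ R hR h ↦ ?_⟩
  have incr : ∀ i < S.N, ∀ x ∈ Icc (S.t i) (S.t (i + 1)),
      ‖fieldIn γ ξ.field (S.c i) x‖ ≤ ‖fieldIn γ ξ.field (S.c i) (S.t i)‖ + R := by
    intro i hi x hx
    have h1 := (ξ.isH1On hi).norm_sub_le (S.le_succ i) hx
    have h2 : √(S.t (i + 1) - S.t i) ≤ 1 := by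
      rw [Real.sqrt_le_one]
      linarith [S.nonneg i, S.le_one (Nat.succ_le_of_lt hi)]
    have h3 : √(∫ x in (S.t i)..(S.t (i + 1)), ‖deriv (fieldIn γ ξ.field (S.c i)) x‖ ^ 2) ≤ R :=
      Real.sqrt_le_iff.2 ⟨hR, h i hi⟩
    have h4 := h1.trans (mul_le_mul h2 h3 (Real.sqrt_nonneg _) zero_le_one)
    have h5 := norm_le_norm_add_norm_sub' (fieldIn γ ξ.field (S.c i) x)
      (fieldIn γ ξ.field (S.c i) (S.t i))
    linarith
  intro i
  induction i with
  | zero =>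
    intro hi x hx
    have h0 : fieldIn γ ξ.field (S.c 0) (S.t 0) = 0 :=
      fieldIn_eq_zero (ξ.2.2 _ (by rw [S.first]; simp)) _
    have := incr 0 hi x hx
    rw [h0, norm_zero, zero_add] at this
    exact this.trans_eq (one_mul R).symm
  | succ i ih =>
    intro hi x hx
    have h1 := incr (i + 1) hi x hx
    have h2 := ih (Nat.lt_of_succ_lt hi) (S.t (i + 1)) ⟨S.le_succ i, le_rfl⟩
    have h3 := hA' i hi ξ
    have h4 := mul_le_mul_of_nonneg_left h2 (hA i)
    have h5 : C (i + 1) * R = A i * (C i * R) + R := by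
      show (A i * C i + 1) * R = _
      ring
    linarith

/-- A Poincaré inequality along the whole curve: the `L²` norms of the coordinate derivatives
control the full norm, so convergence in `H¹₀(γ)` can be tested on derivatives alone. -/
lemma H10.exists_norm_bound (S : ChartSubdivision n γ) :
    ∃ C : ℝ, 0 ≤ C ∧ ∀ (ξ : H10 γ S) (R : ℝ), 0 ≤ R → (∀ j < S.N,
      ∫ x in (S.t j)..(S.t (j + 1)), ‖deriv (fieldIn γ ξ.field (S.c j)) x‖ ^ 2 ≤ R ^ 2) →
      ‖ξ‖ ≤ C * R := by
  obtain ⟨C, hC, h⟩ := H10.exists_sup_bound S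
  refine ⟨√(∑ i ∈ Finset.range S.N, (C i ^ 2 + 1)), Real.sqrt_nonneg _, fun ξ R hR hR' ↦ ?_⟩
  refine le_of_sq_le_sq ?_ (by positivity)
  rw [mul_pow, Real.sq_sqrt (Finset.sum_nonneg fun i _ ↦ by positivity), ξ.norm_sq_eq,
    Finset.sum_mul]
  refine Finset.sum_le_sum fun i hi ↦ ?_
  have hi' := Finset.mem_range.1 hi
  have hu := ξ.isH1On hi'
  rw [hu.sobolevSq_eq (S.le_succ i)]
  have h1 : ∫ x in (S.t i)..(S.t (i + 1)), ‖fieldIn γ ξ.field (S.c i) x‖ ^ 2 ≤ (C i * R) ^ 2 := by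
    have h2 := intervalIntegral.integral_mono_on (S.le_succ i)
      (MemLp.intervalIntegrable_norm_sq (hu.memLp (S.le_succ i)) (S.le_succ i))
      (intervalIntegrable_const (c := (C i * R) ^ 2)) fun x hx ↦
        pow_le_pow_left₀ (norm_nonneg _) (h ξ R hR hR' i hi' x hx) 2
    rw [intervalIntegral.integral_const, smul_eq_mul] at h2
    nlinarith [S.nonneg i, S.le_one (Nat.succ_le_of_lt hi'), sq_nonneg (C i * R)]
  have := hR' i hi'
  rw [mul_pow] at h1
  linarith

end Norm

end FieldsOnPieces

/-! ### Completeness of `H¹₀(γ)` -/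

section Completeness

variable {n ν : ℕ} {M : Type*} [TopologicalSpace M] [ChartedSpace (Eucl n) M]
  [IsManifold (𝓡 n) ∞ M] {γ : ℝ → M}

namespace H10

variable {S : ChartSubdivision n γ}

/-- Evaluation in a chart, as a linear map. -/
def fieldInL (S : ChartSubdivision n γ) (c : M) (t : ℝ) : H10 γ S →ₗ[ℝ] Eucl n where
  toFun ξ := fieldIn γ ξ.field c t
  map_add' ξ η := congrFun (fieldIn_add γ ξ.field η.field c) t
  map_smul' r ξ := congrFun (fieldIn_smul γ r ξ.field c) t

/-- Evaluation as a linear map. -/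
def evalL (S : ChartSubdivision n γ) (t : ℝ) : H10 γ S →ₗ[ℝ] Eucl n where
  toFun ξ := ξ.field t
  map_add' _ _ := rfl
  map_smul' _ _ := rfl

lemma continuous_fieldIn (S : ChartSubdivision n γ) {i : ℕ} (hi : i < S.N) {t : ℝ}
    (ht : t ∈ Icc (S.t i) (S.t (i + 1))) :
    Continuous (fun ξ : H10 γ S ↦ fieldIn γ ξ.field (S.c i) t) := by
  obtain ⟨C, hC, h⟩ := exists_sup_bound S
  exact AddMonoidHomClass.continuous_of_bound (fieldInL S (S.c i) t) (C i) fun ξ ↦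
    h ξ ‖ξ‖ (norm_nonneg _) (fun j hj ↦ ξ.integral_norm_deriv_sq_le hj) i hi t ht

/-- Evaluations are bounded by the sup estimate, so a Cauchy sequence of fields converges pointwise.
-/
lemma uniformContinuous_evalL (S : ChartSubdivision n γ) (t : ℝ) :
    UniformContinuous (evalL S t) := by
  by_cases ht : t ∈ Ioo (0 : ℝ) 1
  · obtain ⟨i, hi, h1, h2⟩ := S.exists_mem ht
    have hi' := Finset.mem_range.1 hi
    have hti : t ∈ Icc (S.t i) (S.t (i + 1)) := ⟨h1, h2.le⟩
    obtain ⟨C, hC, h⟩ := exists_sup_bound S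
    refine AddMonoidHomClass.uniformContinuous_of_bound _ (‖ofChart (n := n) (S.c i) (γ t)‖ * C i)
      fun ξ ↦ ?_
    have e : evalL S t ξ = ofChart (S.c i) (γ t) (fieldIn γ ξ.field (S.c i) t) :=
      (ofChart_toChart (S.mem_source i hi' t hti) (evalL S t ξ)).symm
    rw [e, mul_assoc]
    refine (ContinuousLinearMap.le_opNorm _ _).trans ?_
    gcongr
    exact h ξ ‖ξ‖ (norm_nonneg _) (fun j hj ↦ ξ.integral_norm_deriv_sq_le hj) i hi' t hti
  · refine AddMonoidHomClass.uniformContinuous_of_bound _ 0 fun ξ ↦ ?_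
    have e : evalL S t ξ = 0 := ξ.2.2 t ht
    rw [e, norm_zero, zero_mul]

lemma deriv_sub_ae (ξ η : H10 γ S) {i : ℕ} (hi : i < S.N) :
    deriv (fieldIn γ (ξ - η).field (S.c i))
      =ᵐ[volume.restrict (Icc (S.t i) (S.t (i + 1)))] fun x ↦
        deriv (fieldIn γ ξ.field (S.c i)) x - deriv (fieldIn γ η.field (S.c i)) x := by
  filter_upwards [(ξ.isH1On hi).ae_hasDerivAt (S.le_succ i),
    (η.isH1On hi).ae_hasDerivAt (S.le_succ i)] with x h1 h2
  have e : fieldIn γ (ξ - η).field (S.c i)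
      = fun t ↦ fieldIn γ ξ.field (S.c i) t - fieldIn γ η.field (S.c i) t :=
    funext fun t ↦ map_sub (fieldInL S (S.c i) t) ξ η
  rw [e]
  exact (h1.fun_sub h2).deriv

lemma norm_toLp_sub_sq {a b : ℝ} (hab : a ≤ b) {f g : ℝ → Eucl n}
    (hf : MemLp f 2 (volume.restrict (Icc a b))) (hg : MemLp g 2 (volume.restrict (Icc a b))) :
    ‖hf.toLp f - hg.toLp g‖ ^ 2 = ∫ x in a..b, ‖f x - g x‖ ^ 2 := by
  rw [← MemLp.toLp_sub, ← real_inner_self_eq_norm_sq, L2.inner_def,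
    intervalIntegral.integral_of_le hab, restrict_Ioc_eq_restrict_Icc]
  refine integral_congr_ae ?_
  filter_upwards [(hf.sub hg).coeFn_toLp] with x hx
  rw [hx, real_inner_self_eq_norm_sq]
  rfl

/-- The derivatives of a Cauchy sequence converge in `L²`. -/
lemma exists_deriv_limit {x : ℕ → H10 γ S} (hx : CauchySeq x) {i : ℕ} (hi : i < S.N) :
    ∃ d : ℝ → Eucl n, MemLp d 2 (volume.restrict (Icc (S.t i) (S.t (i + 1)))) ∧
      Tendsto (fun k ↦ ∫ r in (S.t i)..(S.t (i + 1)),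
        ‖deriv (fieldIn γ (x k).field (S.c i)) r - d r‖ ^ 2) atTop (𝓝 0) := by
  have hm := fun ξ : H10 γ S ↦ (ξ.isH1On hi).memLp_deriv (S.le_succ i)
  -- The `L²` norm of the derivative on a single piece is part of the `H¹` norm.
  have hL : LipschitzWith 1 (fun ξ : H10 γ S ↦ (hm ξ).toLp _) := by
    refine LipschitzWith.of_dist_le_mul fun ξ η ↦ ?_
    rw [NNReal.coe_one, one_mul, dist_eq_norm, dist_eq_norm]
    refine le_of_sq_le_sq ?_ (norm_nonneg _)
    rw [norm_toLp_sub_sq (S.le_succ i)]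
    refine Eq.trans_le ?_ ((ξ - η).integral_norm_deriv_sq_le hi)
    refine intervalIntegral.integral_congr_ae_restrict ?_
    rw [uIoc_of_le (S.le_succ i), restrict_Ioc_eq_restrict_Icc]
    filter_upwards [deriv_sub_ae ξ η hi] with r hr
    rw [hr]
  obtain ⟨f, hf⟩ := cauchySeq_tendsto_of_complete
    (hL.uniformContinuous.comp_cauchySeq hx)
  refine ⟨f, Lp.memLp f, ?_⟩
  have h1 := (tendsto_iff_norm_sub_tendsto_zero.1 hf).pow 2
  rw [zero_pow two_ne_zero] at h1
  refine h1.congr fun k ↦ ?_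
  rw [← norm_toLp_sub_sq (S.le_succ i) (hm (x k)) (Lp.memLp f), Lp.toLp_coeFn]
  rfl

/-- The space `H¹₀(γ)` is complete. -/
lemma completeSpace (hγ : ContMDiffOn 𝓘(ℝ, ℝ) (𝓡 n) ∞ γ (Icc 0 1)) (S : ChartSubdivision n γ) :
    CompleteSpace (H10 γ S) := by
  refine Metric.complete_of_cauchySeq_tendsto fun x hx ↦ ?_
  have hd : ∀ i, ∃ d : ℝ → Eucl n, i < S.N →
      MemLp d 2 (volume.restrict (Icc (S.t i) (S.t (i + 1)))) ∧
      Tendsto (fun k ↦ ∫ r in (S.t i)..(S.t (i + 1)),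
        ‖deriv (fieldIn γ (x k).field (S.c i)) r - d r‖ ^ 2) atTop (𝓝 0) := fun i ↦ by
    by_cases hi : i < S.N
    · exact (exists_deriv_limit hx hi).imp fun d hd _ ↦ hd
    · exact ⟨0, fun h ↦ absurd h hi⟩
  choose d hd using hd
  have hpt : ∀ t, ∃ z : Eucl n, Tendsto (fun k ↦ evalL S t (x k)) atTop (𝓝 z) := fun t ↦
    cauchySeq_tendsto_of_complete ((uniformContinuous_evalL S t).comp_cauchySeq hx)
  choose z hz using hpt
  have hzin : ∀ c t, Tendsto (fun k ↦ fieldIn γ (x k).field c t) atTop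
      (𝓝 (fieldIn (n := n) γ z c t)) := fun c t ↦
    ((toChart (n := n) c (γ t)).continuous.tendsto _).comp (hz t)
  -- Passage to the limit in the fundamental theorem of calculus: pointwise in the values, in `L²`
  -- and therefore under the integral in the derivatives. The pointwise limit `z` thus has weak
  -- derivative `d i` on the piece `i`.
  have hzd : ∀ i < S.N, ∀ s ∈ Icc (S.t i) (S.t (i + 1)), fieldIn (n := n) γ z (S.c i) s
      = fieldIn (n := n) γ z (S.c i) (S.t i) + ∫ r in (S.t i)..s, d i r := by
    intro i hi s hs
    have hle := S.le_succ i
    have hm := fun k ↦ ((x k).isH1On hi).memLp_deriv hle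
    refine tendsto_nhds_unique (hzin (S.c i) s) ?_
    have h1 : ∀ k, fieldIn γ (x k).field (S.c i) s = fieldIn γ (x k).field (S.c i) (S.t i)
        + ∫ r in (S.t i)..s, deriv (fieldIn γ (x k).field (S.c i)) r := fun k ↦
      ((x k).isH1On hi).eq_add_integral_deriv hle hs
    simp only [h1]
    refine (hzin _ _).add ?_
    rw [tendsto_iff_norm_sub_tendsto_zero]
    have h2 : Tendsto (fun k ↦ √(S.t (i + 1) - S.t i) * √(∫ r in (S.t i)..(S.t (i + 1)),
        ‖deriv (fieldIn γ (x k).field (S.c i)) r - d i r‖ ^ 2)) atTop (𝓝 0) := by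
      have := ((Real.continuous_sqrt.tendsto 0).comp (hd i hi).2).const_mul (√(S.t (i + 1) - S.t i))
      simpa using this
    refine squeeze_zero (fun _ ↦ norm_nonneg _) (fun k ↦ ?_) h2
    rw [← intervalIntegral.integral_sub (memLp_intervalIntegrable (hm k) hs)
      (memLp_intervalIntegrable (hd i hi).1 hs)]
    exact norm_integral_le_sqrt_mul_sqrt hle ((hm k).sub (hd i hi).1) hs
  have hmem : (z : FieldAlong (n := n) γ) ∈ h10Submodule n γ := by
    refine ⟨S.isH1Field_of_pieces hγ fun i hi ↦ ⟨d i, (hd i hi).1, hzd i hi⟩, fun t ht ↦ ?_⟩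
    have h0 : ∀ k, (0 : Eucl n) = evalL S t (x k) := fun k ↦ ((x k).2.2 t ht).symm
    exact (tendsto_nhds_unique (hz t) (tendsto_const_nhds.congr h0) : z t = (0 : Eucl n))
  let ζ : H10 γ S := ⟨z, hmem⟩
  refine ⟨ζ, ?_⟩
  obtain ⟨C, hC, hCn⟩ := exists_norm_bound S
  rw [tendsto_iff_norm_sub_tendsto_zero]
  -- The squared `L²` distance of the derivatives to their limit on each piece; by
  -- `exists_norm_bound` the root of their sum controls the distance in norm.
  let e : ℕ → ℕ → ℝ := fun k i ↦ ∫ r in (S.t i)..(S.t (i + 1)),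
    ‖deriv (fieldIn γ (x k).field (S.c i)) r - d i r‖ ^ 2
  have he : ∀ k i, 0 ≤ e k i := fun k i ↦
    integral_norm_sq_nonneg (S.le_succ i) fun r ↦ deriv (fieldIn γ (x k).field (S.c i)) r - d i r
  have h0 : Tendsto (fun k ↦ C * √(∑ i ∈ Finset.range S.N, e k i)) atTop (𝓝 0) := by
    have h1 : Tendsto (fun k ↦ ∑ i ∈ Finset.range S.N, e k i) atTop
        (𝓝 (∑ i ∈ Finset.range S.N, 0)) :=
      tendsto_finsetSum _ fun i hi ↦ (hd i (Finset.mem_range.1 hi)).2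
    rw [Finset.sum_const_zero] at h1
    have := ((Real.continuous_sqrt.tendsto 0).comp h1).const_mul C
    simpa using this
  refine squeeze_zero (fun _ ↦ norm_nonneg _) (fun k ↦ ?_) h0
  refine hCn _ _ (Real.sqrt_nonneg _) fun j hj ↦ ?_
  rw [Real.sq_sqrt (Finset.sum_nonneg fun i _ ↦ he k i)]
  refine Eq.trans_le ?_ (Finset.single_le_sum (fun i _ ↦ he k i) (Finset.mem_range.2 hj))
  refine intervalIntegral.integral_congr_ae_restrict ?_
  rw [uIoc_of_le (S.le_succ j), restrict_Ioc_eq_restrict_Icc]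
  filter_upwards [deriv_sub_ae (x k) ζ hj,
    IsH1On.deriv_ae_eq (hd j hj).1 (S.le_succ j) (hzd j hj)] with r hr hr'
  rw [hr]
  have : deriv (fieldIn γ ζ.field (S.c j)) r = d j r := hr'.deriv
  rw [this]

end H10

end Completeness

/-! ### The index form on fields as a sum of local index forms -/

section IndexFormOnFields

variable {n ν : ℕ} {M : Type*} [TopologicalSpace M] [ChartedSpace (Eucl n) M]
  [IsManifold (𝓡 n) ∞ M] {γ : ℝ → M} {g : SemiRiemannianMetric n ν M} {V : ℝ → M → ℝ}

/-- The integrand of the index form in the chart at `c`. -/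
abbrev indexDensityIn (g : SemiRiemannianMetric n ν M) (V : ℝ → M → ℝ) (γ : ℝ → M) (c : M) :
    (ℝ → Eucl n) → (ℝ → Eucl n) → ℝ → ℝ :=
  indexDensity (fun t ↦ metricIn g c (curveIn c γ t)) (connIn g γ c) (tidalIn g V γ c)

variable {a b : ℝ} {c : M} {ξ η : FieldAlong (n := n) γ}

/-- Coordinate expressions of `H¹` fields are differentiable almost everywhere, and the values of
the covariant derivative on the remaining null set are irrelevant. -/
lemma hessianDensity_ae_eq (hγ : ContMDiffOn 𝓘(ℝ, ℝ) (𝓡 n) ∞ γ (Icc 0 1))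
    (hV : IsSmoothPotential n V) (hab : a ≤ b) (hc : Icc a b ⊆ chartDom n c γ)
    (hξ : IsH1On a b (fieldIn γ ξ c)) (hη : IsH1On a b (fieldIn γ η c)) :
    hessianDensity g V γ ξ η =ᵐ[volume.restrict (Icc a b)]
      indexDensityIn g V γ c (fieldIn γ ξ c) (fieldIn γ η c) := by
  filter_upwards [hξ.ae_hasDerivAt hab, hη.ae_hasDerivAt hab, ae_restrict_mem measurableSet_Icc]
    with x h1 h2 hx
  exact hessianDensity_eq hγ hV (hc hx) h1.hasDerivWithinAt h2.hasDerivWithinAt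

lemma intervalIntegrable_indexDensityIn (hγ : ContMDiffOn 𝓘(ℝ, ℝ) (𝓡 n) ∞ γ (Icc 0 1))
    (hV : IsSmoothPotential n V) (hab : a ≤ b) (hc : Icc a b ⊆ chartDom n c γ) {u w : ℝ → Eucl n}
    (hu : IsH1On a b u) (hw : IsH1On a b w) :
    IntervalIntegrable (indexDensityIn g V γ c u w) volume a b :=
  intervalIntegrable_indexDensity hab ((contDiffOn_metricIn_curveIn hγ c).continuousOn.mono hc)
    ((contDiffOn_connIn hγ c).continuousOn.mono hc)
    ((contDiffOn_tidalIn hγ hV c).continuousOn.mono hc) hu hw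

lemma intervalIntegrable_hessianDensity_of_chart (hγ : ContMDiffOn 𝓘(ℝ, ℝ) (𝓡 n) ∞ γ (Icc 0 1))
    (hV : IsSmoothPotential n V) (hab : a ≤ b) (hc : Icc a b ⊆ chartDom n c γ)
    (hξ : IsH1On a b (fieldIn γ ξ c)) (hη : IsH1On a b (fieldIn γ η c)) :
    IntervalIntegrable (hessianDensity g V γ ξ η) volume a b := by
  refine (intervalIntegrable_indexDensityIn (g := g) hγ hV hab hc hξ hη).congr_ae ?_
  rw [uIoc_of_le hab, restrict_Ioc_eq_restrict_Icc]
  exact (hessianDensity_ae_eq hγ hV hab hc hξ hη).symm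

lemma integral_hessianDensity_of_chart (hγ : ContMDiffOn 𝓘(ℝ, ℝ) (𝓡 n) ∞ γ (Icc 0 1))
    (hV : IsSmoothPotential n V) (hab : a ≤ b) (hc : Icc a b ⊆ chartDom n c γ)
    (hξ : IsH1On a b (fieldIn γ ξ c)) (hη : IsH1On a b (fieldIn γ η c)) :
    ∫ x in a..b, hessianDensity g V γ ξ η x
      = ∫ x in a..b, indexDensityIn g V γ c (fieldIn γ ξ c) (fieldIn γ η c) x := by
  refine intervalIntegral.integral_congr_ae_restrict ?_
  rw [uIoc_of_le hab, restrict_Ioc_eq_restrict_Icc]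
  exact hessianDensity_ae_eq hγ hV hab hc hξ hη

variable {S : ChartSubdivision n γ}

lemma intervalIntegrable_hessianDensity (hγ : ContMDiffOn 𝓘(ℝ, ℝ) (𝓡 n) ∞ γ (Icc 0 1))
    (hV : IsSmoothPotential n V) (ξ η : H10 γ S) :
    IntervalIntegrable (hessianDensity g V γ ξ.field η.field) volume 0 1 := by
  have h := IntervalIntegrable.trans_iterate (μ := volume)
    (f := hessianDensity g V γ ξ.field η.field) (a := S.t) (n := S.N) fun k hk ↦
    intervalIntegrable_hessianDensity_of_chart hγ hV (S.le_succ k) (S.subset_chartDom hk)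
      (ξ.isH1On hk) (η.isH1On hk)
  rwa [S.first, S.last] at h

lemma hessianForm_eq_sum (hγ : ContMDiffOn 𝓘(ℝ, ℝ) (𝓡 n) ∞ γ (Icc 0 1))
    (hV : IsSmoothPotential n V) (ξ η : H10 γ S) :
    hessianForm g V γ ξ.field η.field = ∑ i ∈ Finset.range S.N, ∫ x in (S.t i)..(S.t (i + 1)),
      indexDensityIn g V γ (S.c i) (fieldIn γ ξ.field (S.c i)) (fieldIn γ η.field (S.c i)) x := by
  have h := intervalIntegral.sum_integral_adjacent_intervals (μ := volume)
    (f := hessianDensity g V γ ξ.field η.field) (a := S.t) (n := S.N) fun k hk ↦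
    intervalIntegrable_hessianDensity_of_chart hγ hV (S.le_succ k) (S.subset_chartDom hk)
      (ξ.isH1On hk) (η.isH1On hk)
  rw [S.first, S.last] at h
  rw [hessianForm, ← h]
  refine Finset.sum_congr rfl fun i hi ↦ ?_
  have hi' := Finset.mem_range.1 hi
  exact integral_hessianDensity_of_chart hγ hV (S.le_succ i) (S.subset_chartDom hi')
    (ξ.isH1On hi') (η.isH1On hi')

end IndexFormOnFields

/-! ### The index form as a bounded symmetric bilinear form, and its values on test fields -/

section IndexOperator

variable {n ν : ℕ} {M : Type*} [TopologicalSpace M] [ChartedSpace (Eucl n) M]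
  [IsManifold (𝓡 n) ∞ M] {γ : ℝ → M} {g : SemiRiemannianMetric n ν M} {V : ℝ → M → ℝ}
  {S : ChartSubdivision n γ}

lemma hessianForm_add_left (hγ : ContMDiffOn 𝓘(ℝ, ℝ) (𝓡 n) ∞ γ (Icc 0 1))
    (hV : IsSmoothPotential n V) (ξ ζ η : H10 γ S) :
    hessianForm g V γ (ξ + ζ).field η.field
      = hessianForm g V γ ξ.field η.field + hessianForm g V γ ζ.field η.field := by
  rw [hessianForm_eq_sum hγ hV, hessianForm_eq_sum hγ hV, hessianForm_eq_sum hγ hV,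
    ← Finset.sum_add_distrib]
  refine Finset.sum_congr rfl fun i hi ↦ ?_
  have hi' := Finset.mem_range.1 hi
  have hle := S.le_succ i
  have hc := S.subset_chartDom hi'
  rw [← intervalIntegral.integral_add
    (intervalIntegrable_indexDensityIn hγ hV hle hc (ξ.isH1On hi') (η.isH1On hi'))
    (intervalIntegrable_indexDensityIn hγ hV hle hc (ζ.isH1On hi') (η.isH1On hi'))]
  refine intervalIntegral.integral_congr_ae_restrict ?_
  rw [uIoc_of_le hle, restrict_Ioc_eq_restrict_Icc]
  filter_upwards [(ξ.isH1On hi').ae_hasDerivAt hle, (ζ.isH1On hi').ae_hasDerivAt hle] with x h1 h2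
  have e : fieldIn γ (ξ + ζ).field (S.c i)
      = fun t ↦ fieldIn γ ξ.field (S.c i) t + fieldIn γ ζ.field (S.c i) t :=
    fieldIn_add γ ξ.field ζ.field (S.c i)
  simp only [indexDensity]
  rw [e, (h1.fun_add h2).deriv]
  simp only [map_add, add_apply]
  ring

lemma hessianForm_smul_left (hγ : ContMDiffOn 𝓘(ℝ, ℝ) (𝓡 n) ∞ γ (Icc 0 1))
    (hV : IsSmoothPotential n V) (r : ℝ) (ξ η : H10 γ S) :
    hessianForm g V γ (r • ξ).field η.field = r * hessianForm g V γ ξ.field η.field := by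
  rw [hessianForm_eq_sum hγ hV, hessianForm_eq_sum hγ hV, Finset.mul_sum]
  refine Finset.sum_congr rfl fun i hi ↦ ?_
  rw [← intervalIntegral.integral_const_mul]
  refine intervalIntegral.integral_congr fun x _ ↦ ?_
  have e : fieldIn γ (r • ξ).field (S.c i) = fun t ↦ r • fieldIn γ ξ.field (S.c i) t :=
    fieldIn_smul γ r ξ.field (S.c i)
  have hd : deriv (fun t ↦ r • fieldIn γ ξ.field (S.c i) t) x
      = r • deriv (fieldIn γ ξ.field (S.c i)) x := deriv_fun_const_smul_field r _
  simp only [indexDensity]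
  rw [e, hd]
  simp only [map_smul, ← smul_add, FunLike.coe_smul, Pi.smul_apply, smul_eq_mul]
  ring

lemma metricIn_curveIn_symm {c : M} {t : ℝ} (hc : t ∈ chartDom n c γ) (u v : Eucl n) :
    metricIn g c (curveIn c γ t) u v = metricIn g c (curveIn c γ t) v u :=
  (isMetricOn_metricIn g c).symm _ (curveIn_mem_target hc) u v

lemma hessianForm_comm (hγ : ContMDiffOn 𝓘(ℝ, ℝ) (𝓡 n) ∞ γ (Icc 0 1))
    (hV : IsSmoothPotential n V) (ξ η : H10 γ S) :
    hessianForm g V γ ξ.field η.field = hessianForm g V γ η.field ξ.field := by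
  rw [hessianForm_eq_sum hγ hV, hessianForm_eq_sum hγ hV]
  refine Finset.sum_congr rfl fun i hi ↦ ?_
  refine intervalIntegral.integral_congr fun x hx ↦ ?_
  rw [uIcc_of_le (S.le_succ i)] at hx
  have hc := S.subset_chartDom (Finset.mem_range.1 hi) hx
  exact congrArg₂ (· - ·) (metricIn_curveIn_symm hc _ _) (tidalIn_symm hV hc _ _)

lemma exists_hessianForm_bound (hγ : ContMDiffOn 𝓘(ℝ, ℝ) (𝓡 n) ∞ γ (Icc 0 1))
    (hV : IsSmoothPotential n V) (g : SemiRiemannianMetric n ν M) (S : ChartSubdivision n γ) :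
    ∃ C, ∀ ξ η : H10 γ S, |hessianForm g V γ ξ.field η.field| ≤ C * ‖ξ‖ * ‖η‖ := by
  have h : ∀ i, ∃ C, 0 ≤ C ∧ (i < S.N → ∀ ξ η : H10 γ S, |∫ x in (S.t i)..(S.t (i + 1)),
      indexDensityIn g V γ (S.c i) (fieldIn γ ξ.field (S.c i)) (fieldIn γ η.field (S.c i)) x|
        ≤ C * (‖ξ‖ * ‖η‖)) := by
    intro i
    by_cases hi : i < S.N
    · have hc := S.subset_chartDom hi
      obtain ⟨C, hC, hC'⟩ := exists_indexDensity_bound (S.le_succ i)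
        ((contDiffOn_metricIn_curveIn (g := g) hγ (S.c i)).continuousOn.mono hc)
        ((contDiffOn_connIn (g := g) hγ (S.c i)).continuousOn.mono hc)
        ((contDiffOn_tidalIn (g := g) hγ hV (S.c i)).continuousOn.mono hc)
      refine ⟨C, hC.le, fun _ ξ η ↦ (hC' _ _ (ξ.isH1On hi) (η.isH1On hi)).trans ?_⟩
      gcongr
      · exact Real.sqrt_le_iff.2 ⟨norm_nonneg _, ξ.sobolevSq_le hi⟩
      · exact Real.sqrt_le_iff.2 ⟨norm_nonneg _, η.sobolevSq_le hi⟩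
    · exact ⟨0, le_rfl, fun h ↦ absurd h hi⟩
  choose C hC hC' using h
  refine ⟨∑ i ∈ Finset.range S.N, C i, fun ξ η ↦ ?_⟩
  rw [hessianForm_eq_sum hγ hV, mul_assoc, Finset.sum_mul]
  exact (Finset.abs_sum_le_sum_abs _ _).trans
    (Finset.sum_le_sum fun i hi ↦ hC' i (Finset.mem_range.1 hi) ξ η)

/-- The index form as a bounded bilinear form. -/
lemma exists_indexForm (hγ : ContMDiffOn 𝓘(ℝ, ℝ) (𝓡 n) ∞ γ (Icc 0 1))
    (hV : IsSmoothPotential n V) (g : SemiRiemannianMetric n ν M) (S : ChartSubdivision n γ) :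
    ∃ b : H10 γ S →L[ℝ] StrongDual ℝ (H10 γ S),
      ∀ ξ η, b ξ η = hessianForm g V γ ξ.field η.field := by
  obtain ⟨C, hC⟩ := exists_hessianForm_bound hγ hV g S
  let B : H10 γ S →ₗ[ℝ] H10 γ S →ₗ[ℝ] ℝ :=
    LinearMap.mk₂ ℝ (fun ξ η ↦ hessianForm g V γ ξ.field η.field)
      (fun ξ ζ η ↦ hessianForm_add_left hγ hV ξ ζ η)
      (fun r ξ η ↦ hessianForm_smul_left hγ hV r ξ η)
      -- Linearity in the second argument follows from linearity in the first by symmetry.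
      (fun ξ η ζ ↦ by
        rw [hessianForm_comm hγ hV, hessianForm_add_left hγ hV, hessianForm_comm hγ hV η,
          hessianForm_comm hγ hV ζ])
      (fun r ξ η ↦ by
        rw [hessianForm_comm hγ hV, hessianForm_smul_left hγ hV, hessianForm_comm hγ hV η,
          smul_eq_mul])
  exact ⟨B.mkContinuous₂ C hC, fun ξ η ↦ rfl⟩

section LocalTest

variable {a b : ℝ} {c : M} {w : ℝ → Eucl n}

lemma covDeriv_eq_zero (hγ : ContMDiffOn 𝓘(ℝ, ℝ) (𝓡 n) ∞ γ (Icc 0 1))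
    {η : FieldAlong (n := n) γ} {t : ℝ} (ht : t ∈ Icc (0 : ℝ) 1) (h : ∀ᶠ s in 𝓝 t, η s = 0) :
    covDeriv g γ η t = 0 := by
  have hc : t ∈ chartDom n (γ t) γ := ⟨ht, mem_source_self _⟩
  have hd : HasDerivWithinAt (fieldIn γ η (γ t)) 0 (Icc 0 1) t :=
    ((hasDerivAt_const t (0 : Eucl n)).congr_of_eventuallyEq
      (h.mono fun s hs ↦ fieldIn_eq_zero hs _)).hasDerivWithinAt
  have h1 := fieldIn_covDeriv g hγ hc hd
  have h2 : fieldIn γ η (γ t) t = 0 := fieldIn_eq_zero h.self_of_nhds _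
  have h3 : chr (metricIn g (γ t)) (curveIn (γ t) γ t) (velIn (γ t) γ t) (0 : Eucl n) = 0 :=
    map_zero (chrL (metricIn g (γ t)) (curveIn (γ t) γ t) (velIn (γ t) γ t))
  rw [h2, h3, add_zero] at h1
  exact (toChart_self (γ t) (covDeriv g γ η t)).symm.trans h1

lemma hessianDensity_eq_zero (hγ : ContMDiffOn 𝓘(ℝ, ℝ) (𝓡 n) ∞ γ (Icc 0 1))
    (ξ : FieldAlong (n := n) γ)
    {η : FieldAlong (n := n) γ} {t : ℝ} (ht : t ∈ Icc (0 : ℝ) 1) (h : ∀ᶠ s in 𝓝 t, η s = 0) :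
    hessianDensity g V γ ξ η t = 0 := by
  have h1 : metricAt g (γ t) (covDeriv g γ ξ t) (covDeriv g γ η t) = 0 :=
    (congrArg _ (covDeriv_eq_zero hγ ht h)).trans (map_zero _)
  have h2 : metricAt g (γ t) (jacobiPotential g V γ ξ t) (η t) = 0 :=
    (congrArg _ h.self_of_nhds).trans (map_zero _)
  exact (congrArg₂ (· - ·) h1 h2).trans (sub_zero 0)

/-- The index form against a field supported in the domain of a chart. -/
lemma hessianForm_localField (hγ : ContMDiffOn 𝓘(ℝ, ℝ) (𝓡 n) ∞ γ (Icc 0 1))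
    (hV : IsSmoothPotential n V) (ξ : H10 γ S) (ha : 0 ≤ a) (hab : a ≤ b) (hb : b ≤ 1)
    (hc : ∀ t ∈ Icc a b, γ t ∈ (chartAt (Eucl n) c).source) (hw : IsH1On a b w)
    (hwa : w a = 0) (hwb : w b = 0) :
    hessianForm g V γ ξ.field (localField γ c a b w)
      = ∫ x in a..b, indexDensityIn g V γ c (fieldIn γ ξ.field c) w x := by
  have hcd := Icc_subset_chartDom ha hb hc
  have hη := localField_mem hγ ha hab hb hc hw hwa hwb
  let η : H10 γ S := ⟨_, hη⟩
  have hint : IntervalIntegrable (hessianDensity g V γ ξ.field (localField γ c a b w)) volume 0 1 :=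
    intervalIntegrable_hessianDensity hγ hV ξ η
  -- Off `[a, b]` the test field vanishes in a neighbourhood of each point, hence so does its
  -- covariant derivative.
  have hz : ∀ p q, 0 ≤ p → p ≤ q → q ≤ 1 → (∀ t ∈ Ioo p q, t ∉ Icc a b) →
      ∫ x in p..q, hessianDensity g V γ ξ.field (localField γ c a b w) x = 0 := by
    intro p q hp hpq hq h
    refine (intervalIntegral.integral_congr_ae_restrict (g := fun _ ↦ (0 : ℝ)) ?_).trans (by simp)
    rw [uIoc_of_le hpq, ← restrict_Ioo_eq_restrict_Ioc]
    filter_upwards [ae_restrict_mem measurableSet_Ioo] with x hx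
    refine hessianDensity_eq_zero hγ _ ⟨hp.trans hx.1.le, hx.2.le.trans hq⟩ ?_
    filter_upwards [isOpen_Ioo.mem_nhds hx] with y hy
    exact localField_eq_zero hwa hwb fun hy' ↦ h y hy (Ioo_subset_Icc_self hy')
  have hsub : ∀ p q, 0 ≤ p → p ≤ q → q ≤ 1 →
      IntervalIntegrable (hessianDensity g V γ ξ.field (localField γ c a b w)) volume p q :=
    fun p q hp hpq hq ↦ hint.mono_set (by
      rw [uIcc_of_le hpq, uIcc_of_le zero_le_one]
      exact Icc_subset_Icc hp hq)
  rw [hessianForm, ← intervalIntegral.integral_add_adjacent_intervals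
      (hsub 0 a le_rfl ha (hab.trans hb)) (hsub a 1 ha (hab.trans hb) le_rfl),
    ← intervalIntegral.integral_add_adjacent_intervals
      (hsub a b ha hab hb) (hsub b 1 (ha.trans hab) hb le_rfl),
    hz 0 a le_rfl ha (hab.trans hb) fun t ht h ↦ absurd ht.2 (not_lt.2 h.1),
    hz b 1 (ha.trans hab) hb le_rfl fun t ht h ↦ absurd ht.1 (not_lt.2 h.2), zero_add, add_zero,
    integral_hessianDensity_of_chart hγ hV hab hcd (ξ := ξ.field) (ξ.2.1 c a b ha hab hb hc)
      (hη.1 c a b ha hab hb hc)]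
  refine intervalIntegral.integral_congr_ae_restrict ?_
  rw [uIoc_of_le hab, ← restrict_Ioo_eq_restrict_Ioc]
  filter_upwards [ae_restrict_mem measurableSet_Ioo] with x hx
  have h1 : fieldIn γ (localField γ c a b w) c =ᶠ[𝓝 x] w := by
    filter_upwards [Icc_mem_nhds hx.1 hx.2] with y hy using fieldIn_localField hc hy
  simp only [indexDensity]
  rw [h1.deriv_eq, h1.eq_of_nhds]

/-- When the support lies in the piece `i` and the chart is that of the piece, the other pieces
contribute nothing to the norm, so the norm of the test field is the plain `H¹` norm of `w`. -/
lemma norm_localField_sq {i : ℕ} (hi : i < S.N)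
    (ha : S.t i ≤ a) (hab : a ≤ b) (hb : b ≤ S.t (i + 1)) (hwa : w a = 0) (hwb : w b = 0)
    (η : H10 γ S) (hη : η.field = localField γ (S.c i) a b w) :
    ‖η‖ ^ 2 = sobolevSq a b w := by
  have hz : ∀ t ∉ Ioo a b, ∀ c, fieldIn γ η.field c t = 0 := fun t ht c ↦
    fieldIn_eq_zero ((congrFun hη t).trans (localField_eq_zero hwa hwb ht)) c
  have hc : ∀ t ∈ Icc a b, γ t ∈ (chartAt (Eucl n) (S.c i)).source := fun t ht ↦
    S.mem_source i hi t ⟨ha.trans ht.1, ht.2.trans hb⟩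
  rw [η.norm_sq_eq, Finset.sum_eq_single_of_mem i (Finset.mem_range.2 hi)]
  · have hu := η.isH1On hi
    rw [← sobolevSq_add_adjacent ha (hab.trans hb) hu,
      ← sobolevSq_add_adjacent hab hb (hu.mono ha (hab.trans hb) le_rfl),
      sobolevSq_eq_zero ha fun x hx ↦ hz x (fun h ↦ absurd h.1 (not_lt.2 hx.2)) _,
      sobolevSq_eq_zero hb fun x hx ↦ hz x (fun h ↦ absurd h.2 (not_lt.2 hx.1)) _,
      zero_add, add_zero]
    exact sobolevSq_congr hab fun t ht ↦
      (congrArg (fun ζ ↦ fieldIn γ ζ (S.c i) t) hη).trans (fieldIn_localField hc ht)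
  · intro j _ hji
    refine sobolevSq_eq_zero (S.le_succ j) fun x hx ↦ hz x (fun h ↦ ?_) _
    rcases lt_or_gt_of_ne hji with hlt | hlt
    · exact absurd (hx.2.trans ((S.mono hlt).trans ha)) (not_le.2 h.1)
    · exact absurd (hb.trans ((S.mono hlt).trans hx.1)) (not_le.2 h.2)

end LocalTest

end IndexOperator

/-! ### The lower bound on a subspace of finite codimension -/

section Fredholmness

variable {n ν : ℕ} {M : Type*} [TopologicalSpace M] [ChartedSpace (Eucl n) M]
  [IsManifold (𝓡 n) ∞ M] {γ : ℝ → M} {g : SemiRiemannianMetric n ν M} {V : ℝ → M → ℝ}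
  {S : ChartSubdivision n γ}

/-- The points of the subdivision of `[a, b]` into `m` intervals of equal length. -/
def gridPoint (a b : ℝ) (m j : ℕ) : ℝ := a + j / m * (b - a)

section Grid

variable {a b : ℝ} {m : ℕ}

lemma gridPoint_zero : gridPoint a b m 0 = a := by simp [gridPoint]

lemma gridPoint_last (hm : 0 < m) : gridPoint a b m m = b := by
  have : (m : ℝ) ≠ 0 := by positivity
  simp [gridPoint, div_self this]

lemma gridPoint_mono (hab : a ≤ b) : Monotone (gridPoint a b m) := fun i j h ↦ by
  have : (i : ℝ) ≤ j := by exact_mod_cast h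
  have := sub_nonneg.2 hab
  unfold gridPoint
  gcongr

lemma gridPoint_succ_sub (j : ℕ) : gridPoint a b m (j + 1) - gridPoint a b m j = (b - a) / m := by
  simp only [gridPoint]
  push_cast
  ring

lemma le_gridPoint (hab : a ≤ b) (j : ℕ) : a ≤ gridPoint a b m j :=
  gridPoint_zero.symm.trans_le (gridPoint_mono hab (Nat.zero_le j))

lemma gridPoint_le (hab : a ≤ b) (hm : 0 < m) {j : ℕ} (hj : j ≤ m) : gridPoint a b m j ≤ b :=
  (gridPoint_mono hab hj).trans_eq (gridPoint_last hm)

lemma sum_sobolevSq_grid (hab : a ≤ b) (hm : 0 < m) {u : ℝ → Eucl n} (hu : IsH1On a b u) :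
    ∑ j ∈ Finset.range m, sobolevSq (gridPoint a b m j) (gridPoint a b m (j + 1)) u
      = sobolevSq a b u := by
  have h := intervalIntegral.sum_integral_adjacent_intervals (μ := volume)
    (f := fun x ↦ ⟪u x, u x⟫_ℝ + ⟪deriv u x, deriv u x⟫_ℝ) (a := gridPoint a b m) (n := m)
    fun j hj ↦ by
      have hle := gridPoint_mono (m := m) hab (Nat.le_succ j)
      have h1 := hu.mono (le_gridPoint hab j) hle (gridPoint_le hab hm hj)
      exact h1.inner_integrable hle h1
  rw [gridPoint_zero, gridPoint_last hm] at h
  exact h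

end Grid

/-- On each piece, short subintervals carry test fields on which the index form controls the
`H¹` norm. -/
lemma exists_grid (hγ : ContMDiffOn 𝓘(ℝ, ℝ) (𝓡 n) ∞ γ (Icc 0 1))
    (hV : IsSmoothPotential n V) (g : SemiRiemannianMetric n ν M) {i : ℕ} (hi : i < S.N) :
    ∃ m : ℕ, 0 < m ∧ ∃ C : ℝ, 0 ≤ C ∧ ∀ ξ : H10 γ S,
      (∀ j ≤ m, fieldIn γ ξ.field (S.c i) (gridPoint (S.t i) (S.t (i + 1)) m j) = 0) →
      ∀ j < m, ∃ η : H10 γ S, ‖η‖ ≤ C * ‖ξ‖ ∧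
        sobolevSq (gridPoint (S.t i) (S.t (i + 1)) m j) (gridPoint (S.t i) (S.t (i + 1)) m (j + 1))
          (fieldIn γ ξ.field (S.c i)) ≤ 4 * hessianForm g V γ ξ.field η.field := by
  have hc := S.subset_chartDom hi
  have hle := S.le_succ i
  obtain ⟨δ, hδ, C, hC, h⟩ := exists_indexDensity_coercive
    ((contDiffOn_metricIn_curveIn (g := g) hγ (S.c i)).continuousOn.mono hc)
    ((contDiffOn_connIn (g := g) hγ (S.c i)).continuousOn.mono hc)
    ((contDiffOn_tidalIn (g := g) hγ hV (S.c i)).continuousOn.mono hc)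
    (fun t ht u v ↦ metricIn_curveIn_symm (hc ht) u v)
    (fun t ht ↦ (isMetricOn_metricIn g (S.c i)).invertible _ (curveIn_mem_target (hc ht)))
  -- Pieces have length at most `1`, so `m > 1 / δ` intervals of equal length are short enough for
  -- coercivity.
  obtain ⟨m, hm⟩ := exists_nat_gt (1 / δ)
  have hm0 : (0 : ℝ) < m := (by positivity : 0 < 1 / δ).trans hm
  have hm0' : 0 < m := by exact_mod_cast hm0
  refine ⟨m, hm0', C, hC.le, fun ξ hξ j hj ↦ ?_⟩
  set s := gridPoint (S.t i) (S.t (i + 1)) m j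
  set t := gridPoint (S.t i) (S.t (i + 1)) m (j + 1)
  have hst : s ≤ t := gridPoint_mono hle (Nat.le_succ j)
  have has : S.t i ≤ s := le_gridPoint hle j
  have htb : t ≤ S.t (i + 1) := gridPoint_le hle hm0' hj
  have hδst : t - s ≤ δ := by
    have h1 : t - s = (S.t (i + 1) - S.t i) / m := gridPoint_succ_sub j
    rw [h1, div_le_iff₀ hm0]
    have h2 := (div_lt_iff₀ hδ).1 hm
    linarith [S.nonneg i, S.le_one (Nat.succ_le_of_lt hi)]
  obtain ⟨J, hJ, hJ'⟩ := h s t has hst htb hδst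
  have hu := (ξ.isH1On hi).mono has hst htb
  have hJu : IsH1On s t (fun x ↦ J (fieldIn γ ξ.field (S.c i) x)) :=
    hu.clm_apply hst (T := fun _ ↦ J) (T' := fun _ ↦ 0) (fun x _ ↦ hasDerivWithinAt_const _ _ _)
      continuousOn_const
  have hus := hξ j hj.le
  have hut := hξ (j + 1) hj
  have hws : J (fieldIn γ ξ.field (S.c i) s) = 0 := by rw [hus, map_zero]
  have hwt : J (fieldIn γ ξ.field (S.c i) t) = 0 := by rw [hut, map_zero]
  have hsrc : ∀ x ∈ Icc s t, γ x ∈ (chartAt (Eucl n) (S.c i)).source := fun x hx ↦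
    S.mem_source i hi x ⟨has.trans hx.1, hx.2.trans htb⟩
  have hs0 : 0 ≤ s := (S.nonneg i).trans has
  have ht1 : t ≤ 1 := htb.trans (S.le_one (Nat.succ_le_of_lt hi))
  -- The test field is `J ξ` on one grid interval; it extends by zero because `ξ` vanishes at both
  -- grid points.
  let η : H10 γ S := ⟨_, localField_mem hγ hs0 hst ht1 hsrc hJu hws hwt⟩
  refine ⟨η, ?_, ?_⟩
  · refine le_of_sq_le_sq ?_ (by positivity)
    rw [norm_localField_sq hi has hst htb hws hwt η rfl, mul_pow]
    refine (sobolevSq_clm_le hst hu J hJ).trans ?_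
    gcongr
    exact (sobolevSq_mono has hst htb (ξ.isH1On hi)).trans (ξ.sobolevSq_le hi)
  · have e : hessianForm g V γ ξ.field η.field = _ :=
      hessianForm_localField hγ hV ξ hs0 hst ht1 hsrc hJu hws hwt
    rw [e]
    exact hJ' _ hu hus

/-- The index form is bounded below on a closed subspace of finite codimension. -/
lemma exists_subspace_bound (hγ : ContMDiffOn 𝓘(ℝ, ℝ) (𝓡 n) ∞ γ (Icc 0 1))
    (hV : IsSmoothPotential n V) {b : H10 γ S →L[ℝ] StrongDual ℝ (H10 γ S)}
    (hb : ∀ ξ η, b ξ η = hessianForm g V γ ξ.field η.field) :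
    ∃ Z : Submodule ℝ (H10 γ S), IsClosed (Z : Set (H10 γ S)) ∧ FiniteDimensional ℝ (H10 γ S ⧸ Z) ∧
      ∃ c > 0, ∀ z ∈ Z, c * ‖z‖ ≤ ‖b z‖ := by
  have h : ∀ i, ∃ m : ℕ, ∃ C : ℝ, 0 ≤ C ∧ (i < S.N → 0 < m ∧ ∀ ξ : H10 γ S,
      (∀ j ≤ m, fieldIn γ ξ.field (S.c i) (gridPoint (S.t i) (S.t (i + 1)) m j) = 0) →
      ∀ j < m, ∃ η : H10 γ S, ‖η‖ ≤ C * ‖ξ‖ ∧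
        sobolevSq (gridPoint (S.t i) (S.t (i + 1)) m j) (gridPoint (S.t i) (S.t (i + 1)) m (j + 1))
          (fieldIn γ ξ.field (S.c i)) ≤ 4 * b ξ η) := by
    intro i
    by_cases hi : i < S.N
    · obtain ⟨m, hm, C, hC, h⟩ := exists_grid hγ hV g hi
      refine ⟨m, C, hC, fun _ ↦ ⟨hm, ?_⟩⟩
      simpa only [hb] using h
    · exact ⟨0, 0, le_rfl, fun h ↦ absurd h hi⟩
  choose m C hC h using h
  let p : ℕ → ℕ → ℝ := fun i j ↦ gridPoint (S.t i) (S.t (i + 1)) (m i) j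
  have hp : ∀ i < S.N, ∀ j ≤ m i, p i j ∈ Icc (S.t i) (S.t (i + 1)) := fun i hi j hj ↦
    ⟨le_gridPoint (S.le_succ i) j, gridPoint_le (S.le_succ i) (h i hi).1 hj⟩
  -- Evaluation at all grid points of all pieces. Its kernel is the required subspace: closed since
  -- evaluations are continuous, of finite codimension since the target has finite dimension.
  let L : H10 γ S →ₗ[ℝ] ((i : Fin S.N) → Fin (m i + 1) → Eucl n) :=
    LinearMap.pi fun i ↦ LinearMap.pi fun j ↦ H10.fieldInL S (S.c i) (p i j)
  have hL : ∀ ξ : H10 γ S, ξ ∈ LinearMap.ker L ↔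
      ∀ (i : Fin S.N) (j : Fin (m i + 1)), fieldIn γ ξ.field (S.c i) (p i j) = 0 := fun ξ ↦ by
    rw [LinearMap.mem_ker, funext_iff]
    exact forall_congr' fun i ↦ funext_iff
  refine ⟨LinearMap.ker L, ?_, ?_, ?_⟩
  · have e : (LinearMap.ker L : Set (H10 γ S)) = ⋂ (i : Fin S.N) (j : Fin (m i + 1)),
        {ξ | fieldIn γ ξ.field (S.c i) (p i j) = 0} := by
      ext ξ
      simp only [SetLike.mem_coe, hL, mem_iInter, mem_ofPred_eq]
    rw [e]
    exact isClosed_iInter fun i ↦ isClosed_iInter fun j ↦ isClosed_eq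
      (H10.continuous_fieldIn S i.2 (hp i i.2 j (Nat.lt_succ_iff.1 j.2))) continuous_const
  · exact FiniteDimensional.of_injective ((LinearMap.ker L).liftQ L le_rfl)
      (LinearMap.ker_eq_bot.1 (Submodule.ker_liftQ_eq_bot _ _ _ le_rfl))
  · set D := ∑ i ∈ Finset.range S.N, ∑ _j ∈ Finset.range (m i), C i with hD
    have hD0 : 0 ≤ D := Finset.sum_nonneg fun i _ ↦ Finset.sum_nonneg fun _ _ ↦ hC i
    -- From `‖ξ‖² ≤ 4 b (ξ, ζ) ≤ 4 D ‖b ξ‖ ‖ξ‖`; the summand `1` keeps the constant meaningful when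
    -- `D = 0`.
    refine ⟨1 / (4 * (D + 1)), by positivity, fun ξ hξ ↦ ?_⟩
    rw [hL] at hξ
    have hη : ∀ i j, ∃ η : H10 γ S, i < S.N → j < m i → ‖η‖ ≤ C i * ‖ξ‖ ∧
        sobolevSq (p i j) (p i (j + 1)) (fieldIn γ ξ.field (S.c i)) ≤ 4 * b ξ η := fun i j ↦ by
      by_cases hij : i < S.N ∧ j < m i
      · obtain ⟨η, hη⟩ := (h i hij.1).2 ξ (fun j hj ↦ hξ ⟨i, hij.1⟩ ⟨j, Nat.lt_succ_of_le hj⟩) j hij.2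
        exact ⟨η, fun _ _ ↦ hη⟩
      · exact ⟨0, fun h1 h2 ↦ absurd ⟨h1, h2⟩ hij⟩
    choose η hη using hη
    -- One test field for all grid intervals at once: summing the local estimates recovers the whole
    -- of `‖ξ‖²`.
    set ζ := ∑ i ∈ Finset.range S.N, ∑ j ∈ Finset.range (m i), η i j with hζ
    have hζn : ‖ζ‖ ≤ D * ‖ξ‖ := by
      rw [hD, Finset.sum_mul]
      refine norm_sum_le_of_le _ fun i hi ↦ ?_
      rw [Finset.sum_mul]
      exact norm_sum_le_of_le _ fun j hj ↦
        (hη i j (Finset.mem_range.1 hi) (Finset.mem_range.1 hj)).1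
    have hζb : ‖ξ‖ ^ 2 ≤ 4 * b ξ ζ := by
      rw [hζ, map_sum, Finset.mul_sum, ξ.norm_sq_eq]
      refine Finset.sum_le_sum fun i hi ↦ ?_
      have hi' := Finset.mem_range.1 hi
      rw [map_sum, Finset.mul_sum, ← sum_sobolevSq_grid (S.le_succ i) (h i hi').1 (ξ.isH1On hi')]
      exact Finset.sum_le_sum fun j hj ↦ (hη i j hi' (Finset.mem_range.1 hj)).2
    have h1 : b ξ ζ ≤ ‖b ξ‖ * (D * ‖ξ‖) :=
      ((le_abs_self _).trans ((b ξ).le_opNorm ζ)).trans (by gcongr)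
    rcases (norm_nonneg ξ).eq_or_lt with h0 | h0
    · rw [← h0, mul_zero]
      exact norm_nonneg _
    · rw [one_div, inv_mul_le_iff₀ (by positivity)]
      have h2 : ‖ξ‖ * ‖ξ‖ ≤ (4 * D * ‖b ξ‖) * ‖ξ‖ := by nlinarith
      have h3 := le_of_mul_le_mul_right h2 h0
      nlinarith [norm_nonneg (b ξ)]

/-- The index form is Fredholm, and it is nondegenerate if and only if its kernel is trivial. -/
theorem isFredholmForm_hessian (hγ : ContMDiffOn 𝓘(ℝ, ℝ) (𝓡 n) ∞ γ (Icc 0 1))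
    (hV : IsSmoothPotential n V) :
    IsFredholmForm (hessian g V γ S) ∧ (IsNondegenerateForm (hessian g V γ S) ↔
      ∀ ξ : H10 γ S, (∀ η : H10 γ S, hessianForm g V γ ξ.field η.field = 0) → ξ = 0) := by
  have := H10.completeSpace hγ S
  obtain ⟨b, hb⟩ := exists_indexForm hγ hV g S
  obtain ⟨Z, hZ, hZf, c, hc, h⟩ := exists_subspace_bound hγ hV hb
  have hpol : IsPolarForm (hessian g V γ S) b :=
    ⟨fun u v ↦ by rw [hb, hb, hessianForm_comm hγ hV], fun u ↦ (hb u u).symm⟩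
  refine (isFredholmForm_of_bound b hpol Z hZ hc h).imp_right fun hn ↦ hn.trans ?_
  refine forall_congr' fun ξ ↦ imp_congr_left ?_
  rw [ContinuousLinearMap.ext_iff]
  exact forall_congr' fun η ↦ by rw [hb]; rfl

end Fredholmness

/-! ### Regularity of weak solutions -/

section DuBoisReymond

variable {n : ℕ} {a b : ℝ}

/-- The Riesz isomorphism. -/
def rieszL (n : ℕ) : (Eucl n →L[ℝ] ℝ) →L[ℝ] Eucl n :=
  LinearMap.toContinuousLinearMap
    { toFun := fun f ↦ (InnerProductSpace.toDual ℝ (Eucl n)).symm f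
      map_add' := fun f g ↦ map_add _ f g
      map_smul' := fun r f ↦ by simp }

lemma inner_rieszL (f : Eucl n →L[ℝ] ℝ) (w : Eucl n) : ⟪rieszL n f, w⟫_ℝ = f w :=
  InnerProductSpace.toDual_symm_apply

lemma innerSL_rieszL (f : Eucl n →L[ℝ] ℝ) : innerSL ℝ (rieszL n f) = f :=
  ContinuousLinearMap.ext fun w ↦ inner_rieszL f w

/-- The transpose of a matrix. -/
def transposeL (A : Eucl n →L[ℝ] Eucl n) : Eucl n →L[ℝ] Eucl n :=
  (rieszL n).comp (((ContinuousLinearMap.compL ℝ (Eucl n) (Eucl n) ℝ).flip A).comp (innerSL ℝ))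

lemma inner_transposeL (A : Eucl n →L[ℝ] Eucl n) (p w : Eucl n) :
    ⟪transposeL A p, w⟫_ℝ = ⟪p, A w⟫_ℝ := inner_rieszL _ w

lemma contDiffOn_transposeL {s : Set ℝ} {A : ℝ → Eucl n →L[ℝ] Eucl n} {k : WithTop ℕ∞}
    (hA : ContDiffOn ℝ k A s) : ContDiffOn ℝ k (fun t ↦ transposeL (A t)) s :=
  contDiffOn_const.clm_comp
    (((ContinuousLinearMap.contDiff _).comp_contDiffOn hA).clm_comp contDiffOn_const)

lemma hasDerivWithinAt_of_eq_integral {u f : ℝ → Eucl n} (hab : a ≤ b) (hf : ContinuousOn f (Icc a b))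
    (hu : ∀ s ∈ Icc a b, u s = u a + ∫ r in a..s, f r) {t : ℝ} (ht : t ∈ Icc a b) :
    HasDerivWithinAt u (f t) (Icc a b) t := by
  -- The continuous extension by constants makes the fundamental theorem available at the end points
  -- too.
  have hc : Continuous (IccExtend hab ((Icc a b).domRestrict f)) :=
    (continuousOn_iff_continuous_domRestrict.1 hf).Icc_extend'
  have h1 := ((hc.integral_hasStrictDerivAt a t).hasDerivAt.const_add (u a)).hasDerivWithinAt
    (s := Icc a b)
  have h2 : ∀ s ∈ Icc a b, IccExtend hab ((Icc a b).domRestrict f) s = f s := fun s hs ↦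
    IccExtend_of_mem hab _ hs
  rw [h2 t ht] at h1
  refine h1.congr_of_mem (fun s hs ↦ ?_) ht
  rw [hu s hs]
  congr 1
  refine intervalIntegral.integral_congr fun r hr ↦ ?_
  rw [uIcc_of_le hs.1] at hr
  exact (h2 r ⟨hr.1, hr.2.trans hs.2⟩).symm

/-- A square integrable function which is orthogonal to the derivatives of all `H¹` functions
vanishing at the end points is constant. -/
lemma exists_const_of_integral_inner_deriv_eq_zero (hab : a < b) {f : ℝ → Eucl n}
    (hf : MemLp f 2 (volume.restrict (Icc a b)))
    (h : ∀ w : ℝ → Eucl n, IsH1On a b w → w a = 0 → w b = 0 →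
      ∫ x in a..b, ⟪f x, deriv w x⟫_ℝ = 0) :
    ∃ m : Eucl n, f =ᵐ[volume.restrict (Icc a b)] fun _ ↦ m := by
  -- `m` is the mean value of `f`, so the primitive `w` of `f - m` vanishes at both ends and is
  -- admissible. Splitting `f = (f - m) + m`, the constant part integrates to zero and the
  -- hypothesis says that `f - m` has zero `L²` norm.
  set m : Eucl n := (b - a)⁻¹ • ∫ x in a..b, f x with hm
  have hz : MemLp (fun x ↦ f x - m) 2 (volume.restrict (Icc a b)) := hf.sub (memLp_const m)
  have hfi := memLp_intervalIntegrable hf (right_mem_Icc.2 hab.le)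
  have hz0 : ∫ x in a..b, (f x - m) = 0 := by
    rw [intervalIntegral.integral_sub hfi intervalIntegrable_const, intervalIntegral.integral_const,
      hm, smul_inv_smul₀ (sub_pos.2 hab).ne', sub_self]
  let w : ℝ → Eucl n := fun t ↦ ∫ x in a..t, (f x - m)
  have hwe : ∀ s ∈ Icc a b, w s = w a + ∫ x in a..s, (f x - m) := fun s _ ↦ by simp [w]
  have hw : IsH1On a b w := ⟨_, hz, hwe⟩
  have h1 := h w hw (by simp [w]) hz0
  have h2 : ∫ x in a..b, ‖f x - m‖ ^ 2 = 0 := by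
    have h3 : ∫ x in a..b, ⟪f x, deriv w x⟫_ℝ
        = ∫ x in a..b, (‖f x - m‖ ^ 2 + ⟪m, f x - m⟫_ℝ) := by
      refine intervalIntegral.integral_congr_ae_restrict ?_
      rw [uIoc_of_le hab.le, restrict_Ioc_eq_restrict_Icc]
      filter_upwards [IsH1On.deriv_ae_eq hz hab.le hwe] with x hx
      rw [hx.deriv, ← real_inner_self_eq_norm_sq, ← inner_add_left, sub_add_cancel]
    have hzi := memLp_intervalIntegrable hz (right_mem_Icc.2 hab.le)
    have h4 : ∫ x in a..b, ⟪m, f x - m⟫_ℝ = 0 := by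
      have := (innerSL ℝ m).intervalIntegral_comp_comm hzi
      simp only [innerSL_apply_apply] at this
      rw [this, hz0, inner_zero_right]
    rw [h3, intervalIntegral.integral_add (MemLp.intervalIntegrable_norm_sq hz hab.le)
      (MemLp.integrable_inner_Icc (memLp_const m) hz hab.le), h4, add_zero] at h1
    exact h1
  refine ⟨m, ?_⟩
  rw [intervalIntegral.integral_of_le hab.le, restrict_Ioc_eq_restrict_Icc,
    integral_eq_zero_iff_of_nonneg (fun _ ↦ by positivity) (hz.integrable_norm_pow (by norm_num))]
    at h2
  filter_upwards [h2] with x hx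
  exact sub_eq_zero.1 (norm_eq_zero.1 (pow_eq_zero_iff two_ne_zero |>.1 hx))

/-- Solutions of linear systems with smooth coefficients are smooth. -/
lemma contDiffOn_of_linear_system (hab : a < b) {A B C D : ℝ → Eucl n →L[ℝ] Eucl n}
    (hA : ContDiffOn ℝ ∞ A (Icc a b)) (hB : ContDiffOn ℝ ∞ B (Icc a b))
    (hC : ContDiffOn ℝ ∞ C (Icc a b)) (hD : ContDiffOn ℝ ∞ D (Icc a b)) {u p : ℝ → Eucl n}
    (hu : ∀ t ∈ Icc a b, HasDerivWithinAt u (A t (u t) + B t (p t)) (Icc a b) t)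
    (hp : ∀ t ∈ Icc a b, HasDerivWithinAt p (C t (u t) + D t (p t)) (Icc a b) t) :
    ContDiffOn ℝ ∞ u (Icc a b) ∧ ContDiffOn ℝ ∞ p (Icc a b) := by
  have hun := uniqueDiffOn_Icc hab
  -- Bootstrapping: if `u` and `p` are of class `C^k`, then by the system so are their derivatives.
  have key : ∀ k : ℕ, ContDiffOn ℝ k u (Icc a b) ∧ ContDiffOn ℝ k p (Icc a b) := by
    intro k
    induction k with
    | zero =>
      exact ⟨contDiffOn_zero.2 fun t ht ↦ (hu t ht).continuousWithinAt,
        contDiffOn_zero.2 fun t ht ↦ (hp t ht).continuousWithinAt⟩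
    | succ k ih =>
      have hk : ((k : ℕ∞) : WithTop ℕ∞) ≤ ∞ := by exact_mod_cast le_top
      constructor
      · rw [Nat.cast_succ, contDiffOn_succ_iff_derivWithin hun]
        refine ⟨fun t ht ↦ (hu t ht).differentiableWithinAt, by simp, ?_⟩
        exact (((hA.of_le hk).clm_apply ih.1).add ((hB.of_le hk).clm_apply ih.2)).congr
          fun t ht ↦ (hu t ht).derivWithin (hun t ht)
      · rw [Nat.cast_succ, contDiffOn_succ_iff_derivWithin hun]
        refine ⟨fun t ht ↦ (hp t ht).differentiableWithinAt, by simp, ?_⟩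
        exact (((hC.of_le hk).clm_apply ih.1).add ((hD.of_le hk).clm_apply ih.2)).congr
          fun t ht ↦ (hp t ht).derivWithin (hun t ht)
  exact ⟨contDiffOn_infty.2 fun k ↦ (key k).1, contDiffOn_infty.2 fun k ↦ (key k).2⟩

variable {G q : ℝ → Eucl n →L[ℝ] Eucl n →L[ℝ] ℝ} {Γ : ℝ → Eucl n →L[ℝ] Eucl n}

/-- The matrix of the inverse of the metric. -/
def sharpL (B : Eucl n →L[ℝ] Eucl n →L[ℝ] ℝ) : Eucl n →L[ℝ] Eucl n := B.inverse.comp (innerSL ℝ)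

lemma apply_sharpL {B : Eucl n →L[ℝ] Eucl n →L[ℝ] ℝ} (hB : B.IsInvertible) (p : Eucl n) :
    B (sharpL B p) = innerSL ℝ p := by
  obtain ⟨e, he⟩ := hB
  simp [sharpL, ← he]

lemma sharpL_rieszL {B : Eucl n →L[ℝ] Eucl n →L[ℝ] ℝ} (hB : B.IsInvertible) (y : Eucl n) :
    sharpL B (rieszL n (B y)) = y := by
  have h : sharpL B (rieszL n (B y)) = B.inverse (innerSL ℝ (rieszL n (B y))) := rfl
  rw [h, innerSL_rieszL]
  obtain ⟨e, he⟩ := hB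
  simp [← he]

/-- Regularity of weak solutions: in the kernel of the index form, `u` and the momentum
`p = G (u' + Γ u, ·)` are a smooth solution of a first order system. -/
lemma exists_momentum_of_weak (hab : a < b) (hG : ContDiffOn ℝ ∞ G (Icc a b))
    (hΓ : ContDiffOn ℝ ∞ Γ (Icc a b)) (hq : ContDiffOn ℝ ∞ q (Icc a b))
    (hinv : ∀ t ∈ Icc a b, (G t).IsInvertible) {u : ℝ → Eucl n} (hu : IsH1On a b u)
    (h : ∀ w : ℝ → Eucl n, IsH1On a b w → w a = 0 → w b = 0 →
      ∫ x in a..b, indexDensity G Γ q u w x = 0) :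
    ∃ p : ℝ → Eucl n, ContDiffOn ℝ ∞ u (Icc a b) ∧ ContDiffOn ℝ ∞ p (Icc a b) ∧
      ∀ t ∈ Icc a b, HasDerivWithinAt u (sharpL (G t) (p t) - Γ t (u t)) (Icc a b) t ∧
        HasDerivWithinAt p (transposeL (Γ t) (p t) - rieszL n (q t (u t))) (Icc a b) t := by
  have hT := contDiffOn_transposeL hΓ
  have hN : ContDiffOn ℝ ∞ (fun t ↦ sharpL (G t)) (Icc a b) := by
    refine ContDiffOn.clm_comp (fun t ht ↦ ?_) contDiffOn_const
    exact ((hinv t ht).contDiffAt_map_inverse).comp_contDiffWithinAt t (hG t ht)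
  have hQ : ContDiffOn ℝ ∞ (fun t ↦ (rieszL n).comp (q t)) (Icc a b) :=
    contDiffOn_const.clm_comp hq
  have hGh : ContDiffOn ℝ ∞ (fun t ↦ (rieszL n).comp (G t)) (Icc a b) :=
    contDiffOn_const.clm_comp hG
  have hum := hu.memLp hab.le
  have hY := memLp_covDeriv hab.le hΓ.continuousOn hu
  -- The momentum, so far only in `L²`. In terms of it the density is `⟪p₀, w'⟫ + ⟪r, w⟫`, with `r`
  -- as below.
  set p₀ : ℝ → Eucl n := fun t ↦ rieszL n (G t (deriv u t + Γ t (u t))) with hp₀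
  have hp₀m : MemLp p₀ 2 (volume.restrict (Icc a b)) := 
    memLp_clm_apply (T := fun t ↦ (rieszL n).comp (G t)) hGh.continuousOn hY
  set r : ℝ → Eucl n := fun t ↦ transposeL (Γ t) (p₀ t) - rieszL n (q t (u t)) with hr
  have hrm : MemLp r 2 (volume.restrict (Icc a b)) :=
    (memLp_clm_apply hT.continuousOn hp₀m).sub 
      (memLp_clm_apply (T := fun t ↦ (rieszL n).comp (q t)) hQ.continuousOn hum)
  let R : ℝ → Eucl n := fun t ↦ ∫ x in a..t, r x
  have hRe : ∀ s ∈ Icc a b, R s = R a + ∫ x in a..s, r x := fun s _ ↦ by simp [R]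
  have hR : IsH1On a b R := ⟨r, hrm, hRe⟩
  have hRd := IsH1On.deriv_ae_eq hrm hab.le hRe
  -- Integrating `⟪r, w⟫` by parts with the primitive `R` of `r` turns the weak equation into the
  -- orthogonality of `p₀ - R` to all `w'`.
  obtain ⟨m, hm⟩ := exists_const_of_integral_inner_deriv_eq_zero hab
    (f := fun x ↦ p₀ x - R x) (hp₀m.sub (hR.memLp hab.le)) fun w hw hwa hwb ↦ by
      have h1 := h w hw hwa hwb
      have hwm := hw.memLp_deriv hab.le
      have h2 := hR.integral_inner_deriv_left hab.le hw
      rw [hwa, hwb, inner_zero_right, inner_zero_right, sub_zero, zero_sub] at h2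
      have h3 : ∫ x in a..b, ⟪p₀ x - R x, deriv w x⟫_ℝ
          = (∫ x in a..b, ⟪p₀ x, deriv w x⟫_ℝ) - ∫ x in a..b, ⟪R x, deriv w x⟫_ℝ := by
        rw [← intervalIntegral.integral_sub (MemLp.integrable_inner_Icc hp₀m hwm hab.le)
          (MemLp.integrable_inner_Icc (hR.memLp hab.le) hwm hab.le)]
        simp only [inner_sub_left]
      rw [h3, h2, sub_neg_eq_add, ← intervalIntegral.integral_add
        (MemLp.integrable_inner_Icc hp₀m hwm hab.le)
        (MemLp.integrable_inner_Icc (hR.memLp_deriv hab.le) (hw.memLp hab.le) hab.le), ← h1]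
      refine intervalIntegral.integral_congr_ae_restrict ?_
      rw [uIoc_of_le hab.le, restrict_Ioc_eq_restrict_Icc]
      filter_upwards [hRd] with x hx
      rw [hx.deriv, hr, hp₀]
      simp only [indexDensity]
      rw [inner_sub_left, inner_transposeL, inner_rieszL, inner_rieszL, inner_rieszL]
      simp only [map_add, add_apply]
      ring
  -- The continuous representative of the momentum. With it the a.e. equations for `u'` and `p'`
  -- acquire continuous right hand sides and hold at every point.
  set p : ℝ → Eucl n := fun t ↦ R t + m with hp
  have hpc : ContinuousOn p (Icc a b) := (hR.continuousOn hab.le).add continuousOn_const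
  have huc := hu.continuousOn hab.le
  have hpp : p₀ =ᵐ[volume.restrict (Icc a b)] p := by
    filter_upwards [hm] with x hx
    rw [hp, ← hx]
    simp only [add_sub_cancel]
  have hnull : ∀ {f g : ℝ → Eucl n}, f =ᵐ[volume.restrict (Icc a b)] g → ∀ s ∈ Icc a b,
      ∫ x in a..s, f x = ∫ x in a..s, g x := fun {f g} hfg s hs ↦ by
    refine intervalIntegral.integral_congr_ae_restrict ?_
    rw [uIoc_of_le hs.1]
    exact ae_mono (Measure.restrict_mono
      (Ioc_subset_Icc_self.trans (Icc_subset_Icc_right hs.2)) le_rfl) hfg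
  have hup : ∀ t ∈ Icc a b, HasDerivWithinAt u (sharpL (G t) (p t) - Γ t (u t)) (Icc a b) t := by
    intro t ht
    refine hasDerivWithinAt_of_eq_integral hab.le (f := fun t ↦ sharpL (G t) (p t) - Γ t (u t))
      ((hN.continuousOn.clm_apply hpc).sub (hΓ.continuousOn.clm_apply huc)) (fun s hs ↦ ?_) ht
    rw [hu.eq_add_integral_deriv hab.le hs]
    congr 1
    refine hnull ?_ s hs
    filter_upwards [hpp, ae_restrict_mem measurableSet_Icc] with x hx hxm
    rw [← hx, hp₀]
    simp only
    rw [sharpL_rieszL (hinv x hxm), add_sub_cancel_right]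
  have hpd : ∀ t ∈ Icc a b,
      HasDerivWithinAt p (transposeL (Γ t) (p t) - rieszL n (q t (u t))) (Icc a b) t := by
    intro t ht
    refine hasDerivWithinAt_of_eq_integral hab.le
      (f := fun t ↦ transposeL (Γ t) (p t) - rieszL n (q t (u t)))
      ((hT.continuousOn.clm_apply hpc).sub (hQ.continuousOn.clm_apply huc)) (fun s hs ↦ ?_) ht
    have h1 : p s = p a + ∫ x in a..s, r x := by simp [hp, R, add_comm]
    rw [h1]
    congr 1
    refine hnull ?_ s hs
    filter_upwards [hpp] with x hx
    rw [hr, ← hx]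
  obtain ⟨h1, h2⟩ := contDiffOn_of_linear_system hab (A := fun t ↦ -Γ t) (B := fun t ↦ sharpL (G t))
    (C := fun t ↦ -(rieszL n).comp (q t)) (D := fun t ↦ transposeL (Γ t)) hΓ.neg hN hQ.neg hT
    (u := u) (p := p) (fun t ht ↦ (hup t ht).congr_deriv (by
      rw [neg_apply, neg_add_eq_sub])) (fun t ht ↦ (hpd t ht).congr_deriv (by
      rw [neg_apply, neg_add_eq_sub]; rfl))
  exact ⟨p, h1, h2, fun t ht ↦ ⟨hup t ht, hpd t ht⟩⟩

end DuBoisReymond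

/-! ### The kernel of the index form consists of Jacobi fields -/

section JacobiFields

variable {n ν : ℕ} {M : Type*} [TopologicalSpace M] [ChartedSpace (Eucl n) M]
  [IsManifold (𝓡 n) ∞ M] {γ : ℝ → M} {g : SemiRiemannianMetric n ν M} {V : ℝ → M → ℝ}

/-- Derivative of a field with lowered index: metric compatibility splits the derivative of `G` into
a term completing `Y'` to the covariant derivative of `Y` and one that acts on the test vector. -/
lemma hasDerivWithinAt_metricIn_apply (g : SemiRiemannianMetric n ν M)
    (hγ : ContMDiffOn 𝓘(ℝ, ℝ) (𝓡 n) ∞ γ (Icc 0 1)) {c : M}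
    {t : ℝ} (hc : t ∈ chartDom n c γ) {Y : ℝ → Eucl n} {Y' : Eucl n}
    (hY : HasDerivWithinAt Y Y' (Icc 0 1) t) :
    ∃ f : Eucl n →L[ℝ] ℝ,
      HasDerivWithinAt (fun t ↦ metricIn g c (curveIn c γ t) (Y t)) f (Icc 0 1) t ∧
      ∀ w, f w = metricIn g c (curveIn c γ t) (Y' + connIn g γ c t (Y t)) w
        + metricIn g c (curveIn c γ t) (Y t) (connIn g γ c t w) := by
  have hy := curveIn_mem_target hc
  have hG := isMetricOn_metricIn g c
  have h1 : HasDerivWithinAt (fun t ↦ metricIn g c (curveIn c γ t))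
      (fderiv ℝ (metricIn g c) (curveIn c γ t) (velIn c γ t)) (Icc 0 1) t :=
    (hG.differentiableAt hy).hasFDerivAt.comp_hasDerivWithinAt t
      (hasDerivWithinAt_curveIn_velIn hγ hc)
  refine ⟨_, h1.clm_apply hY, fun w ↦ ?_⟩
  have h2 := hG.fderiv_apply hy (velIn c γ t) (Y t) w
  have h3 := hG.symm _ hy (chr (metricIn g c) (curveIn c γ t) (velIn c γ t) w) (Y t)
  rw [map_add, add_apply, add_apply, h2, h3]
  simp only [connIn, chrL_apply]
  ring

section Smooth

variable {ξ : FieldAlong (n := n) γ} (hγ : ContMDiffOn 𝓘(ℝ, ℝ) (𝓡 n) ∞ γ (Icc 0 1))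
  (hξ : ContMDiffOn 𝓘(ℝ, ℝ) (𝓡 n).tangent ∞
    (fun x ↦ (⟨γ x, ξ x⟩ : TangentBundle (𝓡 n) M)) (Icc 0 1)) (c : M)

include hγ hξ

lemma contDiffOn_fieldIn : ContDiffOn ℝ ∞ (fieldIn γ ξ c) (chartDom n c γ) := fun t ht ↦
  ((contMDiffOn_field_iff hγ).1 hξ c t ht).mono inter_subset_left

lemma hasDerivWithinAt_fieldIn {t : ℝ} (ht : t ∈ chartDom n c γ) :
    HasDerivWithinAt (fieldIn γ ξ c) (derivWithin (fieldIn γ ξ c) (chartDom n c γ) t)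
      (Icc 0 1) t :=
  ((contDiffOn_fieldIn hγ hξ c).differentiableOn (by simp) t ht).hasDerivWithinAt.mono_of_mem_nhdsWithin
    (chartDom_mem_nhdsWithin hγ.continuousOn ht)

lemma contDiffOn_fieldIn_covDeriv (g : SemiRiemannianMetric n ν M) :
    ContDiffOn ℝ ∞ (fieldIn γ (covDeriv g γ ξ) c) (chartDom n c γ) := by
  have hu := contDiffOn_fieldIn hγ hξ c
  refine ((hu.derivWithin (uniqueDiffOn_chartDom hγ.continuousOn c) (m := ∞) (by simp)).add
    ((contDiffOn_connIn (g := g) hγ c).clm_apply hu)).congr fun t ht ↦ ?_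
  exact fieldIn_covDeriv g hγ ht (hasDerivWithinAt_fieldIn hγ hξ c ht)

end Smooth

lemma metricIn_covDeriv_covDeriv (hV : IsSmoothPotential n V) {ξ : FieldAlong (n := n) γ}
    (hξ : IsJacobiField g V γ ξ) {c : M} {t : ℝ} (hc : t ∈ chartDom n c γ) (w : Eucl n) :
    metricIn g c (curveIn c γ t) (fieldIn γ (covDeriv g γ (covDeriv g γ ξ)) c t) w
      = -tidalIn g V γ c t (fieldIn γ ξ c t) w := by
  rw [← metricIn_jacobiPotential hV ξ hc, eq_neg_iff_add_eq_zero, ← add_apply, ← map_add]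
  have h1 : fieldIn γ (covDeriv g γ (covDeriv g γ ξ)) c t + fieldIn γ (jacobiPotential g V γ ξ) c t
      = 0 :=
    (congrFun (fieldIn_add γ _ _ c) t).symm.trans (fieldIn_eq_zero (hξ.equation t hc.1) c)
  rw [h1, map_zero, zero_apply]

/-- Integration by parts for Jacobi fields. -/
lemma integral_indexDensity_of_isJacobiField (hγ : ContMDiffOn 𝓘(ℝ, ℝ) (𝓡 n) ∞ γ (Icc 0 1))
    (hV : IsSmoothPotential n V) {ξ : FieldAlong (n := n) γ} (hξ : IsJacobiField g V γ ξ)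
    {a b : ℝ} {c : M} (hab : a ≤ b) (hc : Icc a b ⊆ chartDom n c γ) {w : ℝ → Eucl n}
    (hw : IsH1On a b w) :
    ∫ x in a..b, indexDensityIn g V γ c (fieldIn γ ξ c) w x
      = metricIn g c (curveIn c γ b) (fieldIn γ (covDeriv g γ ξ) c b) (w b)
        - metricIn g c (curveIn c γ a) (fieldIn γ (covDeriv g γ ξ) c a) (w a) := by
  set Y := fieldIn γ (covDeriv g γ ξ) c with hYdef
  have hY : ContDiffOn ℝ ∞ Y (chartDom n c γ) := contDiffOn_fieldIn_covDeriv hγ hξ.smooth c g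
  -- The momentum of the Jacobi field; the claim is integration by parts for `p` and `w`.
  let p : ℝ → Eucl n := fun t ↦ rieszL n (metricIn g c (curveIn c γ t) (Y t))
  have hp : IsH1On a b p := isH1On_of_contDiffOn hab
    (((rieszL n).contDiff.comp_contDiffOn
      ((contDiffOn_metricIn_curveIn hγ c).clm_apply hY)).mono hc)
  have hpw : ∀ t v, ⟪p t, v⟫_ℝ = metricIn g c (curveIn c γ t) (Y t) v := fun t v ↦ inner_rieszL _ v
  rw [← hpw, ← hpw, ← hp.integral_inner_deriv hab hw]
  refine intervalIntegral.integral_congr_ae_restrict ?_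
  rw [uIoc_of_le hab, ← restrict_Ioo_eq_restrict_Ioc]
  filter_upwards [ae_restrict_mem measurableSet_Ioo] with x hx
  have hxc := hc (Ioo_subset_Icc_self hx)
  have hnhds : Icc (0 : ℝ) 1 ∈ 𝓝 x :=
    mem_of_superset (Icc_mem_nhds hx.1 hx.2) (hc.trans inter_subset_left)
  have hu := hasDerivWithinAt_fieldIn hγ hξ.smooth c hxc
  have hYd : HasDerivWithinAt Y (derivWithin Y (chartDom n c γ) x) (Icc 0 1) x :=
    (hY.differentiableOn (by simp) x hxc).hasDerivWithinAt.mono_of_mem_nhdsWithin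
      (chartDom_mem_nhdsWithin hγ.continuousOn hxc)
  obtain ⟨f, hf, hf'⟩ := hasDerivWithinAt_metricIn_apply g hγ hxc hYd
  have hpd : deriv p x = rieszL n f :=
    ((rieszL n).hasFDerivAt.comp_hasDerivAt x (hf.hasDerivAt hnhds)).deriv
  have e1 : Y x = deriv (fieldIn γ ξ c) x + connIn g γ c x (fieldIn γ ξ c x) := by
    rw [(hu.hasDerivAt hnhds).deriv]
    exact fieldIn_covDeriv g hγ hxc hu
  have e2 := fieldIn_covDeriv g hγ hxc hYd
  have e3 := metricIn_covDeriv_covDeriv hV hξ hxc (w x)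
  rw [e2] at e3
  -- The connection term acting on `w` joins `w'` to form the covariant derivative of `w`, and `e3`,
  -- the Jacobi equation, replaces the covariant derivative of `Y` by the tidal term.
  rw [hpd, hpw, inner_rieszL, hf']
  simp only [indexDensity]
  rw [← e1]
  refine Eq.trans ?_ (congrArg (fun z ↦ z + metricIn g c (curveIn c γ x) (Y x)
    (connIn g γ c x (w x)) + metricIn g c (curveIn c γ x) (Y x) (deriv w x)) e3).symm
  rw [map_add]
  ring

lemma integral_indexDensity_congr {G q : ℝ → Eucl n →L[ℝ] Eucl n →L[ℝ] ℝ}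
    {Γ : ℝ → Eucl n →L[ℝ] Eucl n} {a b : ℝ} (hab : a ≤ b) {u u' w : ℝ → Eucl n}
    (h : EqOn u u' (Icc a b)) :
    ∫ x in a..b, indexDensity G Γ q u w x = ∫ x in a..b, indexDensity G Γ q u' w x := by
  refine intervalIntegral.integral_congr_ae_restrict ?_
  rw [uIoc_of_le hab, ← restrict_Ioo_eq_restrict_Ioc]
  filter_upwards [ae_restrict_mem measurableSet_Ioo] with x hx
  have h1 : u =ᶠ[𝓝 x] u' := by
    filter_upwards [Icc_mem_nhds hx.1 hx.2] with y hy using h hy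
  simp only [indexDensity, h1.deriv_eq, h1.eq_of_nhds]

variable {S : ChartSubdivision n γ}

/-- A Jacobi field vanishing at the end points lies in the kernel of the index form. -/
lemma exists_mem_ker_of_isJacobiField (hγ : ContMDiffOn 𝓘(ℝ, ℝ) (𝓡 n) ∞ γ (Icc 0 1))
    (hV : IsSmoothPotential n V) {ξ : FieldAlong (n := n) γ} (hξ : IsJacobiField g V γ ξ)
    (h0 : ξ 0 = 0) (h1 : ξ 1 = 0) :
    ∃ ζ : H10 γ S, (∀ t ∈ Icc (0 : ℝ) 1, ζ.field t = ξ t) ∧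
      ∀ η : H10 γ S, hessianForm g V γ ζ.field η.field = 0 := by
  classical
  -- Elements of `H¹₀(γ)` are zero off `(0, 1)`. The truncation changes nothing on `[0, 1]` because
  -- `ξ` vanishes at both ends.
  let z : FieldAlong (n := n) γ := fun t ↦ if t ∈ Ioo (0 : ℝ) 1 then ξ t else 0
  have hz : ∀ t ∈ Icc (0 : ℝ) 1, z t = ξ t := by
    intro t ht
    by_cases h : t ∈ Ioo (0 : ℝ) 1
    · exact if_pos h
    · refine (if_neg h).trans ?_
      rcases ht.1.eq_or_lt with rfl | h2
      · exact h0.symm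
      · rcases ht.2.eq_or_lt with rfl | h3
        · exact h1.symm
        · exact absurd ⟨h2, h3⟩ h
  have hzin : ∀ c, ∀ t ∈ Icc (0 : ℝ) 1, fieldIn γ z c t = fieldIn γ ξ c t := fun c t ht ↦
    congrArg (toChart c (γ t)) (hz t ht)
  have hmem : z ∈ h10Submodule n γ := by
    refine ⟨fun c a b ha hab hb hc ↦ ?_, fun t ht ↦ if_neg ht⟩
    have hcd := Icc_subset_chartDom ha hb hc
    exact (isH1On_of_contDiffOn hab ((contDiffOn_fieldIn hγ hξ.smooth c).mono hcd)).congr hab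
      fun t ht ↦ hzin c t (hcd ht).1
  let ζ : H10 γ S := ⟨z, hmem⟩
  refine ⟨ζ, hz, fun η ↦ ?_⟩
  rw [hessianForm_eq_sum hγ hV]
  -- The boundary term in intrinsic form: adjacent pieces give it the same value at the common node
  -- although their charts differ, so the sum telescopes.
  let F : ℝ → ℝ := fun t ↦ metricAt g (γ t) (covDeriv g γ ξ t) (η.field t)
  have hF : ∀ i ∈ Finset.range S.N, ∫ x in (S.t i)..(S.t (i + 1)), indexDensityIn g V γ (S.c i)
      (fieldIn γ ζ.field (S.c i)) (fieldIn γ η.field (S.c i)) x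
        = F (S.t (i + 1)) - F (S.t i) := by
    intro i hi
    have hi' := Finset.mem_range.1 hi
    have hc := S.subset_chartDom hi'
    have hle := S.le_succ i
    have e1 : EqOn (fieldIn γ ζ.field (S.c i)) (fieldIn γ ξ (S.c i)) (Icc (S.t i) (S.t (i + 1))) :=
      fun t ht ↦ hzin _ t (hc ht).1
    rw [integral_indexDensity_congr hle e1,
      integral_indexDensity_of_isJacobiField hγ hV hξ hle hc (η.isH1On hi')]
    exact congrArg₂ (· - ·)
      (metricAt_eq_metricIn g (hc ⟨hle, le_rfl⟩).2 _ _).symm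
      (metricAt_eq_metricIn g (hc ⟨le_rfl, hle⟩).2 _ _).symm
  rw [Finset.sum_congr rfl hF, Finset.sum_range_sub (fun i ↦ F (S.t i)), S.first, S.last]
  have hF0 : ∀ t ∉ Ioo (0 : ℝ) 1, F t = 0 := fun t ht ↦
    (congrArg (metricAt g (γ t) (covDeriv g γ ξ t)) (η.2.2 t ht)).trans
      (map_zero (metricAt g (γ t) (covDeriv g γ ξ t)))
  rw [hF0 1 (by simp), hF0 0 (by simp), sub_zero]

/-- Every relative neighbourhood contains a nondegenerate closed one, also at `0` and `1`; the
regularity of weak solutions is applied on such intervals. -/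
lemma exists_Icc_mem_nhdsWithin {s : Set ℝ} {t : ℝ} (ht : t ∈ Icc (0 : ℝ) 1)
    (hs : s ∈ 𝓝[Icc 0 1] t) : ∃ a b, 0 ≤ a ∧ a < b ∧ b ≤ 1 ∧ t ∈ Icc a b ∧ Icc a b ⊆ s ∧
      Icc a b ∈ 𝓝[Icc 0 1] t := by
  obtain ⟨ε, hε, h⟩ := Metric.mem_nhdsWithin_iff.1 hs
  refine ⟨max 0 (t - ε / 2), min 1 (t + ε / 2), le_max_left _ _, ?_, min_le_left _ _, ?_, ?_, ?_⟩
  · rw [max_lt_iff, lt_min_iff, lt_min_iff]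
    exact ⟨⟨one_pos, by linarith [ht.1]⟩, by linarith [ht.2], by linarith⟩
  · exact ⟨max_le ht.1 (by linarith), le_min ht.2 (by linarith)⟩
  · intro x hx
    refine h ⟨?_, (le_max_left _ _).trans hx.1, hx.2.trans (min_le_left _ _)⟩
    rw [Metric.mem_ball, Real.dist_eq, abs_lt]
    have h1 := (le_max_right _ _).trans hx.1
    have h2 := hx.2.trans (min_le_right _ _)
    constructor <;> linarith
  · refine Metric.mem_nhdsWithin_iff.2 ⟨ε / 2, by positivity, fun x hx ↦ ?_⟩
    have h1 := abs_lt.1 (Real.dist_eq x t ▸ Metric.mem_ball.1 hx.1)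
    exact ⟨max_le hx.2.1 (by linarith), le_min hx.2.2 (by linarith)⟩

/-- Elements of the kernel of the index form are Jacobi fields. -/
lemma isJacobiField_of_mem_ker (hγ : ContMDiffOn 𝓘(ℝ, ℝ) (𝓡 n) ∞ γ (Icc 0 1))
    (hV : IsSmoothPotential n V) (ξ : H10 γ S)
    (h : ∀ η : H10 γ S, hessianForm g V γ ξ.field η.field = 0) :
    IsJacobiField g V γ ξ.field := by
  have key : ∀ c, ∀ t ∈ chartDom n c γ, ∃ s ∈ 𝓝[Icc 0 1] t, t ∈ s ∧ s ⊆ chartDom n c γ ∧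
      UniqueDiffOn ℝ s ∧ ∃ p : ℝ → Eucl n,
      ContDiffOn ℝ ∞ (fieldIn γ ξ.field c) s ∧ ContDiffOn ℝ ∞ p s ∧
      ∀ r ∈ s, HasDerivWithinAt (fieldIn γ ξ.field c)
          (sharpL (metricIn g c (curveIn c γ r)) (p r)
            - connIn g γ c r (fieldIn γ ξ.field c r)) s r ∧
        HasDerivWithinAt p (transposeL (connIn g γ c r) (p r)
          - rieszL n (tidalIn g V γ c r (fieldIn γ ξ.field c r))) s r := by
    intro c t ht
    obtain ⟨a, b, ha, hab, hb, htab, hc, hmem⟩ :=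
      exists_Icc_mem_nhdsWithin ht.1 (chartDom_mem_nhdsWithin hγ.continuousOn ht)
    have hsrc : ∀ r ∈ Icc a b, γ r ∈ (chartAt (Eucl n) c).source := fun r hr ↦ (hc hr).2
    refine ⟨Icc a b, hmem, htab, hc, uniqueDiffOn_Icc hab, ?_⟩
    refine exists_momentum_of_weak hab ((contDiffOn_metricIn_curveIn hγ c).mono hc)
      ((contDiffOn_connIn hγ c).mono hc) ((contDiffOn_tidalIn hγ hV c).mono hc)
      (fun r hr ↦ (isMetricOn_metricIn g c).invertible _ (curveIn_mem_target (hc hr)))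
      (ξ.2.1 c a b ha hab.le hb hsrc) fun w hw hwa hwb ↦ ?_
    have h1 := h ⟨_, localField_mem hγ ha hab.le hb hsrc hw hwa hwb⟩
    exact (hessianForm_localField hγ hV ξ ha hab.le hb hsrc hw hwa hwb).symm.trans h1
  have hsm : ContMDiffOn 𝓘(ℝ, ℝ) (𝓡 n).tangent ∞
      (fun x ↦ (⟨γ x, ξ.field x⟩ : TangentBundle (𝓡 n) M)) (Icc 0 1) := by
    refine (contMDiffOn_field_iff hγ).2 fun c t ht ↦ ?_
    obtain ⟨s, hs, hts, -, -, p, hu, -⟩ := key c t ht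
    exact (hu t hts).mono_of_mem_nhdsWithin hs
  refine ⟨hsm, fun t ht ↦ ?_⟩
  set c := γ t with hcdef
  have htc : t ∈ chartDom n c γ := ⟨ht, mem_source_self _⟩
  obtain ⟨s, hs, hts, hsc, hsu, p, hu, hp, hd⟩ := key c t htc
  let N : ℝ → Eucl n →L[ℝ] Eucl n := fun r ↦ sharpL (metricIn g c (curveIn c γ r))
  have hsI : s ⊆ Icc 0 1 := hsc.trans inter_subset_left
  have hinv : ∀ r ∈ s, (metricIn g c (curveIn c γ r)).IsInvertible := fun r hr ↦
    (isMetricOn_metricIn g c).invertible _ (curveIn_mem_target (hsc hr))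
  -- Comparing the derivative of `ξ` from the system with that of the smooth field identifies `p` as
  -- the lowered covariant derivative of `ξ`.
  have hcov : ∀ r ∈ s, fieldIn γ (covDeriv g γ ξ.field) c r = N r (p r) := by
    intro r hr
    have h1 := hasDerivWithinAt_fieldIn hγ hsm c (hsc hr)
    rw [fieldIn_covDeriv g hγ (hsc hr) h1,
      (hsu r hr).eq_deriv _ (h1.mono hsI) (hd r hr).1]
    exact sub_add_cancel _ _
  have hYd := (contDiffOn_fieldIn_covDeriv hγ hsm c g).differentiableOn (by simp) t htc
  have hYd' := hYd.hasDerivWithinAt.mono_of_mem_nhdsWithin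
    (chartDom_mem_nhdsWithin hγ.continuousOn htc)
  obtain ⟨f, hf, hf'⟩ := hasDerivWithinAt_metricIn_apply g hγ htc hYd'
  have hpf : HasDerivWithinAt p (rieszL n f) s t := by
    refine ((rieszL n).hasFDerivAt.comp_hasDerivWithinAt t (hf.mono hsI)).congr_of_mem
      (fun r hr ↦ ?_) hts
    refine Eq.trans ?_ (congrArg (fun z ↦ rieszL n (metricIn g c (curveIn c γ r) z)) (hcov r hr)).symm
    simp only [N]
    rw [apply_sharpL (hinv r hr)]
    refine ext_inner_right ℝ fun w ↦ ?_
    rw [inner_rieszL, innerSL_apply_apply]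
  -- Two expressions for `p'`, one from metric compatibility and one from the system. After
  -- cancelling the connection term their equality is the lowered Jacobi equation.
  have hfe := (hsu t hts).eq_deriv _ hpf (hd t hts).2
  have hcc := fieldIn_covDeriv g hγ htc hYd'
  have hGz : ∀ w, metricIn g c (curveIn c γ t)
      (fieldIn γ (covDeriv g γ (covDeriv g γ ξ.field) + jacobiPotential g V γ ξ.field) c t) w
        = 0 := by
    intro w
    have h1 := congrArg (fun z ↦ ⟪z, w⟫_ℝ) hfe
    simp only [inner_sub_left, inner_rieszL, inner_transposeL] at h1
    rw [hf'] at h1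
    have h2 : metricIn g c (curveIn c γ t) (fieldIn γ (covDeriv g γ ξ.field) c t)
        (connIn g γ c t w) = ⟪p t, connIn g γ c t w⟫_ℝ := by
      rw [hcov t hts, apply_sharpL (hinv t hts), innerSL_apply_apply]
    rw [h2] at h1
    have h3 := congrFun (fieldIn_add γ (covDeriv g γ (covDeriv g γ ξ.field))
      (jacobiPotential g V γ ξ.field) c) t
    rw [h3, map_add, add_apply, metricIn_jacobiPotential hV ξ.field htc, hcc]
    have h4 : connIn g γ c t (fieldIn γ (covDeriv g γ ξ.field) c t)
      = chr (metricIn g c) (curveIn c γ t) (velIn c γ t)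
        (fieldIn γ (covDeriv g γ ξ.field) c t) := rfl
    rw [← h4]
    linarith
  have hz : fieldIn γ (covDeriv g γ (covDeriv g γ ξ.field) + jacobiPotential g V γ ξ.field) c t
      = 0 := by
    obtain ⟨e, he⟩ := hinv t hts
    have h1 : metricIn g c (curveIn c γ t) (fieldIn γ
      (covDeriv g γ (covDeriv g γ ξ.field) + jacobiPotential g V γ ξ.field) c t) = 0 :=
      ContinuousLinearMap.ext hGz
    rw [← he] at h1
    exact e.map_eq_zero_iff.1 h1
  exact fieldIn_inj (ξ := covDeriv g γ (covDeriv g γ ξ.field) + jacobiPotential g V γ ξ.field)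
    (η := 0) htc.2 (hz.trans (fieldIn_eq_zero rfl c).symm)

/-- The kernel of the index form is trivial if and only if `1` is not a conjugate instant. -/
theorem ker_trivial_iff_not_isConjugateInstant (hγ : ContMDiffOn 𝓘(ℝ, ℝ) (𝓡 n) ∞ γ (Icc 0 1))
    (hV : IsSmoothPotential n V) :
    (∀ ξ : H10 γ S, (∀ η : H10 γ S, hessianForm g V γ ξ.field η.field = 0) → ξ = 0) ↔
      ¬ IsConjugateInstant g V γ 1 := by
  constructor
  · rintro h ⟨-, ξ, hξ, ⟨t, ht, hne⟩, h0, h1⟩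
    obtain ⟨ζ, hζ, hker⟩ := exists_mem_ker_of_isJacobiField (S := S) hγ hV hξ h0 h1
    have hz := h ζ hker
    subst hz
    exact hne (hζ t ht).symm
  · intro h ξ hξ
    by_contra hne
    refine h ⟨⟨one_pos, le_rfl⟩, ξ.field, isJacobiField_of_mem_ker hγ hV ξ hξ, ?_,
      ξ.2.2 0 (by simp), ξ.2.2 1 (by simp)⟩
    by_contra hcon
    push Not at hcon
    refine hne (Subtype.ext (funext fun t ↦ ?_))
    by_cases ht : t ∈ Icc (0 : ℝ) 1
    · exact hcon t ht
    · exact ξ.2.2 t fun h ↦ ht (Ioo_subset_Icc_self h)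

end JacobiFields

/-! ### Pointwise formulas for the second variation -/

section VariationCalculus

variable {E : Type*} [NormedAddCommGroup E] [NormedSpace ℝ E]

/-- The integrand of the second variation, up to the derivative of a boundary term. -/
lemma IsMetricOn.second_variation_identity [CompleteSpace E] {G : E → E →L[ℝ] E →L[ℝ] ℝ}
    {U : Set E} (hG : IsMetricOn G U) {y : E} (hy : y ∈ U) (f : E → ℝ) (p u w a b : E) :
    (1 / 2 : ℝ) * fderiv ℝ (fderiv ℝ G) y u u p p + (1 / 2 : ℝ) * fderiv ℝ G y a p p
        + 2 * fderiv ℝ G y u w p + G y b p + G y w w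
        - fderiv ℝ (fderiv ℝ f) y u u - fderiv ℝ f y a
      = G y (w + chr G y p u) (w + chr G y p u) - tidalForm G f y p u u
        + (G y (b + (fderiv ℝ (chrL G) y p u u + chr G y w u + chr G y u w)
            + chr G y p (a + chr G y u u)) p
          - fderiv ℝ f y (a + chr G y u u)) := by
  -- In the application `p = ∂ₓα`, `u = ∂ₛα`, `w = ∂ₓ∂ₛα`, `a = ∂ₛ²α`, `b = ∂ₓ∂ₛ²α`, and the last
  -- bracket becomes the derivative of the boundary term by the geodesic equation. Once everything
  -- is expressed by derivatives of `G` and by Christoffel symbols, the identity follows from the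
  -- symmetries alone.
  rw [hG.tidalForm_apply hy, hG.apply_curv hy]
  simp only [map_add, add_apply, chr_add_right, hG.apply_fderiv_chrL hy, hG.fderiv_apply hy,
    koszul_apply]
  have hc := hG.snd_fderiv_comm hy
  have hs := hG.snd_fderiv_symm hy
  rw [hc u p, hs p u p u, hG.chr_symm hy u w, hG.chr_symm hy u p, hG.chr_symm hy a p,
    hG.symm y hy w (chr G y p u), hG.symm y hy (chr G y u u)]
  ring

/-- First derivative of a Lagrangian along a one parameter family. -/
lemma hasDerivAt_lagrangian {G : E → E →L[ℝ] E →L[ℝ] ℝ} {U : Set E} (hG : IsMetricOn G U)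
    {f : E → ℝ} {y p : ℝ → E} {y' p' : E} {s : ℝ} (hyU : y s ∈ U)
    (hf : DifferentiableAt ℝ f (y s)) (hy : HasDerivAt y y' s) (hp : HasDerivAt p p' s) :
    HasDerivAt (fun r ↦ (1 / 2 : ℝ) * G (y r) (p r) (p r) - f (y r))
      ((1 / 2 : ℝ) * fderiv ℝ G (y s) y' (p s) (p s) + G (y s) p' (p s)
        - fderiv ℝ f (y s) y') s := by
  have h1 := (hG.differentiableAt hyU).hasFDerivAt.comp_hasDerivAt s hy
  have h2 := (((h1.clm_apply hp).clm_apply hp).const_mul (1 / 2 : ℝ)).sub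
    (hf.hasFDerivAt.comp_hasDerivAt s hy)
  refine h2.congr_deriv ?_
  simp only [Function.comp_apply, add_apply, hG.symm _ hyU (p s) p']
  ring

/-- Second derivative of a Lagrangian along a one parameter family. -/
lemma hasDerivAt_hasDerivAt_lagrangian {G : E → E →L[ℝ] E →L[ℝ] ℝ} {U : Set E}
    (hG : IsMetricOn G U)
    {f : E → ℝ} {y p y₁ p₁ : ℝ → E} {y₂ p₂ : E} {s : ℝ} (hyU : y s ∈ U)
    (hf : ContDiffAt ℝ ∞ f (y s)) (hy : HasDerivAt y (y₁ s) s) (hp : HasDerivAt p (p₁ s) s)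
    (hy₁ : HasDerivAt y₁ y₂ s) (hp₁ : HasDerivAt p₁ p₂ s) :
    HasDerivAt (fun r ↦ (1 / 2 : ℝ) * fderiv ℝ G (y r) (y₁ r) (p r) (p r) + G (y r) (p₁ r) (p r)
        - fderiv ℝ f (y r) (y₁ r))
      ((1 / 2 : ℝ) * fderiv ℝ (fderiv ℝ G) (y s) (y₁ s) (y₁ s) (p s) (p s)
        + (1 / 2 : ℝ) * fderiv ℝ G (y s) y₂ (p s) (p s)
        + 2 * fderiv ℝ G (y s) (y₁ s) (p₁ s) (p s) + G (y s) p₂ (p s) + G (y s) (p₁ s) (p₁ s)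
        - fderiv ℝ (fderiv ℝ f) (y s) (y₁ s) (y₁ s) - fderiv ℝ f (y s) y₂) s := by
  have hf' : ContDiffAt ℝ ∞ (fderiv ℝ f) (y s) := hf.fderiv_right (by simp)
  have h1 := (hG.differentiableAt hyU).hasFDerivAt.comp_hasDerivAt s hy
  have h2 := (hG.differentiableAt_fderiv hyU).hasFDerivAt.comp_hasDerivAt s hy
  have h3 := (hf'.differentiableAt (by simp)).hasFDerivAt.comp_hasDerivAt s hy
  have h4 := (((((h2.clm_apply hy₁).clm_apply hp).clm_apply hp).const_mul (1 / 2 : ℝ)).add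
    ((h1.clm_apply hp₁).clm_apply hp)).sub (h3.clm_apply hy₁)
  refine h4.congr_deriv ?_
  simp only [Function.comp_apply, add_apply, hG.fderiv_symm hyU (y₁ s) (p s) (p₁ s)]
  ring

end VariationCalculus

/-! ### Partial derivatives on a strip that contains its lateral boundary -/

section TwoParameters

variable {F : Type*} [NormedAddCommGroup F] [NormedSpace ℝ F] {δ a b : ℝ}

/-- The parameter domain of a variation. -/
abbrev strip (δ a b : ℝ) : Set (ℝ × ℝ) := Ioo (-δ) δ ×ˢ Icc a b

lemma uniqueDiffOn_strip (hab : a < b) : UniqueDiffOn ℝ (strip δ a b) :=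
  isOpen_Ioo.uniqueDiffOn.prod (uniqueDiffOn_Icc hab)

/-- Needed for the symmetry of second derivatives at the boundary points of the strip. -/
lemma mem_closure_interior_strip (hab : a < b) {z : ℝ × ℝ} (hz : z ∈ strip δ a b) :
    z ∈ closure (interior (strip δ a b)) := by
  rw [interior_prod_eq, interior_Ioo, interior_Icc, closure_prod_eq]
  exact ⟨subset_closure hz.1, by rw [closure_Ioo hab.ne]; exact hz.2⟩

/-- The derivative with respect to the first parameter. -/
def pd₁ (δ a b : ℝ) (f : ℝ × ℝ → F) (z : ℝ × ℝ) : F := fderivWithin ℝ f (strip δ a b) z (1, 0)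

/-- The derivative with respect to the second parameter. -/
def pd₂ (δ a b : ℝ) (f : ℝ × ℝ → F) (z : ℝ × ℝ) : F := fderivWithin ℝ f (strip δ a b) z (0, 1)

variable {f : ℝ × ℝ → F}

lemma contDiffOn_pd₁ (hab : a < b) (hf : ContDiffOn ℝ ∞ f (strip δ a b)) :
    ContDiffOn ℝ ∞ (pd₁ δ a b f) (strip δ a b) :=
  (hf.fderivWithin (uniqueDiffOn_strip hab) (by simp)).clm_apply contDiffOn_const

lemma contDiffOn_pd₂ (hab : a < b) (hf : ContDiffOn ℝ ∞ f (strip δ a b)) :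
    ContDiffOn ℝ ∞ (pd₂ δ a b f) (strip δ a b) :=
  (hf.fderivWithin (uniqueDiffOn_strip hab) (by simp)).clm_apply contDiffOn_const

lemma hasDerivAt_pd₁ (hf : ContDiffOn ℝ ∞ f (strip δ a b)) {s x : ℝ} (hs : s ∈ Ioo (-δ) δ)
    (hx : x ∈ Icc a b) : HasDerivAt (fun r ↦ f (r, x)) (pd₁ δ a b f (s, x)) s := by
  have hz : (s, x) ∈ strip δ a b := ⟨hs, hx⟩
  have h1 := (hf.differentiableOn (by simp) (s, x) hz).hasFDerivWithinAt
  have h2 : HasDerivWithinAt (fun r : ℝ ↦ (r, x)) ((1 : ℝ), (0 : ℝ)) (Ioo (-δ) δ) s :=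
    ((hasDerivAt_id s).prodMk (hasDerivAt_const s x)).hasDerivWithinAt
  have hm : MapsTo (fun r : ℝ ↦ (r, x)) (Ioo (-δ) δ) (strip δ a b) := fun r hr ↦ ⟨hr, hx⟩
  exact (h1.comp_hasDerivWithinAt s h2 hm).hasDerivAt (isOpen_Ioo.mem_nhds hs)

lemma hasDerivWithinAt_pd₂ (hf : ContDiffOn ℝ ∞ f (strip δ a b)) {s x : ℝ} (hs : s ∈ Ioo (-δ) δ)
    (hx : x ∈ Icc a b) :
    HasDerivWithinAt (fun r ↦ f (s, r)) (pd₂ δ a b f (s, x)) (Icc a b) x := by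
  have hz : (s, x) ∈ strip δ a b := ⟨hs, hx⟩
  have h1 := (hf.differentiableOn (by simp) (s, x) hz).hasFDerivWithinAt
  have h2 : HasDerivWithinAt (fun r : ℝ ↦ (s, r)) ((0 : ℝ), (1 : ℝ)) (Icc a b) x :=
    ((hasDerivAt_const x s).prodMk (hasDerivAt_id x)).hasDerivWithinAt
  exact h1.comp_hasDerivWithinAt x h2 fun r hr ↦ ⟨hs, hr⟩

lemma pd₁_pd₂ (hab : a < b) (hf : ContDiffOn ℝ ∞ f (strip δ a b)) {z : ℝ × ℝ}
    (hz : z ∈ strip δ a b) : pd₁ δ a b (pd₂ δ a b f) z = pd₂ δ a b (pd₁ δ a b f) z := by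
  have hu := uniqueDiffOn_strip (δ := δ) hab z hz
  have h1 : DifferentiableWithinAt ℝ (fderivWithin ℝ f (strip δ a b)) (strip δ a b) z :=
    ((hf.fderivWithin (m := ∞) (uniqueDiffOn_strip hab) (by simp)).differentiableOn (by simp)) z hz
  have h2 := (hf z hz).isSymmSndFDerivWithinAt (by simp; norm_cast) (uniqueDiffOn_strip hab)
    (mem_closure_interior_strip hab hz) hz
  have h3 : ∀ v w : ℝ × ℝ, fderivWithin ℝ (fun y ↦ fderivWithin ℝ f (strip δ a b) y v)
      (strip δ a b) z w = fderivWithin ℝ (fderivWithin ℝ f (strip δ a b)) (strip δ a b) z w v := by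
    intro v w
    rw [(h1.hasFDerivWithinAt.clm_apply (hasFDerivWithinAt_const v z _)).fderivWithin hu]
    simp
  exact (h3 _ _).trans ((h2 _ _).trans (h3 _ _).symm)

/-- Differentiation of an integral with respect to a parameter. -/
lemma hasDerivAt_integral_pd₁ {f : ℝ × ℝ → ℝ} (hab : a < b)
    (hf : ContDiffOn ℝ ∞ f (strip δ a b)) {s : ℝ} (hs : s ∈ Ioo (-δ) δ) :
    HasDerivAt (fun r ↦ ∫ x in a..b, f (r, x)) (∫ x in a..b, pd₁ δ a b f (s, x)) s := by
  -- A smaller closed ball around `s` stays inside the open parameter interval; compactness then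
  -- bounds the derivative uniformly, as domination requires.
  obtain ⟨ρ, hρ, hρs⟩ := Metric.isOpen_iff.1 isOpen_Ioo s hs
  have hρ' : Metric.closedBall s (ρ / 2) ⊆ Ioo (-δ) δ :=
    (Metric.closedBall_subset_ball (by linarith)).trans hρs
  have hc : IsCompact (Metric.closedBall s (ρ / 2) ×ˢ Icc a b) :=
    (isCompact_closedBall _ _).prod isCompact_Icc
  obtain ⟨C, hC⟩ := hc.exists_bound_of_continuousOn
    ((contDiffOn_pd₁ hab hf).continuousOn.mono (prod_mono_left hρ'))
  have hcont : ∀ h : ℝ × ℝ → ℝ, ContinuousOn h (strip δ a b) → ∀ r ∈ Ioo (-δ) δ,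
      ContinuousOn (fun x ↦ h (r, x)) (Icc a b) := fun h hh r hr ↦
    hh.comp (Continuous.prodMk_right r).continuousOn fun x hx ↦ ⟨hr, hx⟩
  have hii : ∀ h : ℝ × ℝ → ℝ, ContinuousOn h (strip δ a b) → ∀ r ∈ Ioo (-δ) δ,
      IntervalIntegrable (fun x ↦ h (r, x)) volume a b := fun h hh r hr ↦
    (hcont h hh r hr).intervalIntegrable_of_Icc hab.le
  refine (intervalIntegral.hasDerivAt_integral_of_dominated_loc_of_deriv_le
    (F' := fun r x ↦ pd₁ δ a b f (r, x)) (bound := fun _ ↦ C)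
    (Metric.ball_mem_nhds s (half_pos hρ)) ?_ (hii f hf.continuousOn s hs)
    (by rw [uIoc_of_le hab.le]; exact (hii _ (contDiffOn_pd₁ hab hf).continuousOn s hs).aestronglyMeasurable) ?_
    intervalIntegrable_const ?_).2
  · filter_upwards [isOpen_Ioo.mem_nhds hs] with r hr
    rw [uIoc_of_le hab.le]
    exact (hii f hf.continuousOn r hr).aestronglyMeasurable
  · refine Eventually.of_forall fun x hx r hr ↦ hC (r, x) ⟨Metric.ball_subset_closedBall hr, ?_⟩
    rw [uIoc_of_le hab.le] at hx
    exact Ioc_subset_Icc_self hx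
  · refine Eventually.of_forall fun x hx r hr ↦ ?_
    rw [uIoc_of_le hab.le] at hx
    exact hasDerivAt_pd₁ hf (hρ' (Metric.ball_subset_closedBall hr)) (Ioc_subset_Icc_self hx)

end TwoParameters

/-! ### Variations of a curve in coordinates -/

section VariationInCharts

variable {n ν : ℕ} {M : Type*} [TopologicalSpace M] [ChartedSpace (Eucl n) M]
  [IsManifold (𝓡 n) ∞ M] {γ : ℝ → M} {g : SemiRiemannianMetric n ν M} {V : ℝ → M → ℝ}
  {ξ : FieldAlong (n := n) γ} {ε : ℝ} {α : ℝ → ℝ → M}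

/-- The coordinate expression of the transversal acceleration `D (∂α/∂s) / ds` at `s = 0`. -/
def accelIn (g : SemiRiemannianMetric n ν M) (γ : ℝ → M) (ξ : FieldAlong (n := n) γ)
    (α : ℝ → ℝ → M) (c : M) (t : ℝ) : Eucl n :=
  deriv (deriv fun s ↦ extChartAt (𝓡 n) c (α s t)) 0
    + chr (metricIn g c) (curveIn c γ t) (fieldIn γ ξ c t) (fieldIn γ ξ c t)

/-- The boundary term `g (D (∂α/∂s) / ds, γ')` of the second variation. -/
def boundaryTerm (g : SemiRiemannianMetric n ν M) (γ : ℝ → M) (ξ : FieldAlong (n := n) γ)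
    (α : ℝ → ℝ → M) (c : M) (t : ℝ) : ℝ :=
  metricIn g c (curveIn c γ t) (accelIn g γ ξ α c t) (velIn c γ t)

lemma toChart_congr {c p q : M} {v : TangentSpace (𝓡 n) p} {w : TangentSpace (𝓡 n) q}
    (h : (⟨p, v⟩ : TangentBundle (𝓡 n) M) = ⟨q, w⟩) : toChart c p v = toChart c q w := by
  cases h
  rfl

lemma contDiffAt_deriv {E : Type*} [NormedAddCommGroup E] [NormedSpace ℝ E] {y : ℝ → E} {s : ℝ}
    (h : ContDiffAt ℝ ∞ y s) : ContDiffAt ℝ ∞ (deriv y) s :=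
  (h.fderiv_right (m := ∞) (by simp)).clm_apply contDiffAt_const

/-- Second derivative of the image of a curve. -/
lemma deriv_deriv_comp {E F : Type*} [NormedAddCommGroup E] [NormedSpace ℝ E]
    [NormedAddCommGroup F] [NormedSpace ℝ F] {φ : E → F} {y : ℝ → E} {z : ℝ → F} {s : ℝ}
    (hφ : ContDiffAt ℝ ∞ φ (y s)) (hy : ContDiffAt ℝ ∞ y s) (hz : z =ᶠ[𝓝 s] φ ∘ y) :
    deriv (deriv z) s = fderiv ℝ (fderiv ℝ φ) (y s) (deriv y s) (deriv y s)
      + fderiv ℝ φ (y s) (deriv (deriv y) s) := by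
  have hφ' : ContDiffAt ℝ ∞ (fderiv ℝ φ) (y s) := hφ.fderiv_right (by simp)
  have h1 : deriv z =ᶠ[𝓝 s] fun r ↦ fderiv ℝ φ (y r) (deriv y r) := by
    filter_upwards [hz.eventuallyEq_nhds, (hy.of_le (m := 1) (by simp)).eventually (by simp),
      hy.continuousAt.eventually ((hφ.of_le (m := 1) (by simp)).eventually (by simp))]
      with r h1 h2 h3
    exact (((h3.differentiableAt (by simp)).hasFDerivAt.comp_hasDerivAt r
      (h2.differentiableAt (by simp)).hasDerivAt).congr_of_eventuallyEq h1).deriv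
  have h2 : HasDerivAt (fun r ↦ fderiv ℝ φ (y r)) (fderiv ℝ (fderiv ℝ φ) (y s) (deriv y s)) s :=
    (hφ'.differentiableAt (by simp)).hasFDerivAt.comp_hasDerivAt s
      (hy.differentiableAt (by simp)).hasDerivAt
  exact ((h2.clm_apply ((contDiffAt_deriv hy).differentiableAt
    (by simp)).hasDerivAt).congr_of_eventuallyEq h1).deriv

namespace IsVariation

lemma apply_zero (h : IsVariation γ ξ ε α) {t : ℝ} (ht : t ∈ Icc (0 : ℝ) 1) : α 0 t = γ t :=
  congrArg (fun z : TangentBundle (𝓡 n) M ↦ z.1) (h.field t ht)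

lemma zero_mem (h : IsVariation γ ξ ε α) : (0 : ℝ) ∈ Ioo (-ε) ε :=
  ⟨neg_lt_zero.2 h.pos, h.pos⟩

lemma contMDiffAt_left (h : IsVariation γ ξ ε α) {t : ℝ} (ht : t ∈ Icc (0 : ℝ) 1) :
    ContMDiffAt 𝓘(ℝ, ℝ) (𝓡 n) ∞ (fun s ↦ α s t) 0 := by
  have h1 : ContMDiffOn 𝓘(ℝ, ℝ) (𝓡 n) ∞ (fun s ↦ α s t) (Ioo (-ε) ε) :=
    h.smooth.comp (f := fun s : ℝ ↦ (s, t)) (contMDiffOn_id.prodMk contMDiffOn_const)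
      fun _ hs ↦ ⟨hs, ht⟩
  exact h1.contMDiffAt (isOpen_Ioo.mem_nhds h.zero_mem)

lemma contMDiffOn_right (h : IsVariation γ ξ ε α) {s : ℝ} (hs : s ∈ Ioo (-ε) ε) :
    ContMDiffOn 𝓘(ℝ, ℝ) (𝓡 n) ∞ (α s) (Icc 0 1) :=
  h.smooth.comp (f := fun t : ℝ ↦ (s, t)) (contMDiffOn_const.prodMk contMDiffOn_id)
    fun _ ht ↦ ⟨hs, ht⟩

lemma contDiffAt_coord (h : IsVariation γ ξ ε α) {c : M} {t : ℝ} (ht : t ∈ chartDom n c γ) :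
    ContDiffAt ℝ ∞ (fun s ↦ extChartAt (𝓡 n) c (α s t)) 0 := by
  refine contMDiffAt_iff_contDiffAt.1 (ContMDiffAt.comp (0 : ℝ) (g := extChartAt (𝓡 n) c) ?_
    (h.contMDiffAt_left ht.1))
  refine contMDiffAt_extChartAt' ?_
  rw [h.apply_zero ht.1]
  exact ht.2

lemma deriv_coord (h : IsVariation γ ξ ε α) {c : M} {t : ℝ} (ht : t ∈ chartDom n c γ) :
    deriv (fun s ↦ extChartAt (𝓡 n) c (α s t)) 0 = fieldIn γ ξ c t := by
  have hm : MDifferentiableWithinAt 𝓘(ℝ, ℝ) (𝓡 n) (fun s ↦ α s t) univ 0 :=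
    ((h.contMDiffAt_left ht.1).mdifferentiableAt (by simp)).mdifferentiableWithinAt
  have h1 := (hasDerivWithinAt_univ.1 (hasDerivWithinAt_curveIn hm (c := c)
    (by rw [h.apply_zero ht.1]; exact ht.2))).deriv
  rw [mfderivWithin_univ] at h1
  exact h1.trans (toChart_congr (h.field t ht.1))

/-- The second derivative of the change of charts that appears in `∂ₛ²` is the inhomogeneous term in
the law of the Christoffel symbols, so the transversal acceleration is a vector. -/
lemma accelIn_trans (h : IsVariation γ ξ ε α) {c d : M} {t : ℝ} (hc : t ∈ chartDom n c γ)
    (hd : t ∈ chartDom n d γ) :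
    tangentCoordChange (𝓡 n) c d (γ t) (accelIn g γ ξ α c t) = accelIn g γ ξ α d t := by
  have hy := h.contDiffAt_coord hc
  have h0 : extChartAt (𝓡 n) c (α 0 t) = curveIn c γ t := by rw [h.apply_zero hc.1]
  have hov := mem_overlap (n := n) hc.2 hd.2
  have hφ : ContDiffAt ℝ ∞ (coordTrans (n := n) c d) (extChartAt (𝓡 n) c (α 0 t)) := by
    rw [h0]
    exact (contDiffOn_coordTrans c d).contDiffAt ((isOpen_overlap c d).mem_nhds hov)
  have hev : ∀ᶠ s in 𝓝 (0 : ℝ), α s t ∈ (chartAt (Eucl n) c).source :=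
    (h.contMDiffAt_left hc.1).continuousAt.eventually_mem ((chartAt (Eucl n) c).open_source.mem_nhds
      (by rw [h.apply_zero hc.1]; exact hc.2))
  have h3 := deriv_deriv_comp (z := fun s ↦ extChartAt (𝓡 n) d (α s t)) hφ hy (by
    filter_upwards [hev] with s hs using (coordTrans_apply hs).symm)
  rw [h0, h.deriv_coord hc, fderiv_coordTrans hc.2 hd.2] at h3
  rw [accelIn, accelIn, h3, map_add, ← christoffel_eq, christoffel_trans g hc.2 hd.2,
    fieldIn_trans ξ hc.2 hd.2, christoffel_eq]
  abel

lemma boundaryTerm_eq (h : IsVariation γ ξ ε α) {c d : M} {t : ℝ} (hc : t ∈ chartDom n c γ)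
    (hd : t ∈ chartDom n d γ) : boundaryTerm g γ ξ α c t = boundaryTerm g γ ξ α d t := by
  rw [boundaryTerm, metricIn_trans g hc.2 hd.2, h.accelIn_trans hc hd, fieldIn_trans _ hc.2 hd.2]
  rfl

/-- At a fixed end point the transversal curve is constant for small parameters, so both its first
and second derivatives vanish. -/
lemma boundaryTerm_eq_zero (h : IsVariation γ ξ ε α) {c : M} {t : ℝ} (hc : t ∈ chartDom n c γ)
    (hα : ∀ s ∈ Ioo (-ε) ε, α s t = γ t) : boundaryTerm g γ ξ α c t = 0 := by
  have h1 : (fun s ↦ extChartAt (𝓡 n) c (α s t)) =ᶠ[𝓝 0] fun _ ↦ curveIn c γ t := by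
    filter_upwards [isOpen_Ioo.mem_nhds h.zero_mem] with s hs
    rw [hα s hs]
  have h2 : fieldIn γ ξ c t = 0 := by
    rw [← h.deriv_coord hc, h1.deriv_eq]
    simp
  have h3 : accelIn g γ ξ α c t = 0 := by
    rw [accelIn, h2, h1.deriv.deriv_eq, ← chrL_apply]
    simp
  rw [boundaryTerm, h3]
  simp

/-- A variation stays in the chart domain for small parameters. -/
lemma exists_strip (h : IsVariation γ ξ ε α) {a b : ℝ} {c : M} (hc : Icc a b ⊆ chartDom n c γ) :
    ∃ δ > 0, δ ≤ ε ∧ ∀ z ∈ strip δ a b, α z.1 z.2 ∈ (chartAt (Eucl n) c).source := by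
  obtain ⟨O, hO, hO'⟩ := (continuousOn_iff'.1 h.smooth.continuousOn)
    (chartAt (Eucl n) c).source (chartAt (Eucl n) c).open_source
  have hsub : ({0} : Set ℝ) ×ˢ Icc a b ⊆ O := by
    rintro ⟨s, t⟩ ⟨hs, ht⟩
    obtain rfl : s = 0 := hs
    refine (hO'.subset ⟨?_, h.zero_mem, (hc ht).1⟩).1
    change α 0 t ∈ (chartAt (Eucl n) c).source
    rw [h.apply_zero (hc ht).1]
    exact (hc ht).2
  -- Tube lemma around the compact segment `{0} ×ˢ Icc a b`.
  obtain ⟨u, v, hu, -, h0, hv, huv⟩ := generalized_tube_lemma isCompact_singleton isCompact_Icc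
    hO hsub
  obtain ⟨ρ, hρ, hρu⟩ := Metric.isOpen_iff.1 hu 0 (h0 rfl)
  refine ⟨min ρ ε, lt_min hρ h.pos, min_le_right _ _, fun z hz ↦ ?_⟩
  have h1 : z.1 ∈ u := hρu (by
    rw [Real.ball_eq_Ioo]
    exact ⟨by linarith [hz.1.1, min_le_left ρ ε], by linarith [hz.1.2, min_le_left ρ ε]⟩)
  have h2 : z.1 ∈ Ioo (-ε) ε :=
    ⟨by linarith [hz.1.1, min_le_right ρ ε], by linarith [hz.1.2, min_le_right ρ ε]⟩
  exact (hO'.superset ⟨huv (show z ∈ u ×ˢ v from ⟨h1, hv hz.2⟩), h2, (hc hz.2).1⟩).1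

lemma contDiffOn_coord (h : IsVariation γ ξ ε α) {a b δ : ℝ} {c : M}
    (hc : Icc a b ⊆ chartDom n c γ) (hδ : δ ≤ ε)
    (hs : ∀ z ∈ strip δ a b, α z.1 z.2 ∈ (chartAt (Eucl n) c).source) :
    ContDiffOn ℝ ∞ (fun z : ℝ × ℝ ↦ extChartAt (𝓡 n) c (α z.1 z.2)) (strip δ a b) := by
  have h1 := (contMDiffOn_extChartAt (I := 𝓡 n) (n := ∞) (x := c)).comp
    (h.smooth.mono (prod_mono (Ioo_subset_Ioo (neg_le_neg hδ) hδ) fun t ht ↦ (hc ht).1)) hs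
  rw [← modelWithCornersSelf_prod, chartedSpaceSelf_prod] at h1
  exact contMDiffOn_iff_contDiffOn.1 h1

/-- The velocity is a derivative within `[0, 1]`, `pd₂` one within `[a, b]`; uniqueness of
derivatives on the smaller interval identifies them. -/
lemma velIn_eq (h : IsVariation γ ξ ε α) {a b δ : ℝ} {c : M} (hab : a < b)
    (hc : Icc a b ⊆ chartDom n c γ) (hδ : δ ≤ ε)
    (hs : ∀ z ∈ strip δ a b, α z.1 z.2 ∈ (chartAt (Eucl n) c).source)
    {s t : ℝ} (hz : (s, t) ∈ strip δ a b) :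
    velIn c (α s) t = pd₂ δ a b (fun z : ℝ × ℝ ↦ extChartAt (𝓡 n) c (α z.1 z.2)) (s, t) := by
  have h1 := hasDerivWithinAt_pd₂ (h.contDiffOn_coord hc hδ hs) hz.1 hz.2
  have h2 := hasDerivWithinAt_curveIn_velIn (h.contMDiffOn_right
    (Ioo_subset_Ioo (neg_le_neg hδ) hδ hz.1)) (c := c) (t := t) ⟨(hc hz.2).1, hs _ hz⟩
  exact (uniqueDiffOn_Icc hab t hz.2).eq_deriv _
    (h2.mono fun t ht ↦ (hc ht).1) h1

end IsVariation

/-- The equation of `γ` with lowered index, in which the gradient becomes the differential of the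
potential. -/
lemma metricIn_covDeriv_velocity (hγ : IsPGeodesic g V γ) (hV : IsSmoothPotential n V) {c : M}
    {t : ℝ} (hc : t ∈ chartDom n c γ) (w : Eucl n) :
    metricIn g c (curveIn c γ t) (fieldIn γ (covDeriv g γ (velocity γ)) c t) w
      = -fderiv ℝ (funIn c (V t)) (curveIn c γ t) w := by
  have h1 : metricAt g (γ t) (covDeriv g γ (velocity γ) t) (ofChart c (γ t) w)
      = metricIn g c (curveIn c γ t) (fieldIn γ (covDeriv g γ (velocity γ)) c t) w := by
    refine (metricAt_eq_metricIn g hc.2 _ _).trans ?_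
    rw [toChart_ofChart hc.2]
    rfl
  have h2 := metricAt_metricGradient g hV hc.1 hc.2 (ofChart c (γ t) w)
  rw [toChart_ofChart hc.2] at h2
  have h3 : ∀ a b w : Eucl n, a + b = 0 → metricAt g (γ t) a w = -metricAt g (γ t) b w := by
    intro a b w hab
    rw [eq_neg_of_add_eq_zero_left hab, map_neg, neg_apply]
  exact h1.symm.trans ((h3 _ _ _ (hγ.equation t hc.1)).trans (congrArg Neg.neg h2))

end VariationInCharts

/-! ### Differentiating the Lagrangian twice inside a chart -/

section SecondVariation

variable {n ν : ℕ} {M : Type*} [TopologicalSpace M] [ChartedSpace (Eucl n) M]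
  [IsManifold (𝓡 n) ∞ M] {γ : ℝ → M} {g : SemiRiemannianMetric n ν M} {V : ℝ → M → ℝ}
  {ξ : FieldAlong (n := n) γ} {ε : ℝ} {α : ℝ → ℝ → M} {a b δ : ℝ} {c : M}

/-- The kinetic energy density of a curve. -/
def kinetic (g : SemiRiemannianMetric n ν M) (β : ℝ → M) (x : ℝ) : ℝ :=
  (1 / 2 : ℝ) * g.val (β x) (velocity β x) (velocity β x)

lemma kinetic_eq {β : ℝ → M} {x : ℝ} (hc : β x ∈ (chartAt (Eucl n) c).source) :
    kinetic g β x = (1 / 2 : ℝ) * metricIn g c (curveIn c β x) (velIn c β x) (velIn c β x) :=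
  congrArg ((1 / 2 : ℝ) * ·) (metricAt_eq_metricIn g hc (velocity β x) (velocity β x))

/-- The Lagrangian of a variation in coordinates, where `Y` is the coordinate expression of the
variation and `P` that of its velocity. -/
def lagrangianIn (g : SemiRiemannianMetric n ν M) (V : ℝ → M → ℝ) (c : M) (Y P : ℝ × ℝ → Eucl n)
    (z : ℝ × ℝ) : ℝ :=
  (1 / 2 : ℝ) * metricIn g c (Y z) (P z) (P z) - funIn c (V z.2) (Y z)

lemma contDiffOn_lagrangianIn (hV : IsSmoothPotential n V) {Y P : ℝ × ℝ → Eucl n}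
    (h01 : Icc a b ⊆ Icc 0 1) (hY : ContDiffOn ℝ ∞ Y (strip δ a b))
    (hP : ContDiffOn ℝ ∞ P (strip δ a b))
    (hm : MapsTo Y (strip δ a b) (extChartAt (𝓡 n) c).target) :
    ContDiffOn ℝ ∞ (lagrangianIn g V c Y P) (strip δ a b) := by
  have h1 := (contDiffOn_metricIn g c).comp hY hm
  have h2 : ContDiffOn ℝ ∞ (fun z ↦ funIn c (V z.2) (Y z)) (strip δ a b) :=
    (contDiffOn_funIn hV c).comp (contDiffOn_snd.prodMk hY) fun z hz ↦ ⟨h01 hz.2, hm hz⟩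
  exact (contDiffOn_const.mul ((h1.clm_apply hP).clm_apply hP)).sub h2

/-- The second derivative of the Lagrangian with respect to the parameter. -/
lemma pd₁_pd₁_lagrangianIn (hV : IsSmoothPotential n V) {Y : ℝ × ℝ → Eucl n} (hab : a < b)
    (h01 : Icc a b ⊆ Icc 0 1) (hY : ContDiffOn ℝ ∞ Y (strip δ a b))
    (hm : MapsTo Y (strip δ a b) (extChartAt (𝓡 n) c).target) {z : ℝ × ℝ}
    (hz : z ∈ strip δ a b) :
    pd₁ δ a b (pd₁ δ a b (lagrangianIn g V c Y (pd₂ δ a b Y))) z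
      = (1 / 2 : ℝ) * fderiv ℝ (fderiv ℝ (metricIn g c)) (Y z) (pd₁ δ a b Y z) (pd₁ δ a b Y z)
          (pd₂ δ a b Y z) (pd₂ δ a b Y z)
        + (1 / 2 : ℝ) * fderiv ℝ (metricIn g c) (Y z) (pd₁ δ a b (pd₁ δ a b Y) z)
          (pd₂ δ a b Y z) (pd₂ δ a b Y z)
        + 2 * fderiv ℝ (metricIn g c) (Y z) (pd₁ δ a b Y z) (pd₂ δ a b (pd₁ δ a b Y) z)
          (pd₂ δ a b Y z)
        + metricIn g c (Y z) (pd₂ δ a b (pd₁ δ a b (pd₁ δ a b Y)) z) (pd₂ δ a b Y z)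
        + metricIn g c (Y z) (pd₂ δ a b (pd₁ δ a b Y) z) (pd₂ δ a b (pd₁ δ a b Y) z)
        - fderiv ℝ (fderiv ℝ (funIn c (V z.2))) (Y z) (pd₁ δ a b Y z) (pd₁ δ a b Y z)
        - fderiv ℝ (funIn c (V z.2)) (Y z) (pd₁ δ a b (pd₁ δ a b Y) z) := by
  obtain ⟨s, x⟩ := z
  obtain ⟨hs, hx⟩ := hz
  have hG := isMetricOn_metricIn g c
  have hL := contDiffOn_lagrangianIn (g := g) hV h01 hY (contDiffOn_pd₂ hab hY) hm
  have hY₁ := contDiffOn_pd₁ hab hY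
  have hf : ∀ r ∈ Ioo (-δ) δ, ContDiffAt ℝ ∞ (funIn c (V x)) (Y (r, x)) := fun r hr ↦
    contDiffAt_funIn hV (h01 hx) (hm (show (r, x) ∈ strip δ a b from ⟨hr, hx⟩))
  -- Mixed derivatives are rewritten with the derivative in `s` taken first, so that at `s = 0` they
  -- become derivatives along `γ` of the variation field.
  have hP : ∀ r ∈ Ioo (-δ) δ, HasDerivAt (fun r ↦ pd₂ δ a b Y (r, x))
      (pd₂ δ a b (pd₁ δ a b Y) (r, x)) r := fun r hr ↦
    (hasDerivAt_pd₁ (contDiffOn_pd₂ hab hY) hr hx).congr_deriv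
      (pd₁_pd₂ hab hY (show (r, x) ∈ strip δ a b from ⟨hr, hx⟩))
  have hmr : ∀ r ∈ Ioo (-δ) δ, Y (r, x) ∈ (extChartAt (𝓡 n) c).target := fun r hr ↦
    hm (show (r, x) ∈ strip δ a b from ⟨hr, hx⟩)
  have h1 : ∀ r ∈ Ioo (-δ) δ, pd₁ δ a b (lagrangianIn g V c Y (pd₂ δ a b Y)) (r, x)
      = (1 / 2 : ℝ) * fderiv ℝ (metricIn g c) (Y (r, x)) (pd₁ δ a b Y (r, x))
          (pd₂ δ a b Y (r, x)) (pd₂ δ a b Y (r, x))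
        + metricIn g c (Y (r, x)) (pd₂ δ a b (pd₁ δ a b Y) (r, x)) (pd₂ δ a b Y (r, x))
        - fderiv ℝ (funIn c (V x)) (Y (r, x)) (pd₁ δ a b Y (r, x)) := fun r hr ↦
    (hasDerivAt_pd₁ hL hr hx).unique (hasDerivAt_lagrangian hG (y := fun r ↦ Y (r, x))
      (p := fun r ↦ pd₂ δ a b Y (r, x)) (hmr r hr) ((hf r hr).differentiableAt (by simp))
      (hasDerivAt_pd₁ hY hr hx) (hP r hr))
  have h2 := hasDerivAt_hasDerivAt_lagrangian hG (y := fun r ↦ Y (r, x))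
      (p := fun r ↦ pd₂ δ a b Y (r, x)) (y₁ := fun r ↦ pd₁ δ a b Y (r, x))
      (p₁ := fun r ↦ pd₂ δ a b (pd₁ δ a b Y) (r, x)) (hmr s hs) (hf s hs)
      (hasDerivAt_pd₁ hY hs hx) (hP s hs) (hasDerivAt_pd₁ hY₁ hs hx)
      ((hasDerivAt_pd₁ (contDiffOn_pd₂ hab hY₁) hs hx).congr_deriv
        (pd₁_pd₂ hab hY₁ (show (s, x) ∈ strip δ a b from ⟨hs, hx⟩)))
  have h3 := h2.congr_of_eventuallyEq (f₁ := fun r ↦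
      pd₁ δ a b (lagrangianIn g V c Y (pd₂ δ a b Y)) (r, x)) (by
    filter_upwards [isOpen_Ioo.mem_nhds hs] with r hr using h1 r hr)
  exact (hasDerivAt_pd₁ (contDiffOn_pd₁ hab hL) hs hx).unique h3

/-- The integrand of the second variation is the density of the Hessian up to the derivative of
the boundary term. -/
lemma hasDerivAt_boundaryTerm (hγ : IsPGeodesic g V γ) (hV : IsSmoothPotential n V)
    (h : IsVariation γ ξ ε α) (hab : a < b) (hc : Icc a b ⊆ chartDom n c γ) (hδ : 0 < δ)
    (hδε : δ ≤ ε) (hs : ∀ z ∈ strip δ a b, α z.1 z.2 ∈ (chartAt (Eucl n) c).source)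
    {Y : ℝ × ℝ → Eucl n} (hY : Y = fun z : ℝ × ℝ ↦ extChartAt (𝓡 n) c (α z.1 z.2)) :
    ContinuousOn (boundaryTerm g γ ξ α c) (Icc a b) ∧ ∀ x ∈ Ioo a b,
      HasDerivAt (boundaryTerm g γ ξ α c)
        (pd₁ δ a b (pd₁ δ a b (lagrangianIn g V c Y (pd₂ δ a b Y))) (0, x)
          - hessianDensity g V γ ξ ξ x) x := by
  have hYs : ContDiffOn ℝ ∞ Y (strip δ a b) := hY ▸ h.contDiffOn_coord hc hδε hs
  have hY₁ := contDiffOn_pd₁ hab hYs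
  have hY₂ := contDiffOn_pd₁ hab hY₁
  have hm : MapsTo Y (strip δ a b) (extChartAt (𝓡 n) c).target := fun z hz ↦ by
    rw [hY]
    exact mem_target_of_mem_source (hs z hz)
  have h0 : (0 : ℝ) ∈ Ioo (-δ) δ := ⟨neg_lt_zero.2 hδ, hδ⟩
  have hz : ∀ x ∈ Icc a b, ((0 : ℝ), x) ∈ strip δ a b := fun x hx ↦ ⟨h0, hx⟩
  have e0 : ∀ x ∈ Icc a b, Y (0, x) = curveIn c γ x := fun x hx ↦ by
    rw [hY]
    exact congrArg (extChartAt (𝓡 n) c) (h.apply_zero (hc hx).1)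
  have e1 : ∀ x ∈ Icc a b, pd₁ δ a b Y (0, x) = fieldIn γ ξ c x := fun x hx ↦ by
    rw [← h.deriv_coord (hc hx), ← (hasDerivAt_pd₁ hYs h0 hx).deriv, hY]
  have e2 : ∀ x ∈ Icc a b, pd₁ δ a b (pd₁ δ a b Y) (0, x)
      = deriv (deriv fun s ↦ extChartAt (𝓡 n) c (α s x)) 0 := fun x hx ↦ by
    refine (((hasDerivAt_pd₁ hY₁ h0 hx).congr_of_eventuallyEq ?_).deriv).symm
    filter_upwards [isOpen_Ioo.mem_nhds h0] with s hs
    rw [← (hasDerivAt_pd₁ hYs hs hx).deriv, hY]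
  have e3 : ∀ x ∈ Icc a b, pd₂ δ a b Y (0, x) = velIn c γ x := fun x hx ↦ by
    have h1 := (hasDerivWithinAt_pd₂ hYs h0 hx).congr (f₁ := curveIn c γ)
      (fun r hr ↦ (e0 r hr).symm) (e0 x hx).symm
    exact (uniqueDiffOn_Icc hab x hx).eq_deriv _ h1
      ((hasDerivWithinAt_curveIn_velIn hγ.smooth (hc hx)).mono fun t ht ↦ (hc ht).1)
  have hG := isMetricOn_metricIn g c
  have hι : ContDiffOn ℝ ∞ (fun x : ℝ ↦ ((0 : ℝ), x)) (Icc a b) :=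
    (contDiff_prodMk_right 0).contDiffOn
  have hcurve := (contDiffOn_curveIn (n := n) hγ.smooth c).mono hc
  have hvel := (contDiffOn_velIn (n := n) hγ.smooth c).mono hc
  have hu : ContDiffOn ℝ ∞ (fieldIn γ ξ c) (Icc a b) :=
    (hY₁.comp hι hz).congr fun x hx ↦ (e1 x hx).symm
  have hacc : ContDiffOn ℝ ∞ (accelIn g γ ξ α c) (Icc a b) := by
    refine ((hY₂.comp hι hz).add (((hG.contDiffOn_chrL.comp hcurve
      fun x hx ↦ curveIn_mem_target (hc hx)).clm_apply hu).clm_apply hu)).congr fun x hx ↦ ?_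
    rw [accelIn, ← e2 x hx]
    rfl
  refine ⟨((((contDiffOn_metricIn_curveIn hγ.smooth c).mono hc).clm_apply hacc).clm_apply
    hvel).continuousOn, fun x hx ↦ ?_⟩
  have hxI := Ioo_subset_Icc_self hx
  have hcx := hc hxI
  have hn : Icc a b ∈ 𝓝 x := Icc_mem_nhds hx.1 hx.2
  have hy := curveIn_mem_target hcx
  have d0 : HasDerivAt (curveIn c γ) (velIn c γ x) x :=
    ((hasDerivWithinAt_curveIn_velIn hγ.smooth hcx).mono fun t ht ↦ (hc ht).1).hasDerivAt hn
  have d1 : HasDerivAt (fieldIn γ ξ c) (pd₂ δ a b (pd₁ δ a b Y) (0, x)) x :=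
    ((hasDerivWithinAt_pd₂ hY₁ h0 hxI).congr (fun r hr ↦ (e1 r hr).symm)
      (e1 x hxI).symm).hasDerivAt hn
  have d2 : HasDerivAt (fun t ↦ deriv (deriv fun s ↦ extChartAt (𝓡 n) c (α s t)) 0)
      (pd₂ δ a b (pd₁ δ a b (pd₁ δ a b Y)) (0, x)) x :=
    ((hasDerivWithinAt_pd₂ hY₂ h0 hxI).congr (fun r hr ↦ (e2 r hr).symm)
      (e2 x hxI).symm).hasDerivAt hn
  have d3 : HasDerivAt (velIn c γ) (deriv (velIn c γ) x) x :=
    ((hvel.contDiffAt hn).differentiableAt (by simp)).hasDerivAt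
  have d4 : HasDerivAt (fun t ↦ chrL (metricIn g c) (curveIn c γ t))
      (fderiv ℝ (chrL (metricIn g c)) (curveIn c γ x) (velIn c γ x)) x :=
    (hG.differentiableAt_chrL hy).hasFDerivAt.comp_hasDerivAt x d0
  have d5 : HasDerivAt (accelIn g γ ξ α c) (pd₂ δ a b (pd₁ δ a b (pd₁ δ a b Y)) (0, x)
      + (fderiv ℝ (chrL (metricIn g c)) (curveIn c γ x) (velIn c γ x) (fieldIn γ ξ c x)
          (fieldIn γ ξ c x)
        + chr (metricIn g c) (curveIn c γ x) (pd₂ δ a b (pd₁ δ a b Y) (0, x)) (fieldIn γ ξ c x)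
        + chr (metricIn g c) (curveIn c γ x) (fieldIn γ ξ c x)
          (pd₂ δ a b (pd₁ δ a b Y) (0, x)))) x :=
    d2.add ((d4.clm_apply d1).clm_apply d1)
  have hZ : pd₁ δ a b (pd₁ δ a b Y) (0, x)
      + chr (metricIn g c) (curveIn c γ x) (fieldIn γ ξ c x) (fieldIn γ ξ c x)
      = accelIn g γ ξ α c x := by rw [accelIn, e2 x hxI]
  obtain ⟨f, hf, hf'⟩ := hasDerivWithinAt_metricIn_apply g hγ.smooth hcx d5.hasDerivWithinAt
  have h01 : Icc (0 : ℝ) 1 ∈ 𝓝 x := mem_of_superset hn fun t ht ↦ (hc ht).1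
  have d6 := (hf.hasDerivAt h01).clm_apply d3
  have hcov := fieldIn_covDeriv g hγ.smooth hcx d3.hasDerivWithinAt
  refine d6.congr_deriv ?_
  have hid := hG.second_variation_identity hy (funIn c (V x)) (velIn c γ x) (fieldIn γ ξ c x)
    (pd₂ δ a b (pd₁ δ a b Y) (0, x)) (pd₁ δ a b (pd₁ δ a b Y) (0, x))
    (pd₂ δ a b (pd₁ δ a b (pd₁ δ a b Y)) (0, x))
  rw [pd₁_pd₁_lagrangianIn hV hab (fun t ht ↦ (hc ht).1) hYs hm (hz x hxI),
    hessianDensity_eq hγ.smooth hV hcx d1.hasDerivWithinAt d1.hasDerivWithinAt]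
  simp only [e0 x hxI, e1 x hxI, e3 x hxI]
  rw [hid, hf', hZ]
  -- The derivative of the boundary term contains `g (A, Dγ'/dx)` for the transversal acceleration
  -- `A`. The equation of `γ` turns it into `-dV (A)`, the last term of `second_variation_identity`.
  have heq := metricIn_covDeriv_velocity hγ hV hcx (accelIn g γ ξ α c x)
  rw [hcov, hG.symm _ hy, map_add] at heq
  simp only [connIn, chrL_apply, tidalIn]
  linarith

end SecondVariation

/-! ### The Hessian of the energy -/

section SecondVariationFormula

variable {n ν : ℕ} {M : Type*} [TopologicalSpace M] [ChartedSpace (Eucl n) M]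
  [IsManifold (𝓡 n) ∞ M] {γ : ℝ → M} {g : SemiRiemannianMetric n ν M} {V : ℝ → M → ℝ}
  {ξ : FieldAlong (n := n) γ} {ε : ℝ} {α : ℝ → ℝ → M} {a b δ : ℝ} {c : M}

/-- The second variation of the energy on a piece of the curve inside a chart. -/
lemma IsVariation.exists_hasDerivAt_of_chart (h : IsVariation γ ξ ε α) (hγ : IsPGeodesic g V γ)
    (hV : IsSmoothPotential n V) (hab : a ≤ b) (hc : Icc a b ⊆ chartDom n c γ)
    (hint : IntervalIntegrable (hessianDensity g V γ ξ ξ) volume a b) :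
    ∃ e : ℝ → ℝ, (∀ᶠ s in 𝓝 0, IntervalIntegrable (kinetic g (α s)) volume a b ∧
      HasDerivAt (fun r ↦ ∫ x in a..b, (kinetic g (α r) x - V x (α r x))) (e s) s) ∧
      HasDerivAt e ((∫ x in a..b, hessianDensity g V γ ξ ξ x)
        + (boundaryTerm g γ ξ α c b - boundaryTerm g γ ξ α c a)) 0 := by
  rcases hab.eq_or_lt with rfl | hlt
  · refine ⟨fun _ ↦ 0, Eventually.of_forall fun s ↦ ⟨IntervalIntegrable.refl, ?_⟩, ?_⟩
    · simpa using hasDerivAt_const s (0 : ℝ)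
    · simpa using hasDerivAt_const (0 : ℝ) (0 : ℝ)
  obtain ⟨δ, hδ, hδε, hs⟩ := h.exists_strip hc
  have h0 : (0 : ℝ) ∈ Ioo (-δ) δ := ⟨neg_lt_zero.2 hδ, hδ⟩
  obtain ⟨Y, hY⟩ : ∃ Y : ℝ × ℝ → Eucl n, Y = fun z : ℝ × ℝ ↦ extChartAt (𝓡 n) c (α z.1 z.2) :=
    ⟨_, rfl⟩
  have hYs : ContDiffOn ℝ ∞ Y (strip δ a b) := hY ▸ h.contDiffOn_coord hc hδε hs
  have hm : MapsTo Y (strip δ a b) (extChartAt (𝓡 n) c).target := fun z hz ↦ by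
    rw [hY]
    exact mem_target_of_mem_source (hs z hz)
  have hP := contDiffOn_pd₂ hlt hYs
  have hL := contDiffOn_lagrangianIn (g := g) hV (fun t ht ↦ (hc ht).1) hYs hP hm
  have hkin : ∀ s ∈ Ioo (-δ) δ, ∀ x ∈ Icc a b, kinetic g (α s) x
      = (1 / 2 : ℝ) * metricIn g c (Y (s, x)) (pd₂ δ a b Y (s, x)) (pd₂ δ a b Y (s, x)) := by
    intro s hss x hx
    have hz : (s, x) ∈ strip δ a b := ⟨hss, hx⟩
    rw [kinetic_eq (hs _ hz), h.velIn_eq hlt hc hδε hs hz, hY]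
  have hlag : ∀ s ∈ Ioo (-δ) δ, ∫ x in a..b, (kinetic g (α s) x - V x (α s x))
      = ∫ x in a..b, lagrangianIn g V c Y (pd₂ δ a b Y) (s, x) := by
    intro s hss
    refine intervalIntegral.integral_congr fun x hx ↦ ?_
    rw [uIcc_of_le hab] at hx
    rw [hkin s hss x hx, lagrangianIn, funIn, Function.comp_apply]
    congr 2
    rw [hY]
    exact (symm_extChartAt (hs (s, x) ⟨hss, hx⟩)).symm
  refine ⟨fun s ↦ ∫ x in a..b, pd₁ δ a b (lagrangianIn g V c Y (pd₂ δ a b Y)) (s, x), ?_, ?_⟩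
  · filter_upwards [isOpen_Ioo.mem_nhds h0] with s hss
    have hι : ContinuousOn (fun x : ℝ ↦ (s, x)) (Icc a b) :=
      (Continuous.prodMk_right s).continuousOn
    have hιm : MapsTo (fun x : ℝ ↦ (s, x)) (Icc a b) (strip δ a b) := fun x hx ↦ ⟨hss, hx⟩
    constructor
    · have h1 := (((((contDiffOn_metricIn g c).comp hYs hm).clm_apply hP).clm_apply
        hP).continuousOn.comp hι hιm).const_smul (1 / 2 : ℝ)
      refine ContinuousOn.intervalIntegrable_of_Icc hab (h1.congr fun x hx ↦ ?_)
      exact hkin s hss x hx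
    · refine (hasDerivAt_integral_pd₁ hlt hL hss).congr_of_eventuallyEq ?_
      filter_upwards [isOpen_Ioo.mem_nhds hss] with r hr using hlag r hr
  · refine (hasDerivAt_integral_pd₁ hlt (contDiffOn_pd₁ hlt hL) h0).congr_deriv ?_
    obtain ⟨hB, hB'⟩ := hasDerivAt_boundaryTerm hγ hV h hlt hc hδ hδε hs hY
    have h1 : IntervalIntegrable (fun x ↦
        pd₁ δ a b (pd₁ δ a b (lagrangianIn g V c Y (pd₂ δ a b Y))) (0, x)) volume a b :=
      ContinuousOn.intervalIntegrable_of_Icc hab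
        ((contDiffOn_pd₁ hlt (contDiffOn_pd₁ hlt hL)).continuousOn.comp
          (Continuous.prodMk_right (0 : ℝ)).continuousOn fun x hx ↦ ⟨h0, hx⟩)
    -- The boundary term is differentiated only in the open interval; continuity up to the ends and
    -- integrability of its derivative suffice.
    have h2 := intervalIntegral.integral_eq_sub_of_hasDerivAt_of_le hab hB hB' (h1.sub hint)
    rw [intervalIntegral.integral_sub h1 hint] at h2
    linarith

lemma IsVariation.intervalIntegrable_potential (h : IsVariation γ ξ ε α)
    (hV : IsSmoothPotential n V) {s : ℝ} (hs : s ∈ Ioo (-ε) ε) :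
    IntervalIntegrable (fun x ↦ V x (α s x)) volume 0 1 := by
  refine ContinuousOn.intervalIntegrable_of_Icc zero_le_one ?_
  exact hV.continuousOn.comp (continuousOn_id.prodMk (h.contMDiffOn_right hs).continuousOn)
    fun x hx ↦ ⟨hx, mem_univ _⟩

/-- The Hessian form is the second variation of the energy. -/
theorem isSecondVariation_hessian (hγ : IsPGeodesic g V γ) (hV : IsSmoothPotential n V)
    (S : ChartSubdivision n γ) : IsSecondVariation g V γ S (hessian g V γ S) := by
  intro ξ ε α h
  have hint : ∀ i < S.N, IntervalIntegrable (hessianDensity g V γ ξ.field ξ.field) volume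
      (S.t i) (S.t (i + 1)) := fun i hi ↦
    intervalIntegrable_hessianDensity_of_chart hγ.smooth hV (S.le_succ i) (S.subset_chartDom hi)
      (ξ.isH1On hi) (ξ.isH1On hi)
  have hpiece : ∀ i, ∃ e : ℝ → ℝ, i < S.N → (∀ᶠ s in 𝓝 0,
      IntervalIntegrable (kinetic g (α s)) volume (S.t i) (S.t (i + 1)) ∧
      HasDerivAt (fun r ↦ ∫ x in (S.t i)..(S.t (i + 1)), (kinetic g (α r) x - V x (α r x)))
        (e s) s) ∧
      HasDerivAt e ((∫ x in (S.t i)..(S.t (i + 1)), hessianDensity g V γ ξ.field ξ.field x)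
        + (boundaryTerm g γ ξ.field α (S.c i) (S.t (i + 1))
          - boundaryTerm g γ ξ.field α (S.c i) (S.t i))) 0 := by
    intro i
    by_cases hi : i < S.N
    · obtain ⟨e, he⟩ := h.exists_hasDerivAt_of_chart hγ hV (S.le_succ i) (S.subset_chartDom hi)
        (hint i hi)
      exact ⟨e, fun _ ↦ he⟩
    · exact ⟨0, fun hi' ↦ absurd hi' hi⟩
  choose e he using hpiece
  have hev : ∀ᶠ s in 𝓝 (0 : ℝ), ∀ i ∈ Finset.range S.N,
      IntervalIntegrable (kinetic g (α s)) volume (S.t i) (S.t (i + 1)) ∧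
      HasDerivAt (fun r ↦ ∫ x in (S.t i)..(S.t (i + 1)), (kinetic g (α r) x - V x (α r x)))
        (e i s) s :=
    (Finset.eventually_all _).2 fun i hi ↦ (he i (Finset.mem_range.1 hi)).1
  have henergy : ∀ᶠ s in 𝓝 (0 : ℝ), energy g V (α s)
      = ∑ i ∈ Finset.range S.N, ∫ x in (S.t i)..(S.t (i + 1)),
        (kinetic g (α s) x - V x (α s x)) := by
    filter_upwards [hev, isOpen_Ioo.mem_nhds h.zero_mem] with s hs hsε
    have h1 := IntervalIntegrable.trans_iterate (μ := volume) (f := kinetic g (α s)) (a := S.t)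
      (n := S.N) fun k hk ↦ (hs k (Finset.mem_range.2 hk)).1
    rw [S.first, S.last] at h1
    have h2 := h.intervalIntegrable_potential hV hsε
    have h3 : ∀ k < S.N, IntervalIntegrable (fun x ↦ kinetic g (α s) x - V x (α s x)) volume
        (S.t k) (S.t (k + 1)) := fun k hk ↦ (h1.sub h2).mono_set (by
      rw [uIcc_of_le zero_le_one, uIcc_of_le (S.le_succ k)]
      exact Icc_subset_Icc (S.nonneg k) (S.le_one hk))
    have h4 := intervalIntegral.sum_integral_adjacent_intervals (μ := volume) h3
    rw [h4, S.first, S.last]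
    exact (intervalIntegral.integral_sub h1 h2).symm
  refine ⟨fun s ↦ ∑ i ∈ Finset.range S.N, e i s, ?_, ?_⟩
  · filter_upwards [henergy.eventually_nhds, hev] with s h1 h2
    refine HasDerivAt.congr_of_eventuallyEq ?_ h1
    exact HasDerivAt.fun_sum fun i hi ↦ (h2 i hi).2
  · have hsum : HasDerivAt (fun s ↦ ∑ i ∈ Finset.range S.N, e i s) _ 0 :=
      HasDerivAt.fun_sum fun i hi ↦ (he i (Finset.mem_range.1 hi)).2
    refine hsum.congr_deriv ?_
    -- Each boundary value is moved to the chart at the point of `γ` itself, which depends on the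
    -- node alone, so that the sum telescopes.
    have hB : ∀ i < S.N, boundaryTerm g γ ξ.field α (S.c i) (S.t (i + 1))
        - boundaryTerm g γ ξ.field α (S.c i) (S.t i)
        = boundaryTerm g γ ξ.field α (γ (S.t (i + 1))) (S.t (i + 1))
          - boundaryTerm g γ ξ.field α (γ (S.t i)) (S.t i) := fun i hi ↦ by
      have h1 := S.subset_chartDom hi (left_mem_Icc.2 (S.le_succ i))
      have h2 := S.subset_chartDom hi (right_mem_Icc.2 (S.le_succ i))
      rw [h.boundaryTerm_eq h1 ⟨h1.1, mem_source_self _⟩,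
        h.boundaryTerm_eq h2 ⟨h2.1, mem_source_self _⟩]
    rw [Finset.sum_add_distrib, Finset.sum_congr rfl fun i hi ↦ hB i (Finset.mem_range.1 hi),
      Finset.sum_range_sub (fun i ↦ boundaryTerm g γ ξ.field α (γ (S.t i)) (S.t i)), S.first, S.last,
      h.boundaryTerm_eq_zero ⟨⟨le_rfl, zero_le_one⟩, mem_source_self _⟩ h.left,
      h.boundaryTerm_eq_zero ⟨⟨zero_le_one, le_rfl⟩, mem_source_self _⟩ h.right, sub_zero, add_zero,
      intervalIntegral.sum_integral_adjacent_intervals (μ := volume) hint, S.first, S.last]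
    rfl

end SecondVariationFormula

end SemiRiem
end

open SemiRiem
theorem proposition3p1 {n ν : ℕ} {M : Type*} [TopologicalSpace M] [T2Space M]
    [SecondCountableTopology M] [ChartedSpace (Eucl n) M] [IsManifold (𝓡 n) ∞ M]
    (g : SemiRiemannianMetric n ν M) (V : ℝ → M → ℝ) (hV : IsSmoothPotential n V)
    (γ : ℝ → M) (hγ : IsPGeodesic g V γ) (S : ChartSubdivision n γ) :
    (∀ ξ η : H10 γ S,
      IntervalIntegrable (hessianDensity g V γ ξ.field η.field) volume 0 1) ∧
    IsSecondVariation g V γ S (hessian g V γ S) ∧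
    IsFredholmForm (hessian g V γ S) ∧
    (IsNondegenerateForm (hessian g V γ S) ↔ ¬ IsConjugateInstant g V γ 1) :=
  ⟨fun ξ η ↦ intervalIntegrable_hessianDensity hγ.smooth hV ξ η,
    isSecondVariation_hessian hγ hV S, (isFredholmForm_hessian hγ.smooth hV).1,
    (isFredholmForm_hessian hγ.smooth hV).2.trans
      (ker_trivial_iff_not_isConjugateInstant hγ.smooth hV)⟩
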